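/- **Setting.** Let $D\ge 1$, $d\ge1$. Let $\mathcal O$ be the $\star$-algebra of local observables of the quantum spin lattice on $\mathbb Z^D$ with one copy of the $d\times d$ matrices at each site (the union over finite $X\subset\mathbb Z^D$ of the algebras $\bigotimes_{x\in X}M_d(\mathbb C)$, with the operator norm), or any translation-invariant unital $\star$-subalgebra of it. Let $\mathcal A$ be its norm completion, and let $\iota_x$ ($x\in\mathbb Z^D$) be the translation automorphisms. For finite $X$, $\mathcal O_X\subset\mathcal O$ denotes the observables supported on $X$. The support $\mathrm{supp}(A)$ of $A\in\mathcal O$ is the smallest $X$ with $A\in\mathcal O_X$, $|A|$ is its cardinality, and $\mathrm{dist}(A,B)$ is the distance between the supports for the metric $\sum_i|x_i-y_i|$ (infinite if a support is empty). $B(r)$ is the ball of radius $r$ about $0$. A state is a normalized positive linear functional on $\mathcal A$; $\mathrm{Tr}_{\mathcal A}$ is the normalized trace state. **Clustering.** A family $F$ of translation-invariant states is *uniformly clustering* if there are $p>D$ and $\nu:\mathbb N\to(0,\infty)$ such that for each $\omega\in F$ there is $f:\mathbb N\to[0,\infty)$ with $f(n)\le n^{-p}$ for $n>0$ and $$|\omega(AB)-\omega(A)\omega(B)|\le\nu(\ell)\,\|A\|\,\|B\|\,f(\mathrm{dist}(A,B))$$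 for all $\ell\in\mathbb N$ and all $A,B\in\mathcal O$ with $|A|,|B|<\ell$ (nothing being required when $\mathrm{dist}(A,B)=\infty$, where the left side is $0$). It is *uniformly sizably $p$-clustering* if this holds with the given $p$ and $\nu(\ell)=\nu\,\ell^{a}$ for some constants $\nu,a>0$. A state is *clustering* if $\{\omega\}$ is uniformly clustering. For clustering $\omega$ put $$\langle A,B\rangle_\omega=\sum_{x\in\mathbb Z^D}\big(\omega(\iota_x(A)^\star B)-\omega(A^\star)\omega(B)\big),\qquad \langle\langle A,B\rangle\rangle_\omega=\tfrac12\big(\langle A,B\rangle_\omega+\langle B^\star,A^\star\rangle_\omega\big).$$ **Pseudolocal charges.** Let $\omega$ be a clustering state. A sequence $Q=(Q_n)$ with $Q_n\in\mathcal O_{B(n)}$ is *pseudolocal* with respect to $\omega$ if $\tilde Q_n=Q_n-\omega(Q_n)\mathbf 1$ satisfies: (I) there is $\gamma>0$ with $\omega(\tilde Q_n^\star\tilde Q_n)\le\gamma n^D$ for all $n>0$; (II) $\lim_n\omega(\tilde Q_n^\star A)$ exists for all $A\in\mathcal O$; (III) there is $0<k<1$ such that for all $A\in\mathcal O$, $\lim_n\max_{x,y\in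 B(kn)}|\omega(\tilde Q_n^\star\iota_x(A))-\omega(\tilde Q_n^\star\iota_y(A))|=0$. A *pseudolocal charge* with respect to $\omega$ is a functional on $\mathcal O$ of the form $\widehat Q(A)=\lim_n\big(\tfrac12\omega(Q_n^\star A+AQ_n^\star)-\omega(Q_n^\star)\omega(A)\big)$, where $(Q_n)$ and $(Q_n^\star)$ are both pseudolocal. **Flows and pseudolocal states.** A *pseudolocal flow* is a family $\{\omega_s:s\in[0,1]\}$ of clustering states together with pseudolocal charges $\widehat Q_s$ with respect to $\omega_s$ which are uniformly bounded, $|\widehat Q_s(A)|\le K\sqrt{\langle\langle A,A\rangle\rangle_{\omega_s}}$ for all $A\in\mathcal O$, $s\in[0,1]$, with $K$ independent of $s$ and $A$, such that for each $A\in\mathcal O$ the function $s\mapsto\widehat Q_s(A)$ is Lebesgue integrable on $[0,1]$ and $\omega_{s_+}(A)-\omega_{s_-}(A)=\int_{s_-}^{s_+}\widehat Q_s(A)\,\mathrm ds$ for $0\le s_-<s_+\le1$. A state $\omega$ is a *pseudolocal state* (respectively a *weak pseudolocal state*) if there is such a flow with $\omega_0=\mathrm{Tr}_{\mathcal A}$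 and $\omega_1=\omega$ for which $\{\omega_s:s\in[0,1]\}$ is uniformly sizably $p$-clustering for some $p>D$ (respectively uniformly clustering). **Dynamics and GGEs.** Let $h=h^\star\in\mathcal O$, let $H=\sum_x\iota_x(h)$ be the corresponding local Hamiltonian, let $\mathfrak LH(A)=\sum_x(\iota_x(h)A-A\iota_x(h))$ for $A\in\mathcal O$ (a finite sum), and let $\tau_t$ be the time evolution of $\mathcal A$ generated by $\mathrm i\,\mathfrak LH$, that is, $\tau_t(a)=\lim_{n\to\infty}e^{\mathrm itH_n}a\,e^{-\mathrm itH_n}$ in norm, with $H_n=\sum_{x\in B(n)}\iota_x(h)$. A *GGE* (respectively a *weak GGE*) with respect to $H$ is a pseudolocal (respectively weak pseudolocal) state that has a flow $\{\omega_s\}$ and charges $\{\widehat Q_s\}$ as above such that for almost all $s\in[0,1]$, $\omega_s(\mathfrak LH(A))=0$ and $\widehat Q_s(\mathfrak LH(A))=0$ for all $A\in\mathcal O$. **Theorem (Generalized thermalization).** Let $\omega$ be a pseudolocal state with flow $\{\omega_s:s\in[0,1]\}$. Suppose that (a) $\{\omega_s\circ\tau_t:(s,t)\in[0,1]\times[0,\infty)\}$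 is uniformly clustering, and (b) for every $A,B\in\mathcal O$ and almost every $s\in[0,1]$, the limit $\lim_{t\to\infty}\langle\langle\tau_t(A),B\rangle\rangle_{\omega_s}$ exists in $\mathbb C$. Then the limit $\omega^{\rm sta}(a)=\lim_{t\to\infty}\omega(\tau_t(a))$ exists for every $a\in\mathcal A$, and $\omega^{\rm sta}$ is a weak GGE with respect to $H$. If moreover there is $p>D$ such that the family in (a) is uniformly sizably $p$-clustering, then $\omega^{\rm sta}$ is a GGE with respect to $H$. -/

import Mathlib

open Filter Topology MeasureTheory

noncomputable section

namespace SpinLattice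

/-! ### The lattice -/

/-- Sites of the hypercubic lattice `ℤ^D`. -/
abbrev Site (D : ℕ) : Type := Fin D → ℤ

/-- Graph distance on `ℤ^D`: `∑ i, |x i - y i|`. -/
def siteDist {D : ℕ} (x y : Site D) : ℕ := ∑ i, (x i - y i).natAbs

/-- The ball of radius `n` about the origin. -/
def ball (D n : ℕ) : Finset (Site D) :=
  (Fintype.piFinset fun _ => Finset.Icc (-(n : ℤ)) n).filter fun x => siteDist x 0 ≤ n

/-! ### The quasi-local algebra of a quantum spin lattice

The tensor product over all sites of copies of the `d × d` matrices is realised by its faithful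
(hence isometric) action on `ℓ²` of the set of all configurations `ℤ^D → Fin d`: a matrix on a
finite set `X` of sites acts on the coordinates in `X` and leaves the other coordinates alone. -/

/-- Configurations, the labels of the canonical orthonormal basis. -/
abbrev Config (D d : ℕ) : Type := Site D → Fin d

/-- The Hilbert space `ℓ²(Config)`. -/
abbrev Hil (D d : ℕ) : Type := lp (fun _ : Config D d => ℂ) 2

/-- Bounded operators on `ℓ²(Config)`. -/
abbrev Op (D d : ℕ) : Type := Hil D d →L[ℂ] Hil D d

/-- The configuration equal to `τ` on `X` and to `σ` elsewhere. -/
def glue {D d : ℕ} (X : Finset (Site D)) (τ : X → Fin d) (σ : Config D d) : Config D d :=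
  fun y => if hy : y ∈ X then τ ⟨y, hy⟩ else σ y

/-- `T` acts as the matrix `M` on the sites of `X` and as the identity on all other sites, that
is, `T = M ⊗ 1`. -/
def ActsAs {D d : ℕ} (X : Finset (Site D)) (M : Matrix (X → Fin d) (X → Fin d) ℂ)
    (T : Op D d) : Prop :=
  ∀ (f : Hil D d) (σ : Config D d), T f σ = ∑ τ, M (fun y => σ y) τ * f (glue X τ σ)

theorem glue_apply_mem {D d : ℕ} (X : Finset (Site D)) (τ : X → Fin d) (σ : Config D d) :
    (fun y : X => glue X τ σ y) = τ := by
  funext y; simp [glue]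

theorem glue_glue {D d : ℕ} (X : Finset (Site D)) (τ ρ : X → Fin d) (σ : Config D d) :
    glue X ρ (glue X τ σ) = glue X ρ σ := by
  funext y; by_cases hy : y ∈ X <;> simp [glue, hy]

theorem glue_self {D d : ℕ} (X : Finset (Site D)) (σ : Config D d) :
    glue X (fun y => σ y) σ = σ := by
  funext y; by_cases hy : y ∈ X <;> simp [glue, hy]

theorem ActsAs.mul {D d : ℕ} {X : Finset (Site D)} {M N : Matrix (X → Fin d) (X → Fin d) ℂ}
    {S T : Op D d} (hS : ActsAs X M S) (hT : ActsAs X N T) : ActsAs X (M * N) (S * T) := by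
  intro f σ
  have h1 : (S * T) f = S (T f) := rfl
  rw [h1, hS]
  simp_rw [hT f, glue_apply_mem, glue_glue, Matrix.mul_apply, Finset.mul_sum, Finset.sum_mul]
  rw [Finset.sum_comm]
  simp_rw [mul_assoc]

theorem ActsAs.add {D d : ℕ} {X : Finset (Site D)} {M N : Matrix (X → Fin d) (X → Fin d) ℂ}
    {S T : Op D d} (hS : ActsAs X M S) (hT : ActsAs X N T) : ActsAs X (M + N) (S + T) := by
  intro f σ
  have h1 : ((S + T) f) σ = S f σ + T f σ := rfl
  rw [h1, hS, hT, ← Finset.sum_add_distrib]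
  simp_rw [Matrix.add_apply, add_mul]

theorem actsAs_algebraMap {D d : ℕ} (X : Finset (Site D)) (c : ℂ) :
    ActsAs (d := d) X (Matrix.diagonal fun _ => c) (algebraMap ℂ (Op D d) c) := by
  intro f σ
  have h1 : (algebraMap ℂ (Op D d) c f) σ = c * f σ := by
    rw [Algebra.algebraMap_eq_smul_one]; rfl
  rw [h1, Finset.sum_eq_single (fun y : X => σ y)]
  · simp [glue_self]
  · intro τ _ hτ
    simp [Matrix.diagonal_apply_ne _ (Ne.symm hτ)]
  · simp

theorem actsAs_star {D d : ℕ} {X : Finset (Site D)} {M : Matrix (X → Fin d) (X → Fin d) ℂ}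
    {T : Op D d} (hT : ActsAs X M T) : ActsAs X (star M) (star T) := by
  classical
  intro f σ
  let e : Hil D d := lp.single 2 σ (1 : ℂ)
  have key : ∀ g : Hil D d, inner ℂ e g = g σ := by
    intro g
    simp [e, lp.inner_single_left]
  rw [← key, ContinuousLinearMap.star_eq_adjoint, ContinuousLinearMap.adjoint_inner_right]
  have hTe : T e = ∑ τ, M τ (fun y => σ y) • (lp.single 2 (glue X τ σ) (1 : ℂ) : Hil D d) := by
    ext ρ
    rw [hT, lp.coeFn_sum, Finset.sum_apply]
    simp only [lp.coeFn_smul, Pi.smul_apply, smul_eq_mul, e, lp.single_apply, Pi.single_apply]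
    by_cases hρ : ∀ y, y ∉ X → ρ y = σ y
    · rw [Finset.sum_eq_single (fun y : X => σ y), Finset.sum_eq_single (fun y : X => ρ y)]
      · have h1 : glue X (fun y : X => σ y) ρ = σ := by
          funext y; by_cases hy : y ∈ X <;> simp [glue, hy, hρ]
        have h2 : ρ = glue X (fun y : X => ρ y) σ := by
          funext y; by_cases hy : y ∈ X <;> simp [glue, hy, hρ]
        rw [if_pos h1, if_pos h2]
      · intro τ _ hτ
        rw [if_neg, mul_zero]
        intro h; apply hτ
        rw [h, glue_apply_mem]
      · simp
      · intro τ _ hτ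
        rw [if_neg, mul_zero]
        intro h; apply hτ
        rw [← h, glue_apply_mem]
      · simp
    · push Not at hρ
      obtain ⟨y, hy, hne⟩ := hρ
      rw [Finset.sum_eq_zero, Finset.sum_eq_zero]
      · intro τ _
        rw [if_neg, mul_zero]
        intro h; apply hne
        rw [h]; simp [glue, hy]
      · intro τ _
        rw [if_neg, mul_zero]
        intro h; apply hne
        rw [← h]; simp [glue, hy]
  rw [hTe, sum_inner]
  refine Finset.sum_congr rfl fun τ _ => ?_
  rw [inner_smul_left, lp.inner_single_left]
  simp [Matrix.star_apply]

/-- The algebra `O_X` of observables on the finite set `X` of sites. -/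
def localAlg {D d : ℕ} (X : Finset (Site D)) : StarSubalgebra ℂ (Op D d) where
  carrier := {T | ∃ M, ActsAs X M T}
  mul_mem' := by
    rintro S T ⟨M, hM⟩ ⟨N, hN⟩
    exact ⟨_, hM.mul hN⟩
  add_mem' := by
    rintro S T ⟨M, hM⟩ ⟨N, hN⟩
    exact ⟨_, hM.add hN⟩
  algebraMap_mem' c := ⟨_, actsAs_algebraMap X c⟩
  star_mem' := by
    rintro T ⟨M, hM⟩
    exact ⟨_, actsAs_star hM⟩

/-- The star-algebra of all local observables: `O_X` increases with `X`, so this is the union of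
all `O_X`. -/
def localObs (D d : ℕ) : StarSubalgebra ℂ (Op D d) := ⨆ X : Finset (Site D), localAlg X

/-! ### Translations -/

/-- The unitary operator on `ℓ²(Config)` given by a permutation of the basis. -/
def permUnitary {D d : ℕ} (e : Equiv.Perm (Config D d)) : Hil D d ≃ₗᵢ[ℂ] Hil D d where
  toFun f := ⟨fun σ => f (e σ), by
    have hf := lp.memℓp f
    rw [memℓp_gen_iff (by norm_num)] at hf
    exact memℓp_gen (hf.comp_injective e.injective)⟩
  invFun f := ⟨fun σ => f (e.symm σ), by
    have hf := lp.memℓp f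
    rw [memℓp_gen_iff (by norm_num)] at hf
    exact memℓp_gen (hf.comp_injective e.symm.injective)⟩
  map_add' f g := rfl
  map_smul' c f := rfl
  left_inv f := by ext σ; simp
  right_inv f := by ext σ; simp
  norm_map' f := by
    rw [lp.norm_eq_tsum_rpow (by norm_num), lp.norm_eq_tsum_rpow (by norm_num)]
    congr 1
    exact e.tsum_eq (fun σ => ‖f σ‖ ^ (2 : ENNReal).toReal)

/-- The permutation `σ ↦ σ (· + x)` of configurations. -/
def shiftConfig {D d : ℕ} (x : Site D) : Equiv.Perm (Config D d) where
  toFun σ := fun y => σ (y + x)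
  invFun σ := fun y => σ (y - x)
  left_inv σ := by funext y; simp
  right_inv σ := by funext y; simp

/-- The translation automorphism `ι_x`; it moves an observable at site `y` to site `y + x`. -/
def translate {D d : ℕ} (x : Site D) : Op D d ≃⋆ₐ[ℂ] Op D d :=
  (permUnitary (shiftConfig x)).conjStarAlgEquiv

theorem translate_apply {D d : ℕ} (x : Site D) (T : Op D d) (f : Hil D d) (σ : Config D d) :
    translate x T f σ
      = T ((permUnitary (shiftConfig x)).symm f) (fun y => σ (y + x)) := by
  rw [translate, LinearIsometryEquiv.conjStarAlgEquiv_apply_apply]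
  rfl

theorem translate_mem_localAlg {D d : ℕ} (x : Site D) {X : Finset (Site D)} {T : Op D d}
    (hT : T ∈ localAlg X) :
    translate x T ∈ localAlg (X.map (Equiv.addRight x).toEmbedding) := by
  obtain ⟨M, hM⟩ := hT
  have hmem : ∀ y : X, (y : Site D) + x ∈ X.map (Equiv.addRight x).toEmbedding := fun y =>
    Finset.mem_map.2 ⟨y, y.2, rfl⟩
  have hmem' : ∀ z : ↥(X.map (Equiv.addRight x).toEmbedding), (z : Site D) - x ∈ X := by
    rintro ⟨z, hz⟩
    obtain ⟨y, hy, rfl⟩ := Finset.mem_map.1 hz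
    simpa using hy
  let e : (X → Fin d) ≃ (↥(X.map (Equiv.addRight x).toEmbedding) → Fin d) :=
    { toFun := fun τ z => τ ⟨z - x, hmem' z⟩
      invFun := fun τ y => τ ⟨y + x, hmem y⟩
      left_inv := fun τ => by funext y; simp
      right_inv := fun τ => by funext z; simp }
  refine ⟨M.submatrix e.symm e.symm, fun f σ => ?_⟩
  rw [translate_apply, hM, ← e.sum_comp]
  refine Finset.sum_congr rfl fun τ _ => ?_
  have h2 : ((permUnitary (shiftConfig x)).symm f : Hil D d) (glue X τ fun y => σ (y + x))
      = f (glue _ (e τ) σ) := by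
    change f (fun y => glue X τ (fun y => σ (y + x)) (y - x)) = _
    refine congrArg (fun ρ : Config D d => f ρ) ?_
    funext z
    by_cases hz : z - x ∈ X
    · have hz' : z ∈ X.map (Equiv.addRight x).toEmbedding :=
        Finset.mem_map.2 ⟨z - x, hz, by simp⟩
      rw [glue, glue, dif_pos hz, dif_pos hz']
      rfl
    · have hz' : z ∉ X.map (Equiv.addRight x).toEmbedding := fun h => hz (hmem' ⟨z, h⟩)
      rw [glue, glue, dif_neg hz, dif_neg hz']
      simp
  rw [h2, Matrix.submatrix_apply, Equiv.symm_apply_apply]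
  rfl

theorem translate_mem_localObs {D d : ℕ} (x : Site D) (T : Op D d) (hT : T ∈ localObs D d) :
    translate x T ∈ localObs D d := by
  have h : localObs D d ≤ (localObs D d).comap (StarAlgHomClass.toStarAlgHom (translate (d := d) x)) := by
    refine iSup_le fun X S hS => ?_
    have h1 : localAlg (X.map (Equiv.addRight x).toEmbedding) ≤ localObs D d :=
      le_iSup (fun Y : Finset (Site D) => localAlg (d := d) Y) _
    exact h1 (translate_mem_localAlg x hS)
  exact h hT

theorem continuous_translate {D d : ℕ} (x : Site D) :
    Continuous (translate x : Op D d → Op D d) := by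
  change Continuous fun T : Op D d => (permUnitary (shiftConfig x)).conjStarAlgEquiv T
  simp only [LinearIsometryEquiv.conjStarAlgEquiv_apply]
  fun_prop

/-! ### Observables and states -/

/-- The space `O` of local observables of a model: all local observables of the spin lattice, or
any unital star-subalgebra of it that is invariant under translations (it is then also invariant
under commutators with local sequences whose density lies in it). -/
structure ObsAlgebra (D d : ℕ) where
  obs : StarSubalgebra ℂ (Op D d)
  le_localObs : obs ≤ localObs D d
  translate_mem : ∀ (x : Site D) (T : Op D d), T ∈ obs → translate x T ∈ obs

/-- The algebra of all local observables. -/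
def ObsAlgebra.full (D d : ℕ) : ObsAlgebra D d where
  obs := localObs D d
  le_localObs := le_rfl
  translate_mem := translate_mem_localObs

namespace ObsAlgebra

variable {D d : ℕ} (O : ObsAlgebra D d)

/-- The C*-algebra `A` of observables, the norm completion of `O`. -/
abbrev Alg : Type := ↥(O.obs.topologicalClosure)

variable {O}

/-- The inclusion of `O` in its completion. -/
def emb (A : O.obs) : O.Alg := ⟨A, O.obs.le_topologicalClosure A.2⟩

/-- The translation `ι_x` on local observables. -/
def shiftObs (x : Site D) (A : O.obs) : O.obs := ⟨translate x A, O.translate_mem x A A.2⟩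

/-- The translation `ι_x` on the C*-algebra. -/
def shift (x : Site D) (a : O.Alg) : O.Alg :=
  ⟨translate x a, map_mem_closure (continuous_translate x) a.2 (O.translate_mem x)⟩

/-- The support of an observable: the smallest `X` such that the observable lies in `O_X`. -/
def supp (A : O.obs) : Set (Site D) :=
  {x | ∀ X : Finset (Site D), (A : Op D d) ∈ localAlg X → x ∈ X}

/-- The size of an observable: the number of sites in its support. -/
def size (A : O.obs) : ℕ := (supp A).ncard

/-- The distance between the supports of two observables. It is infinite when one of them is a
multiple of the identity (empty support). -/
def obsDist (A B : O.obs) : ℕ∞ := ⨅ x ∈ supp A, ⨅ y ∈ supp B, (siteDist x y : ℕ∞)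

/-- States on the C*-algebra: normalised positive linear functionals. -/
structure IsState (ω : O.Alg → ℂ) : Prop where
  map_add : ∀ a b, ω (a + b) = ω a + ω b
  map_smul : ∀ (c : ℂ) a, ω (c • a) = c * ω a
  nonneg : ∀ a, 0 ≤ (ω (star a * a)).re ∧ (ω (star a * a)).im = 0
  map_one : ω 1 = 1

/-- Translation-invariant states. -/
structure IsInvariantState (ω : O.Alg → ℂ) : Prop extends IsState ω where
  map_shift : ∀ x a, ω (shift x a) = ω a

/-- `ω` restricts on local observables to the normalised trace: `tr M / d ^ |X|` on a matrix `M`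
on the sites of `X`. -/
def IsTrace (ω : O.Alg → ℂ) : Prop :=
  ∀ (A : O.obs) (X : Finset (Site D)) (M : Matrix (X → Fin d) (X → Fin d) ℂ),
    ActsAs X M (A : Op D d) → ω (emb A) = M.trace / (d : ℂ) ^ X.card

/-! ### Clustering -/

/-- The clustering inequality with size function `ν` and decay function `f`. -/
def ClusterBound (ω : O.Alg → ℂ) (ν : ℕ → ℝ) (f : ℕ → ℝ) : Prop :=
  ∀ (ℓ : ℕ) (A B : O.obs), size A < ℓ → size B < ℓ → ∀ n : ℕ, obsDist A B = n →
    ‖ω (emb (A * B)) - ω (emb A) * ω (emb B)‖ ≤ ν ℓ * ‖A‖ * ‖B‖ * f n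

/-- `ω` is an algebraically `p`-clustering state with size function `ν`. -/
def IsPClustering (p : ℝ) (ν : ℕ → ℝ) (ω : O.Alg → ℂ) : Prop :=
  IsInvariantState ω ∧
    ∃ f : ℕ → ℝ, (∀ n, 0 ≤ f n) ∧ (∀ n : ℕ, 0 < n → f n ≤ (n : ℝ) ^ (-p)) ∧ ClusterBound ω ν f

/-- A uniformly clustering family of states: one power `p > D` and one size function `ν` serve all
its members. -/
def UniformlyClustering (F : Set (O.Alg → ℂ)) : Prop :=
  ∃ p : ℝ, (D : ℝ) < p ∧ ∃ ν : ℕ → ℝ, (∀ ℓ, 0 < ν ℓ) ∧ ∀ ω ∈ F, IsPClustering p ν ω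

/-- Clustering states. -/
def IsClustering (ω : O.Alg → ℂ) : Prop := UniformlyClustering {ω}

/-- A uniformly sizably `p`-clustering family of states: moreover the size function is a power. -/
def UniformlySizablyClustering (p : ℝ) (F : Set (O.Alg → ℂ)) : Prop :=
  ∃ ν a : ℝ, 0 < ν ∧ 0 < a ∧ ∀ ω ∈ F, IsPClustering p (fun ℓ => ν * (ℓ : ℝ) ^ a) ω

/-! ### Susceptibilities -/

/-- The form `⟨a, b⟩_ω = ∑ x, (ω (ι_x(a)* b) - ω (a*) ω (b))`. -/
def leftForm (ω : O.Alg → ℂ) (a b : O.Alg) : ℂ :=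
  ∑' x : Site D, (ω (star (shift x a) * b) - ω (star a) * ω b)

/-- The symmetrised form `⟨⟨a, b⟩⟩_ω = (⟨a, b⟩_ω + ⟨b*, a*⟩_ω) / 2`. -/
def symForm (ω : O.Alg → ℂ) (a b : O.Alg) : ℂ :=
  (leftForm ω a b + leftForm ω (star b) (star a)) / 2

/-! ### Pseudolocal charges -/

/-- Subtraction of the average. -/
def centre (ω : O.Alg → ℂ) (a : O.Alg) : O.Alg := a - algebraMap ℂ O.Alg (ω a)

/-- Pseudolocal sequences with respect to `ω`. -/
structure IsPseudolocalSeq (ω : O.Alg → ℂ) (Q : ℕ → O.obs) : Prop where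
  mem_ball : ∀ n, (Q n : Op D d) ∈ localAlg (ball D n)
  volume_growth : ∃ γ : ℝ, 0 < γ ∧ ∀ n : ℕ, 0 < n →
    (ω (star (centre ω (emb (Q n))) * centre ω (emb (Q n)))).re ≤ γ * (n : ℝ) ^ D
  limit_action : ∀ A : O.obs, ∃ c : ℂ,
    Tendsto (fun n => ω (star (centre ω (emb (Q n))) * emb A)) atTop (𝓝 c)
  homogeneity : ∃ k : ℝ, 0 < k ∧ k < 1 ∧ ∀ A : O.obs, ∀ ε : ℝ, 0 < ε → ∀ᶠ n : ℕ in atTop,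
    ∀ x y : Site D, (siteDist x 0 : ℝ) ≤ k * n → (siteDist y 0 : ℝ) ≤ k * n →
      ‖ω (star (centre ω (emb (Q n))) * emb (shiftObs x A))
        - ω (star (centre ω (emb (Q n))) * emb (shiftObs y A))‖ < ε

/-- `P` is a (two-sided) pseudolocal charge with respect to `ω`: the symmetrised limit action
`P(A) = lim (ω (Q_n* A + A Q_n*) / 2 - ω (Q_n*) ω (A))` of a sequence `Q` such that `Q` and `Q*`
are pseudolocal. -/
def IsPseudolocalCharge (ω : O.Alg → ℂ) (P : O.obs → ℂ) : Prop :=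
  ∃ Q : ℕ → O.obs, IsPseudolocalSeq ω Q ∧ IsPseudolocalSeq ω (fun n => star (Q n)) ∧
    ∀ A : O.obs, Tendsto
      (fun n => ω (star (emb (Q n)) * emb A + emb A * star (emb (Q n))) / 2
        - ω (star (emb (Q n))) * ω (emb A)) atTop (𝓝 (P A))

/-- Two-sided pseudolocal flow `ω_s`, `s ∈ [0, 1]`, along the charges `P_s`. The charges are bounded
uniformly in the dual norm of the seminorm `√⟨⟨A, A⟩⟩_{ω_s}`. -/
structure IsPseudolocalFlow (ω : ℝ → O.Alg → ℂ) (P : ℝ → O.obs → ℂ) : Prop where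
  clustering : ∀ s ∈ Set.Icc (0 : ℝ) 1, IsClustering (ω s)
  charge : ∀ s ∈ Set.Icc (0 : ℝ) 1, IsPseudolocalCharge (ω s) (P s)
  bounded : ∃ K : ℝ, ∀ s ∈ Set.Icc (0 : ℝ) 1, ∀ A : O.obs,
    ‖P s A‖ ≤ K * √(symForm (ω s) (emb A) (emb A)).re
  integrable : ∀ A : O.obs, IntervalIntegrable (fun s => P s A) volume 0 1
  flow : ∀ (A : O.obs) (s₁ s₂ : ℝ), 0 ≤ s₁ → s₁ < s₂ → s₂ ≤ 1 →
    ω s₂ (emb A) - ω s₁ (emb A) = ∫ s in s₁..s₂, P s A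

/-- `ω` is a weak pseudolocal state with flow `ω_s` and charges `P_s`: a uniformly clustering flow
from the trace state to `ω`. -/
structure IsWeakPseudolocalState (ω : O.Alg → ℂ) (ωs : ℝ → O.Alg → ℂ) (P : ℝ → O.obs → ℂ) :
    Prop where
  flow : IsPseudolocalFlow ωs P
  uniform : UniformlyClustering (ωs '' Set.Icc 0 1)
  trace : IsTrace (ωs 0)
  endpoint : ωs 1 = ω

/-- `ω` is a pseudolocal state with flow `ω_s` and charges `P_s`: a uniformly sizably
`p`-clustering flow, for some `p > D`, from the trace state to `ω`. -/
structure IsPseudolocalState (ω : O.Alg → ℂ) (ωs : ℝ → O.Alg → ℂ) (P : ℝ → O.obs → ℂ) :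
    Prop where
  flow : IsPseudolocalFlow ωs P
  uniform : ∃ p : ℝ, (D : ℝ) < p ∧ UniformlySizablyClustering p (ωs '' Set.Icc 0 1)
  trace : IsTrace (ωs 0)
  endpoint : ωs 1 = ω

/-! ### Local Hamiltonians, generalized Gibbs ensembles and time evolution -/

/-- The action `𝔏H(B) = [H, B] = ∑ x, (ι_x(h) B - B ι_x(h))` of the local sequence
`H = ∑ x, ι_x(h)`. Only finitely many terms are nonzero. -/
def lieAction (h B : O.obs) : O.obs := ∑ᶠ x : Site D, (shiftObs x h * B - B * shiftObs x h)

/-- For almost every `s ∈ [0, 1]` the state `ω_s` and the charge `P_s` vanish on `𝔏H(O)`. -/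
def ConservedAlong (h : O.obs) (ωs : ℝ → O.Alg → ℂ) (P : ℝ → O.obs → ℂ) : Prop :=
  ∀ᵐ s ∂(volume.restrict (Set.Icc (0 : ℝ) 1)),
    (∀ A : O.obs, ωs s (emb (lieAction h A)) = 0) ∧ ∀ A : O.obs, P s (lieAction h A) = 0

/-- Generalized Gibbs ensembles with respect to the local Hamiltonian of density `h`. -/
def IsGGE (h : O.obs) (ω : O.Alg → ℂ) : Prop :=
  ∃ ωs P, IsPseudolocalState ω ωs P ∧ ConservedAlong h ωs P

/-- Weak generalized Gibbs ensembles. -/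
def IsWeakGGE (h : O.obs) (ω : O.Alg → ℂ) : Prop :=
  ∃ ωs P, IsWeakPseudolocalState ω ωs P ∧ ConservedAlong h ωs P

/-- The Hamiltonian `H_n = ∑ x ∈ B(n), ι_x(h)` of the ball of radius `n`. -/
def hamiltonian (h : O.obs) (n : ℕ) : O.Alg := ∑ x ∈ ball D n, emb (shiftObs x h)

/-- The time evolution `τ_t(a) = lim_n exp(i t H_n) a exp(-i t H_n)`, the one-parameter group of
automorphisms of the C*-algebra generated by `i 𝔏H`. -/
def evolve (h : O.obs) (t : ℝ) (a : O.Alg) : O.Alg :=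
  limUnder atTop fun n : ℕ =>
    NormedSpace.exp ((Complex.I * t) • hamiltonian h n) * a *
      NormedSpace.exp (-((Complex.I * t) • hamiltonian h n))

end ObsAlgebra

end SpinLattice

end

open SpinLattice SpinLattice.ObsAlgebra

/-!
Why the long-time limit exists and is a generalized Gibbs ensemble.

Write `τ_t` for the evolution, `ω_s` for the given flow from the trace and `P_s` for its charges.
Being bounded in the seminorm `√⟨⟨A, A⟩⟩` of the susceptibility form, `P_s` extends from local
observables to the evolved observables `τ_t A`: a Lieb--Robinson bound (`lieb_robinson`) makes the
increments of the evolutions in growing balls decay faster than any power of the radius, while the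
sizable clustering of the flow lets susceptibilities grow only polynomially with the radius
(`exists_norm_cov_evolveObs_le`). Hence the flow equation holds for `τ_t A`
(`IsThermalizing.flow_evolve`):
`ω_{s₂}(τ_t A) - ω_{s₁}(τ_t A) = ∫ P_s(τ_t A) ds` over `[s₁, s₂]`.

By translation covariance `⟨⟨τ_t A, τ_t A⟩⟩` in `ω_s` is `⟨⟨A, A⟩⟩` in `ω_s ∘ τ_t`
(`symForm_evolve`), which is bounded uniformly in `s` and `t` by the uniform clustering of the
evolved states. A bounded functional is a uniform limit of functionals `⟨⟨B, ·⟩⟩` with local `B`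
(`IsPosForm.exists_approx_riesz`), so the assumed convergence of `⟨⟨τ_t A, B⟩⟩` gives convergence of
`P_s(τ_t A)` for almost every `s` (`exists_tendsto_evolveCharge_of_span`; one null set serves for all
observables, since local observables are spanned by a sequence). Bounded convergence under the
integral, together with the invariance of the trace under `τ_t`, shows that `ω_s ∘ τ_t` converges for
every `s`, to a flow of states along the limiting charges.

These limits form a pseudolocal flow. Clustering bounds pass to pointwise limits
(`IsPClustering.of_tendsto`), and so does the bound of the charges by the susceptibility. Every
functional with such a bound is a pseudolocal charge (`IsClustering.isPseudolocalCharge`): it is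
approximated by local densities, whose sums over growing boxes form a pseudolocal sequence.

Finally, the limiting states are invariant under `τ_t`, hence vanish on its generator `𝔏H`. Then the
integrals of the limiting charges over all subintervals vanish on `𝔏H(A)`, and by Lebesgue
differentiation almost every limiting charge vanishes there.
-/

noncomputable section

namespace SpinLattice

/-! ### Lattice geometry -/

section Lattice

variable {D : ℕ}

theorem siteDist_triangle (x y z : Site D) : siteDist x z ≤ siteDist x y + siteDist y z := by
  unfold siteDist
  rw [← Finset.sum_add_distrib]
  exact Finset.sum_le_sum fun i _ => by omega

theorem siteDist_sub_zero (x y : Site D) : siteDist (x - y) 0 = siteDist x y := by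
  simp [siteDist]

theorem siteDist_neg_zero (x : Site D) : siteDist (-x) 0 = siteDist x 0 := by
  simp [siteDist]

theorem siteDist_add_zero_le (x y : Site D) :
    siteDist (x + y) 0 ≤ siteDist x 0 + siteDist y 0 := by
  have := siteDist_triangle (x + y) y 0
  rwa [← siteDist_sub_zero (x + y) y, add_sub_cancel_right] at this

theorem siteDist_zero_zero : siteDist (0 : Site D) 0 = 0 := by simp [siteDist]

theorem natAbs_le_siteDist (x : Site D) (i : Fin D) : (x i).natAbs ≤ siteDist x 0 := by
  have := Finset.single_le_sum (f := fun i => (x i - (0 : Site D) i).natAbs)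
    (fun _ _ => Nat.zero_le _) (Finset.mem_univ i)
  simpa [siteDist] using this

theorem mem_ball {n : ℕ} {x : Site D} : x ∈ ball D n ↔ siteDist x 0 ≤ n := by
  simp only [ball, Finset.mem_filter, Fintype.mem_piFinset, Finset.mem_Icc, and_iff_right_iff_imp]
  intro h i
  have := (natAbs_le_siteDist x i).trans h
  omega

theorem ball_mono {m n : ℕ} (h : m ≤ n) : ball D m ⊆ ball D n := fun _ hx =>
  mem_ball.2 ((mem_ball.1 hx).trans h)

theorem exists_subset_ball (X : Finset (Site D)) : ∃ n, X ⊆ ball D n :=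
  ⟨X.sup fun x => siteDist x 0, fun _ hx =>
    mem_ball.2 (Finset.le_sup (f := fun x => siteDist x 0) hx)⟩

/-- The cube `{x | ∀ i, |x i| ≤ m}`. -/
def box (D m : ℕ) : Finset (Site D) := Fintype.piFinset fun _ => Finset.Icc (-(m : ℤ)) m

theorem mem_box {m : ℕ} {x : Site D} : x ∈ box D m ↔ ∀ i, (x i).natAbs ≤ m := by
  simp only [box, Fintype.mem_piFinset, Finset.mem_Icc]
  exact forall_congr' fun i => by omega

theorem card_box (m : ℕ) : (box D m).card = (2 * m + 1) ^ D := by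
  simp only [box, Fintype.card_piFinset, Int.card_Icc, Finset.prod_const, Finset.card_univ,
    Fintype.card_fin]
  congr 1
  omega

theorem ball_subset_box (n : ℕ) : ball D n ⊆ box D n := fun x hx =>
  mem_box.2 fun i => (natAbs_le_siteDist x i).trans (mem_ball.1 hx)

theorem box_subset_ball (m : ℕ) : box D m ⊆ ball D (D * m) := fun x hx => by
  rw [mem_ball, siteDist]
  refine (Finset.sum_le_sum fun i _ => ?_).trans (by simp : ∑ _i : Fin D, m ≤ D * m)
  simpa using mem_box.1 hx i

theorem card_ball_le (n : ℕ) : (ball D n).card ≤ (2 * n + 1) ^ D :=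
  (Finset.card_le_card (ball_subset_box n)).trans_eq (card_box n)

theorem tendsto_ball : Tendsto (ball D) atTop atTop :=
  tendsto_atTop_finset_of_monotone (fun _ _ h => ball_mono h) fun _ => ⟨_, mem_ball.2 le_rfl⟩

/-- The integrable weight `(1 + |x|)^{-p}` on the lattice. -/
def siteWeight (p : ℝ) (x : Site D) : ℝ := (1 + (siteDist x 0 : ℝ)) ^ (-p)

theorem siteWeight_pos (p : ℝ) (x : Site D) : 0 < siteWeight p x := by
  unfold siteWeight; positivity

theorem summable_one_add_abs_int {q : ℝ} (hq : 1 < q) :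
    Summable fun k : ℤ => (1 + (k.natAbs : ℝ)) ^ (-q) := by
  have h : Summable fun n : ℕ => (1 + (n : ℝ)) ^ (-q) := by
    have := (summable_nat_add_iff 1).2 (Real.summable_nat_rpow.2 (by linarith : -q < -1))
    refine this.congr fun n => ?_
    push_cast
    rw [add_comm]
  refine Summable.of_nat_of_neg ?_ ?_
  · simpa using h
  · simpa using h

/-- The weight is dominated by `∏ i, (1 + |x i|)^{-p / D}`, whose sums over boxes factorise. -/
theorem summable_siteWeight (hD : 1 ≤ D) {p : ℝ} (hp : (D : ℝ) < p) :
    Summable (siteWeight p : Site D → ℝ) := by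
  have hD0 : (0 : ℝ) < D := by exact_mod_cast hD
  have hp0 : 0 < p := hD0.trans hp
  have hq : 1 < p / D := by rwa [one_lt_div hD0]
  set w : ℤ → ℝ := fun k => (1 + (k.natAbs : ℝ)) ^ (-(p / D)) with hw
  have hw0 : ∀ k, 0 ≤ w k := fun k => by positivity
  have hs : Summable w := summable_one_add_abs_int hq
  have hle : ∀ x : Site D, siteWeight p x ≤ ∏ i, w (x i) := by
    intro x
    have h1 : siteWeight p x = ∏ _i : Fin D, (1 + (siteDist x 0 : ℝ)) ^ (-(p / D)) := by
      rw [Finset.prod_const, Finset.card_univ, Fintype.card_fin, ← Real.rpow_mul_natCast (by positivity)]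
      rw [siteWeight]
      congr 1
      field_simp
    rw [h1]
    refine Finset.prod_le_prod (fun i _ => by positivity) fun i _ => ?_
    refine Real.rpow_le_rpow_of_nonpos (by positivity) ?_ (by linarith)
    have : ((x i).natAbs : ℝ) ≤ siteDist x 0 := by exact_mod_cast natAbs_le_siteDist x i
    linarith
  refine summable_of_sum_le (c := (∑' k, w k) ^ D) (fun x => (siteWeight_pos p x).le) fun u => ?_
  obtain ⟨n, hn⟩ := exists_subset_ball u
  calc ∑ x ∈ u, siteWeight p x ≤ ∑ x ∈ box D n, siteWeight p x :=
        Finset.sum_le_sum_of_subset_of_nonneg (hn.trans (ball_subset_box n))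
          fun x _ _ => (siteWeight_pos p x).le
    _ ≤ ∑ x ∈ box D n, ∏ i, w (x i) := Finset.sum_le_sum fun x _ => hle x
    _ = ∏ _i : Fin D, ∑ k ∈ Finset.Icc (-(n : ℤ)) n, w k := by
        rw [Finset.prod_univ_sum]; rfl
    _ = (∑ k ∈ Finset.Icc (-(n : ℤ)) n, w k) ^ D := by simp
    _ ≤ (∑' k, w k) ^ D :=
        pow_le_pow_left₀ (Finset.sum_nonneg fun k _ => hw0 k)
          (hs.sum_le_tsum _ fun k _ => hw0 k) _

/-- Boxes are a Følner sequence: the mean over a box of the double sum of a summable function of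
differences tends to the full sum. -/
theorem tendsto_box_average {c : Site D → ℂ} (hc : Summable c) :
    Tendsto (fun m : ℕ => (∑ x ∈ box D m, ∑ y ∈ box D m, c (x - y)) / ((box D m).card : ℂ))
      atTop (𝓝 (∑' z, c z)) := by
  classical
  -- the number of pairs in the box with a given difference
  set N : ℕ → Site D → ℕ := fun m z => ((box D m).filter fun y => z + y ∈ box D m).card with hN
  have hcard : ∀ m, (0 : ℝ) < (box D m).card := fun m => by rw [card_box]; positivity
  have h1 : ∀ m, (∑ x ∈ box D m, ∑ y ∈ box D m, c (x - y)) / ((box D m).card : ℂ)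
      = ∑' z, (((N m z : ℝ) / (box D m).card : ℝ) : ℂ) * c z := by
    intro m
    have hy : ∀ y, ∑ x ∈ box D m, c (x - y) = ∑' z, if z + y ∈ box D m then c z else 0 := by
      intro y
      rw [← (Equiv.subRight y).tsum_eq]
      simp only [Equiv.subRight_apply, sub_add_cancel]
      rw [tsum_eq_sum (s := box D m) (fun x hx => if_neg hx)]
      exact Finset.sum_congr rfl fun x hx => (if_pos hx).symm
    rw [Finset.sum_comm]
    simp_rw [hy]
    rw [← Summable.tsum_finsetSum, div_eq_mul_inv, ← tsum_mul_right]
    · refine tsum_congr fun z => ?_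
      rw [← Finset.sum_filter, Finset.sum_const, nsmul_eq_mul]
      push_cast
      ring
    · intro y _
      refine Summable.of_norm_bounded hc.norm fun z => ?_
      split_ifs <;> simp
  simp_rw [h1]
  refine tendsto_tsum_of_dominated_convergence (bound := fun z => ‖c z‖) hc.norm ?_ ?_
  · intro z
    have hlim : Tendsto (fun m : ℕ => (N m z : ℝ) / (box D m).card) atTop (𝓝 1) := by
      have hlow : Tendsto (fun m : ℕ => (((2 * (m - siteDist z 0 : ℕ) + 1 : ℕ) : ℝ)
          / ((2 * m + 1 : ℕ) : ℝ)) ^ D) atTop (𝓝 1) := by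
        have : Tendsto (fun m : ℕ => ((2 * (m - siteDist z 0 : ℕ) + 1 : ℕ) : ℝ)
          / ((2 * m + 1 : ℕ) : ℝ)) atTop (𝓝 1) := by
          have h2 : Tendsto (fun m : ℕ => 1 - (2 * siteDist z 0 : ℝ) * ((2 * m + 1 : ℕ) : ℝ)⁻¹)
              atTop (𝓝 (1 - (2 * siteDist z 0 : ℝ) * 0)) := by
            refine tendsto_const_nhds.sub (tendsto_const_nhds.mul ?_)
            refine tendsto_inv_atTop_zero.comp (tendsto_natCast_atTop_atTop.comp ?_)
            exact tendsto_atTop_mono (fun m => by simp only [id]; omega) tendsto_id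
          rw [mul_zero, sub_zero] at h2
          refine h2.congr' ?_
          filter_upwards [eventually_ge_atTop (siteDist z 0)] with m hm
          have : ((2 * m + 1 : ℕ) : ℝ) ≠ 0 := by positivity
          field_simp
          push_cast [Nat.cast_sub hm]
          ring
        simpa using this.pow D
      refine tendsto_of_tendsto_of_tendsto_of_le_of_le' hlow tendsto_const_nhds ?_ ?_
      · filter_upwards [eventually_ge_atTop (siteDist z 0)] with m hm
        rw [div_pow, card_box]
        have hsub : (2 * (m - siteDist z 0 : ℕ) + 1) ^ D ≤ N m z := by
          rw [← card_box]
          refine Finset.card_le_card fun y hy => ?_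
          rw [mem_box] at hy
          refine Finset.mem_filter.2 ⟨mem_box.2 fun i => (hy i).trans (Nat.sub_le _ _), ?_⟩
          refine mem_box.2 fun i => ?_
          have h3 := hy i
          have h4 := natAbs_le_siteDist z i
          simp only [Pi.add_apply]
          omega
        have hsub' : ((2 * (m - siteDist z 0 : ℕ) + 1 : ℕ) : ℝ) ^ D ≤ N m z := by
          exact_mod_cast hsub
        rw [Nat.cast_pow]
        gcongr
      · refine Eventually.of_forall fun m => ?_
        rw [div_le_one (hcard m)]
        exact_mod_cast Finset.card_filter_le _ _
    have := ((Complex.continuous_ofReal.tendsto 1).comp hlim).mul_const (c z)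
    simpa using this
  · refine Eventually.of_forall fun m z => ?_
    rw [norm_mul, Complex.norm_real, Real.norm_of_nonneg (by positivity)]
    refine mul_le_of_le_one_left (norm_nonneg _) ?_
    rw [div_le_one (hcard m)]
    exact_mod_cast Finset.card_filter_le _ _

end Lattice
/-! ### Local observables through their matrix elements -/

section Local

variable {D d : ℕ}

open Classical in
/-- The matrix element of `T` between the basis vectors labelled by `σ` and `ρ`. -/
def matrixElt (T : Op D d) (σ ρ : Config D d) : ℂ :=
  T (lp.single 2 ρ (1 : ℂ)) σ

/-- The matrix elements of an operator on the sites of `X`: they vanish between configurations that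
differ off `X`, and otherwise depend only on the restrictions to `X`. -/
structure IsLocalKernel (X : Finset (Site D)) (k : Config D d → Config D d → ℂ) : Prop where
  offdiag : ∀ σ ρ y, y ∉ X → σ y ≠ ρ y → k σ ρ = 0
  indep : ∀ σ ρ σ' ρ', (∀ y ∈ X, σ y = σ' y) → (∀ y ∈ X, ρ y = ρ' y) →
    (∀ y, y ∉ X → σ y = ρ y) → (∀ y, y ∉ X → σ' y = ρ' y) → k σ ρ = k σ' ρ'

theorem hasSum_matrixElt (T : Op D d) (f : Hil D d) (σ : Config D d) :
    HasSum (fun ρ => matrixElt T σ ρ * f ρ) (T f σ) := by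
  classical
  have h1 := (lp.hasSum_single (p := 2) (by norm_num) f).mapL T
  have h2 := h1.mapL (lp.evalCLM ℂ (fun _ : Config D d => ℂ) 2 σ)
  refine h2.congr_fun fun ρ => ?_
  have h3 : (lp.single 2 ρ (f ρ) : Hil D d) = f ρ • (lp.single 2 ρ (1 : ℂ) : Hil D d) := by
    rw [← lp.single_smul, smul_eq_mul, mul_one]
  change matrixElt T σ ρ * f ρ = T (lp.single 2 ρ (f ρ)) σ
  rw [h3, map_smul, mul_comm, matrixElt]
  rfl

theorem op_ext_matrixElt {S T : Op D d} (h : ∀ σ ρ, matrixElt S σ ρ = matrixElt T σ ρ) :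
    S = T := by
  ext f σ
  have h1 := hasSum_matrixElt S f σ
  simp_rw [h] at h1
  exact h1.unique (hasSum_matrixElt T f σ)

theorem glue_injective (X : Finset (Site D)) (σ : Config D d) :
    Function.Injective fun τ : X → Fin d => glue X τ σ := fun τ τ' h => by
  rw [← glue_apply_mem X τ σ, ← glue_apply_mem X τ' σ]
  exact congrArg (fun (ρ : Config D d) (y : X) => ρ y) h

/-- Localisation in `X` is a condition on matrix elements, which makes inclusions and intersections of
regions accessible. -/
theorem mem_localAlg_iff {X : Finset (Site D)} {T : Op D d} :
    T ∈ localAlg X ↔ IsLocalKernel X (matrixElt T) := by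
  classical
  constructor
  · rintro ⟨M, hM⟩
    have h1 : ∀ σ ρ, matrixElt T σ ρ
        = ∑ τ, M (fun y => σ y) τ * if glue X τ σ = ρ then 1 else 0 := by
      intro σ ρ
      rw [matrixElt, hM]
      simp only [lp.single_apply, Pi.single_apply]
    have h2 : ∀ σ ρ, (∀ y, y ∉ X → σ y = ρ y) →
        matrixElt T σ ρ = M (fun y => σ y) (fun y => ρ y) := by
      intro σ ρ h
      rw [h1, Finset.sum_eq_single (fun y : X => ρ y)]
      · rw [if_pos, mul_one]
        funext y
        by_cases hy : y ∈ X <;> simp [glue, hy, h]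
      · intro τ _ hτ
        rw [if_neg, mul_zero]
        intro h3
        apply hτ
        rw [← h3, glue_apply_mem]
      · simp
    refine ⟨fun σ ρ y hy hne => ?_, fun σ ρ σ' ρ' h3 h4 h5 h6 => ?_⟩
    · rw [h1]
      refine Finset.sum_eq_zero fun τ _ => ?_
      rw [if_neg, mul_zero]
      rintro rfl
      simp [glue, hy] at hne
    · rw [h2 _ _ h5, h2 _ _ h6]
      congr 1
      · funext y; exact h3 y y.2
      · funext y; exact h4 y y.2
  · intro hk
    rcases isEmpty_or_nonempty (Config D d) with he | ⟨⟨σ₀⟩⟩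
    · exact ⟨0, fun f σ => he.elim σ⟩
    refine ⟨fun α β => matrixElt T (glue X α σ₀) (glue X β σ₀), fun f σ => ?_⟩
    have h1 : HasSum (fun ρ => matrixElt T σ ρ * f ρ)
        (∑ ρ ∈ (Finset.univ : Finset (X → Fin d)).map ⟨fun τ => glue X τ σ, glue_injective X σ⟩,
          matrixElt T σ ρ * f ρ) := by
      refine hasSum_sum_of_ne_finset_zero fun ρ hρ => ?_
      by_cases h : ∀ y, y ∉ X → σ y = ρ y
      · refine absurd (Finset.mem_map.2 ⟨fun y : X => ρ y, Finset.mem_univ _, ?_⟩) hρ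
        funext y
        by_cases hy : y ∈ X <;> simp [glue, hy, h]
      · push Not at h
        obtain ⟨y, hy, hne⟩ := h
        rw [hk.offdiag σ ρ y hy hne, zero_mul]
    rw [(hasSum_matrixElt T f σ).unique h1, Finset.sum_map]
    refine Finset.sum_congr rfl fun τ _ => ?_
    simp only [Function.Embedding.coeFn_mk]
    congr 1
    refine hk.indep _ _ _ _ ?_ ?_ ?_ ?_ <;> intro y hy <;> simp [glue, hy]

theorem localAlg_mono {X Y : Finset (Site D)} (h : X ⊆ Y) :
    localAlg (d := d) X ≤ localAlg Y := by
  intro T hT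
  rw [mem_localAlg_iff] at hT ⊢
  refine ⟨fun σ ρ y hy => hT.offdiag σ ρ y fun hy' => hy (h hy'), ?_⟩
  intro σ ρ σ' ρ' h1 h2 h3 h4
  by_cases h5 : ∀ y, y ∉ X → σ y = ρ y
  · refine hT.indep _ _ _ _ (fun y hy => h1 y (h hy)) (fun y hy => h2 y (h hy)) h5 fun y hy => ?_
    by_cases hy' : y ∈ Y
    · rw [← h1 y hy', ← h2 y hy', h5 y hy]
    · exact h4 y hy'
  · push Not at h5
    obtain ⟨y, hy, hne⟩ := h5
    have hy' : y ∈ Y := by by_contra hy'; exact hne (h3 y hy')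
    rw [hT.offdiag σ ρ y hy hne, hT.offdiag σ' ρ' y hy]
    rwa [← h1 y hy', ← h2 y hy']

/-- Regions that carry an observable are closed under intersection, so that a smallest one exists. -/
theorem localAlg_inter {X Y : Finset (Site D)} {T : Op D d} (hX : T ∈ localAlg X)
    (hY : T ∈ localAlg Y) [DecidableEq (Site D)] : T ∈ localAlg (X ∩ Y) := by
  rw [mem_localAlg_iff] at *
  refine ⟨fun σ ρ y hy hne => ?_, ?_⟩
  · by_cases hyX : y ∈ X
    · exact hY.offdiag σ ρ y (fun hyY => hy (Finset.mem_inter.2 ⟨hyX, hyY⟩)) hne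
    · exact hX.offdiag σ ρ y hyX hne
  · intro σ ρ σ' ρ' h1 h2 h3 h4
    have e1 : matrixElt T σ ρ = matrixElt T (fun y => if y ∈ X then σ y else σ' y)
        (fun y => if y ∈ X then ρ y else ρ' y) := by
      refine hX.indep _ _ _ _ (fun y hy => ?_) (fun y hy => ?_)
        (fun y hy => h3 y (by simp [hy])) (fun y hy => ?_)
      · simp only [hy, if_true]
      · simp only [hy, if_true]
      · simpa only [hy, if_false] using h4 y (by simp [hy])
    rw [e1]
    refine hY.indep _ _ _ _ (fun y hy => ?_) (fun y hy => ?_) (fun y hy => ?_)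
      (fun y hy => h4 y (by simp [hy]))
    · by_cases hyX : y ∈ X
      · simpa only [hyX, if_true] using h1 y (by simp [hy, hyX])
      · simp only [hyX, if_false]
    · by_cases hyX : y ∈ X
      · simpa only [hyX, if_true] using h2 y (by simp [hy, hyX])
      · simp only [hyX, if_false]
    · by_cases hyX : y ∈ X
      · simpa only [hyX, if_true] using h3 y (by simp [hy])
      · simpa only [hyX, if_false] using h4 y (by simp [hyX])

theorem eq_algebraMap_of_mem_localAlg_empty {T : Op D d} (hT : T ∈ localAlg (∅ : Finset (Site D))) :
    ∃ c : ℂ, T = algebraMap ℂ _ c := by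
  obtain ⟨M, hM⟩ := hT
  refine ⟨M default default, ?_⟩
  ext f σ
  rw [hM, Fintype.sum_unique, Algebra.algebraMap_eq_smul_one]
  have h1 : glue ∅ (default : (∅ : Finset (Site D)) → Fin d) σ = σ := by
    funext y; simp [glue]
  rw [h1, Subsingleton.elim (fun y : (∅ : Finset (Site D)) => σ y) default]
  rfl

/-- Observables on disjoint sets of sites commute. -/
theorem commute_of_disjoint {X Y : Finset (Site D)} (hXY : Disjoint X Y) {S T : Op D d}
    (hS : S ∈ localAlg X) (hT : T ∈ localAlg Y) : Commute S T := by
  obtain ⟨M, hM⟩ := hS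
  obtain ⟨N, hN⟩ := hT
  have hd : ∀ y, y ∈ X → y ∉ Y := fun y h1 h2 => Finset.disjoint_left.1 hXY h1 h2
  have e1 : ∀ (τ : X → Fin d) (σ : Config D d), (fun y : Y => glue X τ σ y) = fun y : Y => σ y := by
    intro τ σ
    funext y
    have : (y : Site D) ∉ X := fun h => hd _ h y.2
    simp [glue, this]
  have e2 : ∀ (τ : Y → Fin d) (σ : Config D d), (fun y : X => glue Y τ σ y) = fun y : X => σ y := by
    intro τ σ
    funext y
    have : (y : Site D) ∉ Y := hd _ y.2
    simp [glue, this]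
  have e3 : ∀ (τ : X → Fin d) (ρ : Y → Fin d) (σ : Config D d),
      glue Y ρ (glue X τ σ) = glue X τ (glue Y ρ σ) := by
    intro τ ρ σ
    funext y
    by_cases h1 : y ∈ X
    · have := hd y h1
      simp [glue, h1, this]
    · by_cases h2 : y ∈ Y <;> simp [glue, h1, h2]
  change S * T = T * S
  ext f σ
  change S (T f) σ = T (S f) σ
  rw [hM, hN]
  simp_rw [hN f, hM f, e1, e2, e3, Finset.mul_sum]
  rw [Finset.sum_comm]
  exact Finset.sum_congr rfl fun _ _ => Finset.sum_congr rfl fun _ _ => by ring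

theorem exists_mem_localAlg_ball {T : Op D d} (hT : T ∈ localObs D d) :
    ∃ m, T ∈ localAlg (ball D m) := by
  have hdir : Directed (· ≤ ·) fun X : Finset (Site D) => localAlg (d := d) X :=
    directed_of_isDirected_le fun _ _ h => localAlg_mono h
  have h1 : T ∈ ((localObs D d : StarSubalgebra ℂ (Op D d)) : Set (Op D d)) := hT
  rw [localObs, StarSubalgebra.coe_iSup_of_directed hdir] at h1
  obtain ⟨X, hX⟩ := Set.mem_iUnion.1 h1
  obtain ⟨m, hm⟩ := exists_subset_ball X
  exact ⟨m, localAlg_mono hm hX⟩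

instance finiteDimensional_localAlg (X : Finset (Site D)) :
    FiniteDimensional ℂ (Subalgebra.toSubmodule (localAlg (d := d) X).toSubalgebra) := by
  classical
  rcases isEmpty_or_nonempty (Config D d) with he | ⟨⟨σ₀⟩⟩
  · have : Subsingleton (Op D d) := ⟨fun S T => op_ext_matrixElt fun σ => he.elim σ⟩
    infer_instance
  let Φ : Subalgebra.toSubmodule (localAlg (d := d) X).toSubalgebra →ₗ[ℂ]
      ((X → Fin d) → (X → Fin d) → ℂ) :=
    { toFun := fun T α β => matrixElt T (glue X α σ₀) (glue X β σ₀)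
      map_add' := fun S T => rfl
      map_smul' := fun c T => rfl }
  refine FiniteDimensional.of_injective Φ fun S T hST => Subtype.ext (op_ext_matrixElt fun σ ρ => ?_)
  have hS := mem_localAlg_iff.1 S.2
  have hT := mem_localAlg_iff.1 T.2
  by_cases h : ∀ y, y ∉ X → σ y = ρ y
  · have h1 := congrFun (congrFun hST fun y => σ y) fun y => ρ y
    refine (hS.indep _ _ _ _ ?_ ?_ h ?_).trans (h1.trans (hT.indep _ _ _ _ ?_ ?_ ?_ h)) <;>
      intro y hy <;> simp [glue, hy]
  · push Not at h
    obtain ⟨y, hy, hne⟩ := h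
    rw [hS.offdiag σ ρ y hy hne, hT.offdiag σ ρ y hy hne]

end Local

namespace ObsAlgebra

variable {D d : ℕ} {O : ObsAlgebra D d}

theorem exists_ball (A : O.obs) : ∃ m, (A : Op D d) ∈ localAlg (ball D m) :=
  exists_mem_localAlg_ball (O.le_localObs A.2)

theorem supp_subset {A : O.obs} {X : Finset (Site D)} (hA : (A : Op D d) ∈ localAlg X) :
    supp A ⊆ X := fun _ hx => hx X hA

theorem size_le_card {A : O.obs} {X : Finset (Site D)} (hA : (A : Op D d) ∈ localAlg X) :
    size A ≤ X.card := by
  rw [size, ← Set.ncard_coe_finset]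
  exact Set.ncard_le_ncard (supp_subset hA) X.finite_toSet

theorem eq_algebraMap_of_supp_eq_empty {A : O.obs} (hA : supp A = ∅) :
    ∃ c : ℂ, A = algebraMap ℂ _ c := by
  classical
  -- a smallest set carrying `A` is contained in every other one, hence in the support
  obtain ⟨m, hm⟩ := exists_ball A
  obtain ⟨X, hX, hmin⟩ := exists_minimal_of_wellFoundedLT
    (fun X : Finset (Site D) => (A : Op D d) ∈ localAlg X) ⟨_, hm⟩
  have hsub : (X : Set (Site D)) ⊆ supp A := fun x hx Y hY =>
    Finset.inter_subset_right (hmin (localAlg_inter hX hY) Finset.inter_subset_left hx)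
  have hX0 : X = ∅ := by
    rw [hA] at hsub
    exact Finset.coe_eq_empty.1 (Set.subset_empty_iff.1 hsub)
  subst hX0
  obtain ⟨c, hc⟩ := eq_algebraMap_of_mem_localAlg_empty hX
  exact ⟨c, Subtype.ext hc⟩

/-- The observables of the model on the sites of `X`, as a subalgebra of the completion. -/
def localSub (O : ObsAlgebra D d) (X : Finset (Site D)) : Subalgebra ℂ O.Alg where
  carrier := {a | (a : Op D d) ∈ O.obs ∧ (a : Op D d) ∈ localAlg X}
  mul_mem' h1 h2 := ⟨mul_mem h1.1 h2.1, mul_mem h1.2 h2.2⟩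
  add_mem' h1 h2 := ⟨add_mem h1.1 h2.1, add_mem h1.2 h2.2⟩
  algebraMap_mem' c := ⟨algebraMap_mem _ c, algebraMap_mem _ c⟩

theorem emb_mem_localSub {X : Finset (Site D)} {A : O.obs} :
    emb A ∈ localSub O X ↔ (A : Op D d) ∈ localAlg X := ⟨fun h => h.2, fun h => ⟨A.2, h⟩⟩

/-- Finite-dimensional subspaces are closed; exponentials of local observables are therefore local. -/
theorem isClosed_localSub (X : Finset (Site D)) : IsClosed (localSub O X : Set O.Alg) := by
  let Φ : Subalgebra.toSubmodule (localSub O X) →ₗ[ℂ]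
      Subalgebra.toSubmodule (localAlg (d := d) X).toSubalgebra :=
    { toFun := fun a => ⟨a, a.2.2⟩
      map_add' := fun _ _ => rfl
      map_smul' := fun _ _ => rfl }
  have : FiniteDimensional ℂ (Subalgebra.toSubmodule (localSub O X)) :=
    FiniteDimensional.of_injective Φ fun a b hab => by
      have := congrArg Subtype.val hab
      exact Subtype.ext (Subtype.ext this)
  exact (Subalgebra.toSubmodule (localSub O X)).closed_of_finiteDimensional

/-- The local observables are spanned by a sequence: each ball carries a finite-dimensional space
of them. -/
theorem exists_spanning_sequence (O : ObsAlgebra D d) :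
    ∃ e : ℕ → O.obs, Submodule.span ℂ (Set.range e) = ⊤ := by
  let V : ℕ → Submodule ℂ O.obs := fun m =>
    { carrier := {A | (A : Op D d) ∈ localAlg (ball D m)}
      add_mem' := fun h1 h2 => (localAlg (ball D m)).add_mem' h1 h2
      zero_mem' := zero_mem (localAlg (ball D m))
      smul_mem' := fun c _ h => (localAlg (ball D m)).smul_mem h c }
  have hfin : ∀ m, FiniteDimensional ℂ (V m) := fun m => by
    let Φ : V m →ₗ[ℂ] Subalgebra.toSubmodule (localAlg (d := d) (ball D m)).toSubalgebra :=
      { toFun := fun a => ⟨a, a.2⟩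
        map_add' := fun _ _ => rfl
        map_smul' := fun _ _ => rfl }
    refine FiniteDimensional.of_injective Φ fun a b hab => ?_
    have := congrArg Subtype.val hab
    exact Subtype.ext (Subtype.ext this)
  choose S hS using fun m => (Module.Finite.iff_fg (N := V m)).1 (hfin m)
  have hne : (⋃ m, (insert 0 (S m : Set O.obs))).Nonempty := ⟨0, Set.mem_iUnion.2 ⟨0, by simp⟩⟩
  have hct : (⋃ m, (insert 0 (S m : Set O.obs))).Countable :=
    Set.countable_iUnion fun m => (S m).countable_toSet.insert 0
  obtain ⟨e, he⟩ := hct.exists_eq_range hne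
  refine ⟨e, ?_⟩
  rw [← he, eq_top_iff]
  intro A _
  obtain ⟨m, hm⟩ := exists_ball A
  have hA : A ∈ V m := hm
  rw [← hS m] at hA
  refine Submodule.span_mono ?_ hA
  exact (Set.subset_insert _ _).trans (Set.subset_iUnion (fun m => insert 0 (S m : Set O.obs)) m)

/-! ### States -/

section States

variable {D d : ℕ} {O : ObsAlgebra D d}

theorem denseRange_emb : DenseRange (emb : O.obs → O.Alg) := by
  intro a
  rw [Metric.mem_closure_iff]
  intro ε hε
  obtain ⟨b, hb, hab⟩ := Metric.mem_closure_iff.1 (show (a : Op D d) ∈ closure (O.obs : Set _) from a.2) ε hε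
  exact ⟨emb ⟨b, hb⟩, ⟨_, rfl⟩, hab⟩

theorem norm_emb (A : O.obs) : ‖emb A‖ = ‖A‖ := rfl

theorem emb_add (A B : O.obs) : emb (A + B) = emb A + emb B := rfl
theorem emb_mul (A B : O.obs) : emb (A * B) = emb A * emb B := rfl
theorem emb_smul (c : ℂ) (A : O.obs) : emb (c • A) = c • emb A := rfl
theorem emb_star (A : O.obs) : emb (star A) = star (emb A) := rfl
theorem emb_one : emb (1 : O.obs) = 1 := rfl
theorem emb_zero : emb (0 : O.obs) = 0 := rfl
theorem emb_shiftObs (x : Site D) (A : O.obs) : emb (shiftObs x A) = shift x (emb A) := rfl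

theorem emb_sum {ι : Type*} (s : Finset ι) (f : ι → O.obs) :
    emb (∑ i ∈ s, f i) = ∑ i ∈ s, emb (f i) :=
  map_sum (AddMonoidHom.mk' (emb : O.obs → O.Alg) emb_add) f s

theorem norm_star_alg (a : O.Alg) : ‖star a‖ = ‖a‖ := norm_star a

/-- `‖a‖² - a* a` is positive, hence of the form `c* c`. -/
theorem exists_algebraMap_norm_sq_sub {B : Type*} [CStarAlgebra B] (a : B) :
    ∃ c : B, algebraMap ℂ B ((‖a‖ ^ 2 : ℝ) : ℂ) - star a * a = star c * c := by
  let _ := CStarAlgebra.spectralOrder B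
  have _ := CStarAlgebra.spectralOrderedRing B
  exact CStarAlgebra.nonneg_iff_eq_star_mul_self.1
    (sub_nonneg.2 (CStarAlgebra.star_mul_le_algebraMap_norm_sq (a := a)))

theorem exists_star_mul_self_eq (a : O.Alg) :
    ∃ c : O.Alg, algebraMap ℂ O.Alg ((‖a‖ ^ 2 : ℝ) : ℂ) - star a * a = star c * c := by
  have : IsClosed (O.obs.topologicalClosure : Set (Op D d)) :=
    O.obs.isClosed_topologicalClosure
  exact exists_algebraMap_norm_sq_sub a

theorem IsState.map_star {ω : O.Alg → ℂ} (hω : IsState ω) (a : O.Alg) :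
    ω (star a) = (starRingEnd ℂ) (ω a) := by
  -- polarisation: `ω ((a + z)* (a + z))` is real for `z = 0, 1, i`
  have key : ∀ z : ℂ, (ω (star (a + z • 1) * (a + z • 1))).im
      = (ω (star a * a)).im + (z * ω (star a)).im + ((starRingEnd ℂ) z * ω a).im := by
    intro z
    have : star (a + z • 1) * (a + z • (1 : O.Alg))
        = star a * a + z • star a + (starRingEnd ℂ z) • a + (starRingEnd ℂ z * z) • 1 := by
      simp only [star_add, star_smul, star_one, add_mul, mul_add, smul_mul_assoc, mul_smul_comm,
        one_mul, mul_one, smul_add, smul_smul]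
      rw [mul_comm z]
      simp only [RCLike.star_def]
      abel
    rw [this, hω.map_add, hω.map_add, hω.map_add, hω.map_smul, hω.map_smul, hω.map_smul,
      hω.map_one, mul_one]
    have h0 : ((starRingEnd ℂ) z * z).im = 0 := by
      rw [mul_comm, Complex.mul_conj]; simp
    simp [h0]
  have h0 := (hω.nonneg a).2
  have h1 := key 1
  have h2 := key Complex.I
  rw [(hω.nonneg _).2, h0] at h1 h2
  apply Complex.ext
  · simp at h2 ⊢; linarith
  · simp at h1 ⊢; linarith

/-- States are contractive: `‖a‖² - a* a` is positive, so `ω (a* a) ≤ ‖a‖²`, and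
`|ω a|² ≤ ω (a* a)` by Cauchy--Schwarz. -/
theorem IsState.norm_le {ω : O.Alg → ℂ} (hω : IsState ω) (a : O.Alg) : ‖ω a‖ ≤ ‖a‖ := by
  have hsub : ∀ a b, ω (a - b) = ω a - ω b := fun a b => by
    rw [eq_sub_iff_add_eq, ← hω.map_add, sub_add_cancel]
  have halg : ∀ c : ℂ, ω (algebraMap ℂ O.Alg c) = c := fun c => by
    rw [Algebra.algebraMap_eq_smul_one, hω.map_smul, hω.map_one, mul_one]
  have h1 : (ω (star a * a)).re ≤ ‖a‖ ^ 2 := by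
    obtain ⟨c, hc⟩ := exists_star_mul_self_eq a
    have := (hω.nonneg c).1
    rw [← hc, hsub, halg, Complex.sub_re, Complex.ofReal_re] at this
    linarith
  -- Cauchy--Schwarz, from positivity on `a - ω a`
  have h2 : ‖ω a‖ ^ 2 ≤ (ω (star a * a)).re := by
    have h := (hω.nonneg (a - ω a • (1 : O.Alg))).1
    have e : star (a - ω a • 1) * (a - ω a • (1 : O.Alg))
        = star a * a - ω a • star a - (starRingEnd ℂ (ω a)) • a
          + (starRingEnd ℂ (ω a) * ω a) • 1 := by
      simp only [star_sub, star_smul, star_one, sub_mul, mul_sub, smul_mul_assoc, mul_smul_comm,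
        one_mul, mul_one, smul_sub, smul_smul]
      rw [mul_comm (ω a)]
      simp only [RCLike.star_def]
      abel
    rw [e, hω.map_add, hsub, hsub, hω.map_smul, hω.map_smul, hω.map_smul, hω.map_one, mul_one,
      hω.map_star, mul_comm (starRingEnd ℂ (ω a)), sub_add_cancel, Complex.mul_conj] at h
    simp only [Complex.sub_re, Complex.ofReal_re, Complex.normSq_eq_norm_sq] at h
    linarith
  exact (sq_le_sq₀ (norm_nonneg _) (norm_nonneg _)).1 (h2.trans h1)

/-- A state as a continuous linear functional. -/
def IsState.toCLM {ω : O.Alg → ℂ} (hω : IsState ω) : O.Alg →L[ℂ] ℂ :=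
  LinearMap.mkContinuous
    { toFun := ω, map_add' := hω.map_add, map_smul' := hω.map_smul } 1
    fun a => by simpa using hω.norm_le a

theorem IsState.continuous {ω : O.Alg → ℂ} (hω : IsState ω) : Continuous ω := hω.toCLM.continuous

theorem IsState.map_sub {ω : O.Alg → ℂ} (hω : IsState ω) (a b : O.Alg) :
    ω (a - b) = ω a - ω b := _root_.map_sub hω.toCLM a b

theorem IsState.map_zero {ω : O.Alg → ℂ} (hω : IsState ω) : ω 0 = 0 := _root_.map_zero hω.toCLM

theorem IsState.map_sum {ω : O.Alg → ℂ} (hω : IsState ω) {ι : Type*} (s : Finset ι)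
    (f : ι → O.Alg) : ω (∑ i ∈ s, f i) = ∑ i ∈ s, ω (f i) := _root_.map_sum hω.toCLM f s

theorem IsState.norm_sub_mul_le {ω : O.Alg → ℂ} (hω : IsState ω) (a b : O.Alg) :
    ‖ω (a * b) - ω a * ω b‖ ≤ 2 * ‖a‖ * ‖b‖ := by
  have h1 : ‖ω (a * b)‖ ≤ ‖a‖ * ‖b‖ := (hω.norm_le _).trans (norm_mul_le a b)
  have h2 : ‖ω a * ω b‖ ≤ ‖a‖ * ‖b‖ := by
    rw [norm_mul]
    exact mul_le_mul (hω.norm_le a) (hω.norm_le b) (norm_nonneg _) (norm_nonneg _)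
  linarith [norm_sub_le (ω (a * b)) (ω a * ω b)]

section Limits

variable {ι : Type*} {l : Filter ι} [l.NeBot] {φ : ι → O.Alg → ℂ} {ω : O.Alg → ℂ}

theorem IsState.of_tendsto (hφ : ∀ i, IsState (φ i))
    (h : ∀ a, Tendsto (fun i => φ i a) l (𝓝 (ω a))) : IsState ω where
  map_add a b := tendsto_nhds_unique (h _)
    (((h a).add (h b)).congr fun i => ((hφ i).map_add a b).symm)
  map_smul c a := tendsto_nhds_unique (h _)
    (((h a).const_mul c).congr fun i => ((hφ i).map_smul c a).symm)
  nonneg a := by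
    have h1 := h (star a * a)
    exact ⟨ge_of_tendsto ((Complex.continuous_re.tendsto _).comp h1)
        (Eventually.of_forall fun i => ((hφ i).nonneg a).1),
      tendsto_nhds_unique ((Complex.continuous_im.tendsto _).comp h1)
        (tendsto_const_nhds.congr fun i => ((hφ i).nonneg a).2.symm)⟩
  map_one := tendsto_nhds_unique (h _) (tendsto_const_nhds.congr fun i => ((hφ i).map_one).symm)

/-- Pointwise limits of uniformly clustering states obey the same clustering bound, as long as the
size function stays away from zero. The limiting decay function is `n ^ (-p)`; at distance zero,
where nothing is prescribed, a constant serves. -/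
theorem IsPClustering.of_tendsto {p : ℝ} {ν : ℕ → ℝ} {c : ℝ} (hc : 0 < c)
    (hν : ∀ ℓ, 1 ≤ ℓ → c ≤ ν ℓ) (hφ : ∀ i, IsPClustering p ν (φ i))
    (h : ∀ a, Tendsto (fun i => φ i a) l (𝓝 (ω a))) : IsPClustering p ν ω := by
  have hω : IsState ω := IsState.of_tendsto (fun i => (hφ i).1.toIsState) h
  refine ⟨⟨hω, fun x a => tendsto_nhds_unique (h _)
    ((h a).congr fun i => ((hφ i).1.map_shift x a).symm)⟩,
    fun n => if n = 0 then 2 / c else (n : ℝ) ^ (-p), fun n => ?_, fun n hn => ?_, ?_⟩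
  · dsimp only
    split_ifs <;> positivity
  · simp [hn.ne']
  · intro ℓ A B hA hB n hn
    have hνℓ := hν ℓ (by omega)
    have hν0 : 0 ≤ ν ℓ := hc.le.trans hνℓ
    -- at distance zero the bound is the trivial one, which is why `ν` has to stay above `c`
    by_cases hn0 : n = 0
    · simp only [hn0, if_true]
      refine (hω.norm_sub_mul_le (emb A) (emb B)).trans ?_
      rw [norm_emb, norm_emb]
      have h1 : 1 ≤ ν ℓ / c := (one_le_div hc).2 hνℓ
      calc 2 * ‖A‖ * ‖B‖ = 1 * (2 * ‖A‖ * ‖B‖) := by ring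
        _ ≤ ν ℓ / c * (2 * ‖A‖ * ‖B‖) := by gcongr
        _ = ν ℓ * ‖A‖ * ‖B‖ * (2 / c) := by ring
    · simp only [hn0, if_false]
      refine le_of_tendsto ((h (emb (A * B))).sub ((h (emb A)).mul (h (emb B)))).norm
        (Eventually.of_forall fun i => ?_)
      obtain ⟨f, -, hf, hcl⟩ := (hφ i).2
      refine (hcl ℓ A B hA hB n hn).trans ?_
      have := hf n (Nat.pos_of_ne_zero hn0)
      gcongr

end Limits

/-- Convergence of states on local observables implies convergence everywhere. -/
theorem exists_tendsto_of_local {φ : ℝ → O.Alg → ℂ} (hφ : ∀ t, 0 ≤ t → IsState (φ t))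
    (h : ∀ A : O.obs, ∃ c, Tendsto (fun t => φ t (emb A)) atTop (𝓝 c)) (a : O.Alg) :
    ∃ c, Tendsto (fun t => φ t a) atTop (𝓝 c) := by
  refine cauchySeq_tendsto_of_complete (Metric.cauchySeq_iff.2 fun ε hε => ?_)
  obtain ⟨b, ⟨A, rfl⟩, hA⟩ := Metric.mem_closure_iff.1 (denseRange_emb a) (ε / 3) (by positivity)
  obtain ⟨c, hc⟩ := h A
  obtain ⟨N, hN⟩ := Metric.cauchySeq_iff.1 hc.cauchySeq (ε / 3) (by positivity)
  have hap : ∀ t, 0 ≤ t → dist (φ t a) (φ t (emb A)) < ε / 3 := fun t ht => by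
    rw [dist_eq_norm, ← (hφ t ht).map_sub]
    exact ((hφ t ht).norm_le _).trans_lt (by rwa [← dist_eq_norm])
  refine ⟨max N 0, fun s hs t ht => ?_⟩
  have h1 := hap s ((le_max_right _ _).trans hs)
  have h2 := hap t ((le_max_right _ _).trans ht)
  have h3 := hN s ((le_max_left _ _).trans hs) t ((le_max_left _ _).trans ht)
  have h4 := dist_triangle4 (φ s a) (φ s (emb A)) (φ t (emb A)) (φ t a)
  rw [dist_comm (φ t (emb A))] at h4
  linarith

theorem IsPClustering.mono {p : ℝ} {ν ν' : ℕ → ℝ} {ω : O.Alg → ℂ} (h : IsPClustering p ν ω)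
    (hν : ∀ ℓ, ν ℓ ≤ ν' ℓ) : IsPClustering p ν' ω := by
  obtain ⟨h1, f, hf0, hf, hcl⟩ := h
  refine ⟨h1, f, hf0, hf, fun ℓ A B hA hB n hn => (hcl ℓ A B hA hB n hn).trans ?_⟩
  have := hν ℓ
  have := hf0 n
  gcongr

/-- The trace property holds for matrices on a common ball and extends by density. -/
theorem IsTrace.map_mul_comm {ω : O.Alg → ℂ} (hω : IsState ω) (ht : IsTrace ω) (a b : O.Alg) :
    ω (a * b) = ω (b * a) := by
  refine denseRange_emb.induction_on₂ (p := fun a b : O.Alg => ω (a * b) = ω (b * a)) ?_ ?_ a b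
  · exact isClosed_eq (hω.continuous.comp (continuous_fst.mul continuous_snd))
      (hω.continuous.comp (continuous_snd.mul continuous_fst))
  · intro A B
    obtain ⟨m, M, hM⟩ := exists_ball A
    obtain ⟨n, hn⟩ := exists_ball B
    have hA : (A : Op D d) ∈ localAlg (ball D (max m n)) :=
      localAlg_mono (ball_mono (le_max_left _ _)) ⟨M, hM⟩
    have hB : (B : Op D d) ∈ localAlg (ball D (max m n)) :=
      localAlg_mono (ball_mono (le_max_right _ _)) hn
    obtain ⟨M', hM'⟩ := hA
    obtain ⟨N', hN'⟩ := hB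
    rw [← emb_mul, ← emb_mul, ht (A * B) _ _ (hM'.mul hN'), ht (B * A) _ _ (hN'.mul hM'),
      Matrix.trace_mul_comm]

end States

/-! ### Translations and covariances -/

section Covariance

variable {D d : ℕ} {O : ObsAlgebra D d}

/-- The translation automorphism of the completion as a star-algebra homomorphism. -/
def shiftHom (x : Site D) : O.Alg →⋆ₐ[ℂ] O.Alg where
  toFun := shift x
  map_one' := by
    refine Subtype.ext ?_
    change translate x (1 : Op D d) = 1
    exact map_one _
  map_mul' a b := by
    refine Subtype.ext ?_
    change translate x ((a : Op D d) * (b : Op D d)) = translate x (a : Op D d) * translate x (b : Op D d)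
    exact map_mul _ _ _
  map_zero' := by
    refine Subtype.ext ?_
    change translate x (0 : Op D d) = 0
    exact map_zero _
  map_add' a b := by
    refine Subtype.ext ?_
    change translate x ((a : Op D d) + (b : Op D d)) = translate x (a : Op D d) + translate x (b : Op D d)
    exact map_add _ _ _
  commutes' c := Subtype.ext
    (AlgHomClass.commutes (translate (d := d) x) c)
  map_star' a := Subtype.ext (map_star (translate (d := d) x) (a : Op D d))

theorem shiftHom_apply (x : Site D) (a : O.Alg) : shiftHom x a = shift x a := rfl

theorem shift_mul (x : Site D) (a b : O.Alg) : shift x (a * b) = shift x a * shift x b :=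
  map_mul (shiftHom x) a b

theorem shift_star (x : Site D) (a : O.Alg) : shift x (star a) = star (shift x a) :=
  map_star (shiftHom x) a

theorem shift_smul (x : Site D) (c : ℂ) (a : O.Alg) : shift x (c • a) = c • shift x a :=
  map_smul (shiftHom x) c a

theorem translate_translate (x y : Site D) (T : Op D d) :
    translate x (translate y T) = translate (x + y) T := by
  ext f σ
  simp only [translate_apply]
  have h1 : (permUnitary (shiftConfig y)).symm ((permUnitary (shiftConfig x)).symm f)
      = (permUnitary (shiftConfig (x + y))).symm f := by
    ext ρ
    refine congrArg (fun ρ : Config D d => f ρ) ?_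
    funext z
    simp [shiftConfig, sub_sub]
  rw [h1]
  refine congrArg (fun ρ : Config D d =>
    T ((permUnitary (shiftConfig (x + y))).symm f) ρ) ?_
  funext z
  rw [add_assoc, add_comm y x]

theorem shift_shift (x y : Site D) (a : O.Alg) : shift x (shift y a) = shift (x + y) a :=
  Subtype.ext (translate_translate x y (a : Op D d))

theorem shift_zero (a : O.Alg) : shift 0 a = a := by
  refine Subtype.ext ?_
  change translate 0 (a : Op D d) = a
  ext f σ
  rw [translate_apply]
  have h1 : (permUnitary (shiftConfig (0 : Site D))).symm f = f := by
    ext ρ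
    refine congrArg (fun ρ : Config D d => f ρ) ?_
    funext z
    simp [shiftConfig]
  rw [h1]
  refine congrArg (fun ρ : Config D d => (a : Op D d) f ρ) ?_
  funext z
  rw [add_zero]

theorem continuous_shift (x : Site D) : Continuous (shift x : O.Alg → O.Alg) :=
  Continuous.subtype_mk ((continuous_translate x).comp continuous_subtype_val) _

theorem norm_shift (x : Site D) (a : O.Alg) : ‖shift x a‖ = ‖a‖ :=
  norm_map_of_isometry_translate a
where
  norm_map_of_isometry_translate (a : O.Alg) : ‖shift x a‖ = ‖a‖ := by
    change ‖(translate x (a : Op D d))‖ = ‖(a : Op D d)‖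
    exact (StarAlgEquiv.isometry (translate (d := d) x)).norm_map_of_map_zero
      (map_zero (translate (d := d) x)) _

/-- The covariance `ω (ι_x(a)* b) - ω (a*) ω (b)`. -/
def cov (ω : O.Alg → ℂ) (a b : O.Alg) (x : Site D) : ℂ :=
  ω (star (shift x a) * b) - ω (star a) * ω b

theorem leftForm_eq_tsum (ω : O.Alg → ℂ) (a b : O.Alg) : leftForm ω a b = ∑' x, cov ω a b x := rfl

variable {ω : O.Alg → ℂ}

theorem cov_add_right (hω : IsState ω) (a b c : O.Alg) (x : Site D) :
    cov ω a (b + c) x = cov ω a b x + cov ω a c x := by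
  simp only [cov, mul_add, hω.map_add]; ring

theorem cov_smul_right (hω : IsState ω) (a b : O.Alg) (z : ℂ) (x : Site D) :
    cov ω a (z • b) x = z * cov ω a b x := by
  simp only [cov, mul_smul_comm, hω.map_smul]; ring

theorem conj_cov (hω : IsInvariantState ω) (a b : O.Alg) (x : Site D) :
    (starRingEnd ℂ) (cov ω a b x) = cov ω b a (-x) := by
  have h1 : star (shift (-x) b) * a = shift (-x) (star b * shift x a) := by
    rw [shift_mul, shift_star, shift_shift, neg_add_cancel, shift_zero]
  rw [cov, cov, h1, hω.map_shift, map_sub, map_mul, ← hω.map_star, ← hω.map_star, ← hω.map_star,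
    star_mul, star_star, star_star, mul_comm (ω a)]

theorem cov_shift (hω : IsInvariantState ω) (a b : O.Alg) (x y : Site D) :
    ω (star (shift x a) * shift y b) - ω (star a) * ω b = cov ω a b (x - y) := by
  have h1 : star (shift x a) * shift y b = shift y (star (shift (x - y) a) * b) := by
    rw [shift_mul, ← shift_star, ← shift_star, shift_shift, add_sub_cancel]
  rw [h1, hω.map_shift, cov]

theorem norm_cov_le_two (hω : IsInvariantState ω) (a b : O.Alg) (x : Site D) :
    ‖cov ω a b x‖ ≤ 2 * ‖a‖ * ‖b‖ := by
  have h := hω.norm_sub_mul_le (star (shift x a)) b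
  rwa [← shift_star, hω.map_shift, norm_shift, norm_star_alg, shift_star] at h

/-- The constant in the decay of covariances of observables on the ball of radius `m`. -/
def clusterConst (D : ℕ) (p : ℝ) (ν : ℕ → ℝ) (m : ℕ) : ℝ :=
  2 * (1 + 4 * (m : ℝ)) ^ p + 4 ^ p * ν ((ball D m).card + 1)

theorem clusterConst_nonneg {p : ℝ} {ν : ℕ → ℝ} (hν : ∀ ℓ, 0 ≤ ν ℓ) (m : ℕ) :
    0 ≤ clusterConst D p ν m := by
  have := hν ((ball D m).card + 1)
  unfold clusterConst
  positivity

/-- Clustering makes the covariances of two observables on a ball decay like `(1 + |x|)^{-p}`: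
translates by more than `4 m` are at distance comparable to `|x|`, and the trivial bound covers
the others. -/
theorem norm_cov_le {p : ℝ} {ν : ℕ → ℝ} (hp : 0 < p) (hν : ∀ ℓ, 0 ≤ ν ℓ)
    (hω : IsPClustering p ν ω) {m : ℕ} {A B : O.obs} (hA : (A : Op D d) ∈ localAlg (ball D m))
    (hB : (B : Op D d) ∈ localAlg (ball D m)) (x : Site D) :
    ‖cov ω (emb A) (emb B) x‖ ≤ ‖A‖ * ‖B‖ * clusterConst D p ν m * siteWeight p x := by
  obtain ⟨hinv, f, hf0, hf, hcl⟩ := hω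
  set n := siteDist x 0 with hn
  have hw : siteWeight p x = ((1 + (n : ℝ)) ^ p)⁻¹ := by
    rw [siteWeight, Real.rpow_neg (by positivity)]
  have hνc := hν ((ball D m).card + 1)
  by_cases hnm : n ≤ 4 * m
  · refine (norm_cov_le_two hinv _ _ x).trans ?_
    rw [norm_emb, norm_emb]
    have h1 : 2 ≤ clusterConst D p ν m * siteWeight p x := by
      rw [hw, ← div_eq_mul_inv, le_div_iff₀ (by positivity), clusterConst]
      have h2 : (1 + (n : ℝ)) ^ p ≤ (1 + 4 * (m : ℝ)) ^ p := by
        refine Real.rpow_le_rpow (by positivity) ?_ hp.le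
        have : (n : ℝ) ≤ 4 * m := by exact_mod_cast hnm
        linarith
      have : 0 ≤ (4 : ℝ) ^ p * ν ((ball D m).card + 1) := by positivity
      linarith
    calc 2 * ‖A‖ * ‖B‖ = ‖A‖ * ‖B‖ * 2 := by ring
      _ ≤ ‖A‖ * ‖B‖ * (clusterConst D p ν m * siteWeight p x) := by gcongr
      _ = _ := by ring
  · push Not at hnm
    have hA' : ((star (shiftObs x A) : O.obs) : Op D d)
        ∈ localAlg ((ball D m).map (Equiv.addRight x).toEmbedding) :=
      star_mem (translate_mem_localAlg x hA)
    have hc : cov ω (emb A) (emb B) x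
        = ω (emb (star (shiftObs x A) * B)) - ω (emb (star (shiftObs x A))) * ω (emb B) := by
      rw [emb_mul, emb_star, emb_shiftObs, cov, ← shift_star, hinv.map_shift]
    have hnorm : ‖star (shiftObs x A)‖ = ‖A‖ := by
      rw [← norm_emb, emb_star, norm_star_alg, emb_shiftObs, norm_shift, norm_emb]
    have hdist : ((n - 2 * m : ℕ) : ℕ∞) ≤ obsDist (star (shiftObs x A)) B := by
      refine le_iInf₂ fun y hy => le_iInf₂ fun z hz => ?_
      obtain ⟨y', hy', rfl⟩ := Finset.mem_map.1 (supp_subset hA' hy)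
      have hz' := mem_ball.1 (supp_subset hB hz)
      have hy'' := mem_ball.1 hy'
      have h1 := siteDist_triangle (y' + x) z 0
      have h2 : siteDist x 0 ≤ siteDist (y' + x) 0 + siteDist y' 0 := by
        have := siteDist_add_zero_le (y' + x) (-y')
        rwa [add_neg_cancel_comm, siteDist_neg_zero] at this
      simp only [Equiv.coe_toEmbedding, Equiv.coe_addRight]
      exact_mod_cast (by omega : n - 2 * m ≤ siteDist (y' + x) z)
    have hrhs : 0 ≤ ‖A‖ * ‖B‖ * clusterConst D p ν m * siteWeight p x := by
      have := clusterConst_nonneg (D := D) (p := p) hν m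
      have := (siteWeight_pos p x).le
      positivity
    rcases eq_or_ne (obsDist (star (shiftObs x A)) B) ⊤ with htop | htop
    · -- one of the two observables is a multiple of the identity
      have h0 : supp (star (shiftObs x A)) = ∅ ∨ supp B = ∅ := by
        by_contra! hne
        obtain ⟨⟨y, hy⟩, ⟨z, hz⟩⟩ := hne
        simp only [obsDist, iInf_eq_top] at htop
        exact absurd (htop y hy z hz) (by simp)
      have : cov ω (emb A) (emb B) x = 0 := by
        rw [hc]
        rcases h0 with h0 | h0 <;> obtain ⟨c, hc⟩ := eq_algebraMap_of_supp_eq_empty h0 <;>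
          rw [hc, Algebra.algebraMap_eq_smul_one]
        · rw [smul_one_mul, emb_smul, emb_smul, hinv.map_smul, hinv.map_smul, emb_one,
            hinv.map_one, mul_one, sub_self]
        · rw [mul_smul_one, emb_smul, emb_smul, hinv.map_smul, hinv.map_smul, emb_one,
            hinv.map_one, mul_one, mul_comm, sub_self]
      rw [this, norm_zero]
      exact hrhs
    · obtain ⟨k, hk⟩ := ENat.ne_top_iff_exists.1 htop
      rw [← hk] at hdist
      have hkn : n - 2 * m ≤ k := by exact_mod_cast hdist
      have h1 := hcl ((ball D m).card + 1) (star (shiftObs x A)) B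
        (Nat.lt_succ_of_le ((size_le_card hA').trans_eq (Finset.card_map _)))
        (Nat.lt_succ_of_le (size_le_card hB)) k hk.symm
      rw [← hc, hnorm] at h1
      refine h1.trans ?_
      have hk0 : 0 < k := by omega
      have h2 : f k ≤ 4 ^ p * siteWeight p x := by
        refine (hf k hk0).trans ?_
        rw [hw, Real.rpow_neg (by positivity), ← div_eq_mul_inv, ← Real.div_rpow (by norm_num) (by positivity),
          ← Real.inv_rpow (by positivity)]
        refine Real.rpow_le_rpow (by positivity) ?_ hp.le
        rw [inv_eq_one_div, div_le_div_iff₀ (by exact_mod_cast hk0) (by positivity)]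
        have : 1 + n ≤ 4 * k := by omega
        rw [one_mul]
        exact_mod_cast this
      calc ν ((ball D m).card + 1) * ‖A‖ * ‖B‖ * f k
          ≤ ν ((ball D m).card + 1) * ‖A‖ * ‖B‖ * (4 ^ p * siteWeight p x) := by gcongr
        _ = ‖A‖ * ‖B‖ * (4 ^ p * ν ((ball D m).card + 1)) * siteWeight p x := by ring
        _ ≤ ‖A‖ * ‖B‖ * clusterConst D p ν m * siteWeight p x := by
          have := (siteWeight_pos p x).le
          have h3 : (0 : ℝ) ≤ 2 * (1 + 4 * (m : ℝ)) ^ p := by positivity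
          gcongr
          unfold clusterConst
          linarith

theorem IsClustering.exists_isPClustering (hω : IsClustering ω) :
    ∃ p : ℝ, (D : ℝ) < p ∧ ∃ ν : ℕ → ℝ, (∀ ℓ, 0 ≤ ν ℓ) ∧ IsPClustering p ν ω := by
  obtain ⟨p, hp, ν, hν, h⟩ := hω
  exact ⟨p, hp, ν, fun ℓ => (hν ℓ).le, h ω rfl⟩

theorem IsClustering.isInvariantState (hω : IsClustering ω) : IsInvariantState ω := by
  obtain ⟨p, hp, ν, hν, h⟩ := hω
  exact (h ω rfl).1

theorem IsClustering.summable_cov (hD : 1 ≤ D) (hω : IsClustering ω) (A B : O.obs) :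
    Summable (cov ω (emb A) (emb B)) := by
  obtain ⟨p, hp, ν, hν, h⟩ := hω.exists_isPClustering
  obtain ⟨m, hm⟩ := exists_ball A
  obtain ⟨n, hn⟩ := exists_ball B
  have hp0 : 0 < p := lt_of_le_of_lt (Nat.cast_nonneg D) hp
  exact Summable.of_norm_bounded ((summable_siteWeight hD hp).mul_left _)
    (norm_cov_le hp0 hν h (localAlg_mono (ball_mono (le_max_left m n)) hm)
      (localAlg_mono (ball_mono (le_max_right m n)) hn))

/-! ### The susceptibility forms -/

theorem conj_leftForm (hω : IsInvariantState ω) (a b : O.Alg) :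
    (starRingEnd ℂ) (leftForm ω a b) = leftForm ω b a := by
  rw [leftForm_eq_tsum, leftForm_eq_tsum, Complex.conj_tsum,
    ← (Equiv.neg (Site D)).tsum_eq (cov ω b a)]
  exact tsum_congr fun x => conj_cov hω a b x

theorem conj_symForm (hω : IsInvariantState ω) (a b : O.Alg) :
    (starRingEnd ℂ) (symForm ω a b) = symForm ω b a := by
  rw [symForm, symForm, map_div₀, map_add, conj_leftForm hω, conj_leftForm hω, Complex.conj_ofNat]

theorem symForm_star (a b : O.Alg) : symForm ω (star b) (star a) = symForm ω a b := by
  rw [symForm, symForm, star_star, star_star, add_comm]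

theorem IsClustering.leftForm_add_right (hD : 1 ≤ D) (hω : IsClustering ω) (A B C : O.obs) :
    leftForm ω (emb A) (emb (B + C)) = leftForm ω (emb A) (emb B) + leftForm ω (emb A) (emb C) := by
  rw [emb_add, leftForm_eq_tsum, leftForm_eq_tsum, leftForm_eq_tsum,
    ← (hω.summable_cov hD A B).tsum_add (hω.summable_cov hD A C)]
  exact tsum_congr fun x => cov_add_right hω.isInvariantState.toIsState _ _ _ x

theorem leftForm_smul_right (hω : IsInvariantState ω) (a b : O.Alg) (c : ℂ) :
    leftForm ω a (c • b) = c * leftForm ω a b := by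
  rw [leftForm_eq_tsum, leftForm_eq_tsum, ← tsum_mul_left]
  exact tsum_congr fun x => cov_smul_right hω.toIsState _ _ _ x

theorem IsClustering.leftForm_add_left (hD : 1 ≤ D) (hω : IsClustering ω) (A B C : O.obs) :
    leftForm ω (emb (A + B)) (emb C) = leftForm ω (emb A) (emb C) + leftForm ω (emb B) (emb C) := by
  have h := hω.isInvariantState
  rw [← conj_leftForm h, hω.leftForm_add_right hD, map_add, conj_leftForm h, conj_leftForm h]

theorem leftForm_smul_left (hω : IsInvariantState ω) (a b : O.Alg) (c : ℂ) :
    leftForm ω (c • a) b = (starRingEnd ℂ) c * leftForm ω a b := by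
  rw [← conj_leftForm hω, leftForm_smul_right hω, map_mul, conj_leftForm hω]

theorem IsClustering.symForm_add_right (hD : 1 ≤ D) (hω : IsClustering ω) (A B C : O.obs) :
    symForm ω (emb A) (emb (B + C)) = symForm ω (emb A) (emb B) + symForm ω (emb A) (emb C) := by
  have := hω.leftForm_add_left hD (star B) (star C) (star A)
  rw [← star_add] at this
  simp only [symForm, hω.leftForm_add_right hD, ← emb_star, this]
  ring

theorem symForm_smul_right (hω : IsInvariantState ω) (a b : O.Alg) (c : ℂ) :
    symForm ω a (c • b) = c * symForm ω a b := by
  rw [symForm, symForm, leftForm_smul_right hω, star_smul, leftForm_smul_left hω]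
  simp only [RCLike.star_def, Complex.conj_conj]
  ring

theorem map_star_centre_mul (hω : IsState ω) (a b : O.Alg) :
    ω (star (centre ω a) * b) = ω (star a * b) - ω (star a) * ω b := by
  have h1 : star (centre ω a) * b = star a * b - (ω (star a)) • b := by
    rw [centre, Algebra.algebraMap_eq_smul_one, star_sub, star_smul, star_one, sub_mul,
      smul_one_mul, hω.map_star, RCLike.star_def]
  rw [h1, hω.map_sub, hω.map_smul]

theorem map_star_centre_mul_centre (hω : IsState ω) (a b : O.Alg) :
    ω (star (centre ω a) * centre ω b) = ω (star a * b) - ω (star a) * ω b := by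
  rw [map_star_centre_mul hω, centre, mul_sub, Algebra.algebraMap_eq_smul_one, mul_smul_one,
    hω.map_sub, hω.map_sub, hω.map_smul, hω.map_smul, hω.map_one]
  ring

/-- The variance of a sum of translates is the double sum of covariances at the differences. -/
theorem variance_sum_shift (hω : IsInvariantState ω) (a : O.Alg) (s : Finset (Site D)) :
    ω (star (centre ω (∑ x ∈ s, shift x a)) * centre ω (∑ x ∈ s, shift x a))
      = ∑ x ∈ s, ∑ y ∈ s, cov ω a a (x - y) := by
  rw [map_star_centre_mul_centre hω.toIsState, star_sum, Finset.sum_mul_sum, hω.map_sum]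
  simp_rw [hω.map_sum, Finset.sum_mul_sum, ← Finset.sum_sub_distrib]
  refine Finset.sum_congr rfl fun x _ => Finset.sum_congr rfl fun y _ => ?_
  rw [← cov_shift hω, ← shift_star, hω.map_shift x, hω.map_shift y]

/-- The variance of an extensive sum, per volume, tends to the susceptibility. -/
theorem IsClustering.tendsto_variance (hD : 1 ≤ D) (hω : IsClustering ω) (A : O.obs) :
    Tendsto (fun m : ℕ => ω (star (centre ω (∑ x ∈ box D m, shift x (emb A)))
      * centre ω (∑ x ∈ box D m, shift x (emb A))) / ((box D m).card : ℂ)) atTop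
      (𝓝 (leftForm ω (emb A) (emb A))) := by
  simp_rw [variance_sum_shift hω.isInvariantState]
  exact tendsto_box_average (hω.summable_cov hD A A)

/-- The susceptibility is a limit of variances per volume, hence nonnegative. -/
theorem IsClustering.leftForm_self_nonneg (hD : 1 ≤ D) (hω : IsClustering ω) (A : O.obs) :
    0 ≤ (leftForm ω (emb A) (emb A)).re := by
  refine ge_of_tendsto ((Complex.continuous_re.tendsto _).comp (hω.tendsto_variance hD A))
    (Eventually.of_forall fun m => ?_)
  simp only [Function.comp_apply, Complex.div_natCast_re]
  exact div_nonneg (hω.isInvariantState.nonneg _).1 (Nat.cast_nonneg _)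

theorem IsClustering.symForm_self_nonneg (hD : 1 ≤ D) (hω : IsClustering ω) (A : O.obs) :
    0 ≤ (symForm ω (emb A) (emb A)).re := by
  have h1 := hω.leftForm_self_nonneg hD A
  have h2 := hω.leftForm_self_nonneg hD (star A)
  rw [emb_star] at h2
  rw [symForm]
  have : ((leftForm ω (emb A) (emb A) + leftForm ω (star (emb A)) (star (emb A))) / 2).re
      = ((leftForm ω (emb A) (emb A)).re + (leftForm ω (star (emb A)) (star (emb A))).re) / 2 := by
    simp
  rw [this]
  linarith

end Covariance

end ObsAlgebra

/-! ### Riesz representation for positive semidefinite forms -/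

section Riesz

variable {V : Type*} [AddCommGroup V] [Module ℂ V]

/-- Positive semidefinite hermitian forms, linear in the second argument. -/
structure IsPosForm (B : V → V → ℂ) : Prop where
  add_right : ∀ a b c, B a (b + c) = B a b + B a c
  smul_right : ∀ (z : ℂ) a b, B a (z • b) = z * B a b
  conj_symm : ∀ a b, (starRingEnd ℂ) (B a b) = B b a
  nonneg : ∀ a, 0 ≤ (B a a).re

variable {B : V → V → ℂ}

theorem IsPosForm.add_left (hB : IsPosForm B) (a b c : V) : B (a + b) c = B a c + B b c := by
  rw [← hB.conj_symm, hB.add_right, map_add, hB.conj_symm, hB.conj_symm]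

theorem IsPosForm.smul_left (hB : IsPosForm B) (z : ℂ) (a b : V) :
    B (z • a) b = (starRingEnd ℂ) z * B a b := by
  rw [← hB.conj_symm, hB.smul_right, map_mul, hB.conj_symm]

theorem IsPosForm.sub_left (hB : IsPosForm B) (a b c : V) : B (a - b) c = B a c - B b c := by
  rw [eq_sub_iff_add_eq, ← hB.add_left, sub_add_cancel]

/-- The Cauchy--Schwarz inequality. -/
theorem IsPosForm.norm_le (hB : IsPosForm B) (a b : V) :
    ‖B a b‖ ≤ √(B a a).re * √(B b b).re := by
  let core : PreInnerProductSpace.Core ℂ V :=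
    { inner := B
      conj_inner_symm := fun a b => hB.conj_symm b a
      re_inner_nonneg := hB.nonneg
      add_left := hB.add_left
      smul_left := fun a b z => hB.smul_left z a b }
  exact InnerProductSpace.Core.norm_inner_le_norm (c := core) a b

theorem IsPosForm.re_add_smul (hB : IsPosForm B) (b c : V) (z : ℂ) :
    (B (b + z • c) (b + z • c)).re
      = (B b b).re + 2 * (z * B b c).re + ‖z‖ ^ 2 * (B c c).re := by
  have h1 : B (b + z • c) (b + z • c)
      = B b b + (z * B b c + (starRingEnd ℂ) (z * B b c))
        + ((‖z‖ ^ 2 : ℝ) : ℂ) * B c c := by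
    rw [hB.add_left, hB.add_right, hB.add_right, hB.smul_right, hB.smul_right, hB.smul_left,
      hB.smul_left, map_mul, hB.conj_symm, ← Complex.normSq_eq_norm_sq, ← Complex.mul_conj]
    ring
  rw [h1, Complex.add_conj, Complex.add_re, Complex.add_re, Complex.re_ofReal_mul,
    Complex.ofReal_re]

/-- A linear functional bounded in the seminorm of a form is a limit, in the dual seminorm, of
functionals represented by vectors. The representing vectors are near-minimisers of
`B b b - 2 Re (P b)`. -/
theorem IsPosForm.exists_approx_riesz (hB : IsPosForm B) (P : V →ₗ[ℂ] ℂ) {K : ℝ}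
    (hP : ∀ a, ‖P a‖ ≤ K * √(B a a).re) {ε : ℝ} (hε : 0 < ε) :
    ∃ b, ∀ c, ‖P c - B b c‖ ≤ ε * √(B c c).re := by
  -- minimality of `b` up to `ε ^ 2`, tested in the direction `z • c`, bounds the residual `w`
  set J : V → ℝ := fun b => (B b b).re - 2 * (P b).re with hJ
  have hbdd : BddBelow (Set.range J) := by
    refine ⟨-K ^ 2, ?_⟩
    rintro _ ⟨b, rfl⟩
    have h1 := (Complex.re_le_norm (P b)).trans (hP b)
    have h2 := Real.sq_sqrt (hB.nonneg b)
    simp only [hJ]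
    nlinarith [sq_nonneg (√(B b b).re - K)]
  obtain ⟨b, hb⟩ := exists_lt_of_ciInf_lt
    (lt_add_of_pos_right (⨅ b, J b) (by positivity : 0 < ε ^ 2))
  refine ⟨b, fun c => ?_⟩
  set w := P c - B b c with hw
  have key : ∀ z : ℂ, 2 * (z * w).re ≤ ‖z‖ ^ 2 * (B c c).re + ε ^ 2 := by
    intro z
    have h1 : ⨅ b, J b ≤ J (b + z • c) := ciInf_le hbdd _
    simp only [hJ, hB.re_add_smul, map_add, map_smul, smul_eq_mul, Complex.add_re] at h1 hb
    have h2 : (z * w).re = (z * P c).re - (z * B b c).re := by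
      rw [hw, mul_sub, Complex.sub_re]
    linarith
  rcases eq_or_ne w 0 with h0 | h0
  · rw [h0, norm_zero]
    positivity
  have hw0 : 0 < ‖w‖ := norm_pos_iff.2 h0
  have key2 : ∀ r : ℝ, 2 * r * ‖w‖ ^ 2 ≤ r ^ 2 * ‖w‖ ^ 2 * (B c c).re + ε ^ 2 := by
    intro r
    have h1 := key (r * (starRingEnd ℂ) w)
    have h2 : ((r : ℂ) * (starRingEnd ℂ) w * w).re = r * ‖w‖ ^ 2 := by
      rw [mul_assoc, mul_comm ((starRingEnd ℂ) w), Complex.mul_conj, Complex.normSq_eq_norm_sq]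
      norm_cast
    rw [h2, norm_mul, Complex.norm_real, RCLike.norm_conj, mul_pow, Real.norm_eq_abs, sq_abs] at h1
    linarith
  set q := √(B c c).re with hq
  have hq2 : q ^ 2 = (B c c).re := Real.sq_sqrt (hB.nonneg c)
  rcases (Real.sqrt_nonneg (B c c).re).eq_or_lt with hq0 | hq0
  · have h1 := key2 (ε ^ 2 / ‖w‖ ^ 2)
    rw [← hq2, hq, ← hq0] at h1
    have h2 : 2 * (ε ^ 2 / ‖w‖ ^ 2) * ‖w‖ ^ 2 = 2 * ε ^ 2 := by field_simp
    rw [h2] at h1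
    nlinarith [sq_nonneg ε, pow_pos hε 2]
  · have h1 := key2 (ε / (‖w‖ * q))
    rw [← hq2] at h1
    have hq0' : 0 < q := hq0
    have h2 : 2 * (ε / (‖w‖ * q)) * ‖w‖ ^ 2 = 2 * ε * (‖w‖ / q) := by field_simp
    have h3 : (ε / (‖w‖ * q)) ^ 2 * ‖w‖ ^ 2 * q ^ 2 = ε ^ 2 := by field_simp
    rw [h2, h3] at h1
    have h4 : ‖w‖ / q ≤ ε := by nlinarith
    rwa [div_le_iff₀ hq0'] at h4

/-- Vectors representing the same functional up to small errors are close in seminorm. -/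
theorem IsPosForm.sqrt_sub_le (hB : IsPosForm B) {P : V → ℂ} {b c : V} {ε δ : ℝ}
    (hb : ∀ v, ‖P v - B b v‖ ≤ ε * √(B v v).re) (hc : ∀ v, ‖P v - B c v‖ ≤ δ * √(B v v).re)
    (hεδ : 0 ≤ ε + δ) : √(B (b - c) (b - c)).re ≤ ε + δ := by
  set v := b - c with hv
  have h1 : ‖B v v‖ ≤ (ε + δ) * √(B v v).re := by
    have : B v v = (P v - B c v) - (P v - B b v) := by
      conv_lhs => rw [hv, hB.sub_left]
      ring
    have hn : ‖B v v‖ ≤ ‖P v - B c v‖ + ‖P v - B b v‖ := by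
      conv_lhs => rw [this]
      exact norm_sub_le _ _
    linarith [hb v, hc v]
  have h2 := (Complex.re_le_norm (B v v)).trans h1
  by_contra! h3
  have h4 := Real.sq_sqrt (hB.nonneg v)
  nlinarith

/-- A vector representing a bounded functional up to a small error is bounded. -/
theorem IsPosForm.sqrt_self_le (hB : IsPosForm B) {P : V → ℂ} {b : V} {ε K : ℝ}
    (hP : ∀ a, ‖P a‖ ≤ K * √(B a a).re)
    (hb : ∀ v, ‖P v - B b v‖ ≤ ε * √(B v v).re) (hεK : 0 ≤ K + ε) :
    √(B b b).re ≤ K + ε := by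
  have h1 : ‖B b b‖ ≤ (K + ε) * √(B b b).re := by
    have : B b b = P b - (P b - B b b) := by ring
    have hn : ‖B b b‖ ≤ ‖P b‖ + ‖P b - B b b‖ := by
      conv_lhs => rw [this]
      exact norm_sub_le _ _
    linarith [hb b, hP b]
  have h2 := (Complex.re_le_norm (B b b)).trans h1
  by_contra! h3
  have h4 := Real.sq_sqrt (hB.nonneg b)
  nlinarith

end Riesz

/-- Diagonalisation: eventual properties hold along a slowly increasing sequence of indices. -/
theorem exists_slow_of_eventually {p : ℕ → ℕ → Prop} (h : ∀ k, ∀ᶠ n in atTop, p k n) :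
    ∃ κ : ℕ → ℕ, Tendsto κ atTop atTop ∧ ∀ᶠ n in atTop, p (κ n) n := by
  classical
  choose N hN using fun k => eventually_atTop.1 (h k)
  refine ⟨fun n => Nat.findGreatest (fun k => N k ≤ n) n, tendsto_atTop.2 fun K => ?_, ?_⟩
  · filter_upwards [eventually_ge_atTop (max (N K) K)] with n hn
    exact Nat.le_findGreatest ((le_max_right _ _).trans hn) ((le_max_left _ _).trans hn)
  · filter_upwards [eventually_ge_atTop (N 0)] with n hn
    exact hN _ _ (Nat.findGreatest_spec (P := fun k => N k ≤ n) (Nat.zero_le n) hn)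

/-- Partial sums of a dominated series are as close to the limit as those of the majorant. -/
theorem norm_tsum_sub_sum_le {ι : Type*} {f : ι → ℂ} {g : ι → ℝ} (hg : Summable g)
    (hfg : ∀ i, ‖f i‖ ≤ g i) (s : Finset ι) :
    ‖∑' i, f i - ∑ i ∈ s, f i‖ ≤ ∑' i, g i - ∑ i ∈ s, g i := by
  have hf : Summable f := Summable.of_norm_bounded hg hfg
  have h1 := hf.sum_add_tsum_compl (s := s)
  have h2 := hg.sum_add_tsum_compl (s := s)
  rw [← h1, ← h2, add_sub_cancel_left, add_sub_cancel_left]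
  exact tsum_of_norm_bounded (hg.subtype _).hasSum fun i => hfg i

namespace ObsAlgebra

/-! ### Bounded functionals are pseudolocal charges -/

section Charges

variable {D d : ℕ} {O : ObsAlgebra D d} {ω : O.Alg → ℂ}

theorem IsClustering.isPosForm_leftForm (hD : 1 ≤ D) (hω : IsClustering ω) :
    IsPosForm fun A B : O.obs => leftForm ω (emb A) (emb B) where
  add_right := hω.leftForm_add_right hD
  smul_right z a b := leftForm_smul_right hω.isInvariantState (emb a) (emb b) z
  conj_symm a b := conj_leftForm hω.isInvariantState (emb a) (emb b)
  nonneg := hω.leftForm_self_nonneg hD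

theorem IsClustering.isPosForm_symForm (hD : 1 ≤ D) (hω : IsClustering ω) :
    IsPosForm fun A B : O.obs => symForm ω (emb A) (emb B) where
  add_right := hω.symForm_add_right hD
  smul_right z a b := symForm_smul_right hω.isInvariantState (emb a) (emb b) z
  conj_symm a b := conj_symForm hω.isInvariantState (emb a) (emb b)
  nonneg := hω.symForm_self_nonneg hD

theorem symForm_self_re (a : O.Alg) : (symForm ω a a).re
    = ((leftForm ω a a).re + (leftForm ω (star a) (star a)).re) / 2 := by
  simp [symForm]

theorem IsClustering.leftForm_self_le (hD : 1 ≤ D) (hω : IsClustering ω) (A : O.obs) :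
    (leftForm ω (emb A) (emb A)).re ≤ 2 * (symForm ω (emb A) (emb A)).re := by
  have h := hω.leftForm_self_nonneg hD (star A)
  rw [emb_star] at h
  rw [symForm_self_re]
  linarith

/-- The half-width of the cube over which the density of a charge is summed: the cube lies well
inside the ball of radius `n`, and contains a ball of radius proportional to `n`. -/
def halfWidth (D n : ℕ) : ℕ := n / (2 * D)

/-- The sum of translates `∑ ι_x(C)` over a cube inside the ball of radius `n`. -/
def blockSum (C : O.obs) (n : ℕ) : O.obs := ∑ x ∈ box D (halfWidth D n), shiftObs x C

theorem emb_blockSum (C : O.obs) (n : ℕ) :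
    emb (blockSum C n) = ∑ x ∈ box D (halfWidth D n), shift x (emb C) := by
  rw [blockSum, emb_sum]; rfl

theorem shiftObs_star (x : Site D) (A : O.obs) : shiftObs x (star A) = star (shiftObs x A) :=
  Subtype.ext (map_star (translate (d := d) x) (A : Op D d))

theorem star_blockSum (C : O.obs) (n : ℕ) : star (blockSum C n) = blockSum (star C) n := by
  rw [blockSum, blockSum, star_sum]
  exact Finset.sum_congr rfl fun x _ => (shiftObs_star x C).symm

theorem shiftObs_mem_localAlg {m n : ℕ} {x : Site D} {A : O.obs}
    (hA : (A : Op D d) ∈ localAlg (ball D m)) (hn : siteDist x 0 + m ≤ n) :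
    (shiftObs x A : Op D d) ∈ localAlg (ball D n) := by
  refine localAlg_mono ?_ (translate_mem_localAlg x hA)
  intro y hy
  obtain ⟨z, hz, rfl⟩ := Finset.mem_map.1 hy
  have h1 := mem_ball.1 hz
  have h2 := siteDist_add_zero_le z x
  rw [mem_ball]
  simp only [Equiv.coe_toEmbedding, Equiv.coe_addRight]
  omega

theorem tendsto_halfWidth (hD : 1 ≤ D) : Tendsto (halfWidth D) atTop atTop :=
  Nat.tendsto_div_const_atTop (by omega)

theorem blockSum_mem_localAlg (C : O.obs) :
    ∀ᶠ n in atTop, (blockSum C n : Op D d) ∈ localAlg (ball D n) := by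
  obtain ⟨m, hm⟩ := exists_ball C
  filter_upwards [eventually_ge_atTop (2 * m)] with n hn
  rw [blockSum, AddSubmonoidClass.coe_finsetSum]
  refine sum_mem fun x hx => shiftObs_mem_localAlg hm ?_
  have h1 := mem_ball.1 (box_subset_ball _ hx)
  have h2 : D * halfWidth D n ≤ n / 2 := by
    rw [halfWidth, ← Nat.div_div_eq_div_mul]
    exact Nat.mul_div_le _ _
  omega

theorem card_box_halfWidth_le (hD : 1 ≤ D) {n : ℕ} (hn : 0 < n) :
    ((box D (halfWidth D n)).card : ℝ) ≤ 2 ^ D * (n : ℝ) ^ D := by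
  rw [card_box, ← mul_pow]
  have h1 : 2 * halfWidth D n + 1 ≤ 2 * n := by
    have : 2 * halfWidth D n ≤ n := by
      rw [halfWidth]
      calc 2 * (n / (2 * D)) ≤ (2 * D) * (n / (2 * D)) := Nat.mul_le_mul_right _ (by omega)
        _ ≤ n := Nat.mul_div_le _ _
    omega
  exact_mod_cast Nat.pow_le_pow_left h1 D

theorem IsClustering.variance_blockSum_le (hD : 1 ≤ D) (hω : IsClustering ω) (C : O.obs) :
    ∀ᶠ n : ℕ in atTop,
      (ω (star (centre ω (emb (blockSum C n))) * centre ω (emb (blockSum C n)))).re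
        ≤ ((leftForm ω (emb C) (emb C)).re + 1) * (2 ^ D * (n : ℝ) ^ D) := by
  have h1 := ((Complex.continuous_re.tendsto _).comp (hω.tendsto_variance hD C)).comp
    (tendsto_halfWidth hD)
  filter_upwards [h1.eventually (gt_mem_nhds (lt_add_one _)), eventually_gt_atTop 0] with n hn hn0
  simp only [Function.comp_apply, Complex.div_natCast_re] at hn
  have hc : (0 : ℝ) < (box D (halfWidth D n)).card := by rw [card_box]; positivity
  rw [div_lt_iff₀ hc] at hn
  rw [emb_blockSum]
  refine hn.le.trans ?_
  have := hω.leftForm_self_nonneg hD C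
  gcongr
  exact card_box_halfWidth_le hD hn0

/-- Block sums act on an observable, translated anywhere in a ball of radius proportional to `n`,
nearly as the full sum of covariances does, uniformly over the observables on a ball. -/
theorem IsClustering.blockSum_action (hD : 1 ≤ D) (hω : IsClustering ω) (C : O.obs) (m : ℕ)
    {ε : ℝ} (hε : 0 < ε) :
    ∀ᶠ n : ℕ in atTop, ∀ A : O.obs, (A : Op D d) ∈ localAlg (ball D m) → ∀ x : Site D,
      4 * D * siteDist x 0 ≤ n →
      ‖ω (star (centre ω (emb (blockSum C n))) * emb (shiftObs x A))
        - leftForm ω (emb C) (emb A)‖ ≤ ε * ‖A‖ := by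
  obtain ⟨p, hp, ν, hν, h⟩ := hω.exists_isPClustering
  have hinv := hω.isInvariantState
  obtain ⟨r, hr⟩ := exists_ball C
  have hp0 : 0 < p := lt_of_le_of_lt (Nat.cast_nonneg D) hp
  set k := ‖C‖ * clusterConst D p ν (max r m) with hk
  have hk0 : 0 ≤ k := mul_nonneg (norm_nonneg _) (clusterConst_nonneg hν _)
  have hs := (summable_siteWeight hD hp).mul_left k
  obtain ⟨s₀, hs₀⟩ := (Metric.tendsto_atTop.1 hs.hasSum) ε hε
  obtain ⟨R, hR⟩ := exists_subset_ball s₀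
  filter_upwards [eventually_ge_atTop (4 * D * (R + 1))] with n hn A hA x hx
  have hcov : ∀ z, ‖cov ω (emb C) (emb A) z‖ ≤ ‖A‖ * (k * siteWeight p z) := fun z => by
    have := norm_cov_le hp0 hν h (localAlg_mono (ball_mono (le_max_left r m)) hr)
      (localAlg_mono (ball_mono (le_max_right r m)) hA) z
    calc _ ≤ _ := this
      _ = _ := by rw [hk]; ring
  have h1 : ω (star (centre ω (emb (blockSum C n))) * emb (shiftObs x A))
      = ∑ z ∈ (box D (halfWidth D n)).map (Equiv.subRight x).toEmbedding,
          cov ω (emb C) (emb A) z := by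
    rw [map_star_centre_mul hinv.toIsState, emb_blockSum, star_sum, Finset.sum_mul,
      hinv.map_sum, hinv.map_sum, Finset.sum_mul, ← Finset.sum_sub_distrib, Finset.sum_map]
    refine Finset.sum_congr rfl fun z _ => ?_
    simp only [Equiv.coe_toEmbedding, Equiv.subRight_apply]
    rw [← cov_shift hinv, emb_shiftObs, ← shift_star, hinv.map_shift z, hinv.map_shift x]
  rw [h1, leftForm_eq_tsum, norm_sub_rev]
  refine (norm_tsum_sub_sum_le (hs.mul_left ‖A‖) hcov _).trans ?_
  rw [tsum_mul_left, ← Finset.mul_sum, ← mul_sub, mul_comm ε]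
  refine mul_le_mul_of_nonneg_left ?_ (norm_nonneg _)
  have h2 := hs₀ ((box D (halfWidth D n)).map (Equiv.subRight x).toEmbedding) ?_
  · rw [Real.dist_eq, abs_sub_comm] at h2
    exact (le_abs_self _).trans h2.le
  · intro z hz
    have hz' := mem_ball.1 (hR hz)
    refine Finset.mem_map.2 ⟨z + x, mem_box.2 fun i => ?_, by simp⟩
    have h3 := natAbs_le_siteDist z i
    have h4 := natAbs_le_siteDist x i
    have h5 : R + siteDist x 0 ≤ halfWidth D n := by
      rw [halfWidth, Nat.le_div_iff_mul_le (by omega)]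
      nlinarith
    simp only [Pi.add_apply]
    omega

/-- The requirements met by a block sum in a pseudolocal sequence, at precision `1 / (k + 1)`. -/
structure IsGoodBlock (ω : O.Alg → ℂ) (C : O.obs) (k n : ℕ) : Prop where
  mem : (blockSum C n : Op D d) ∈ localAlg (ball D n)
  variance : (ω (star (centre ω (emb (blockSum C n))) * centre ω (emb (blockSum C n)))).re
    ≤ ((leftForm ω (emb C) (emb C)).re + 1) * (2 ^ D * (n : ℝ) ^ D)
  action : ∀ A : O.obs, (A : Op D d) ∈ localAlg (ball D k) → ∀ x : Site D,
    4 * D * siteDist x 0 ≤ n →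
    ‖ω (star (centre ω (emb (blockSum C n))) * emb (shiftObs x A))
      - leftForm ω (emb C) (emb A)‖ ≤ 1 / ((k : ℝ) + 1) * ‖A‖

theorem IsClustering.eventually_isGoodBlock (hD : 1 ≤ D) (hω : IsClustering ω) (C : O.obs)
    (k : ℕ) : ∀ᶠ n in atTop, IsGoodBlock ω C k n := by
  filter_upwards [blockSum_mem_localAlg C, hω.variance_blockSum_le hD C,
    hω.blockSum_action hD C k (ε := 1 / ((k : ℝ) + 1)) (by positivity)] with n h1 h2 h3
  exact ⟨h1, h2, h3⟩

theorem shiftObs_zero (A : O.obs) : shiftObs 0 A = A :=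
  Subtype.ext (show (shift 0 (emb A) : Op D d) = A from congrArg Subtype.val (shift_zero (emb A)))

section Slow

variable {c : ℕ → O.obs} {κ : ℕ → ℕ} {Q : ℕ → O.obs}

/-- The action of the block sums on an observable approaches the susceptibility of the densities. -/
theorem tendsto_action_of_isGoodBlock (hκ : Tendsto κ atTop atTop)
    (hQ : ∀ᶠ n in atTop, Q n = blockSum (c (κ n)) n ∧ IsGoodBlock ω (c (κ n)) (κ n) n)
    (A : O.obs) : Tendsto (fun n => ω (star (centre ω (emb (Q n))) * emb A)
      - leftForm ω (emb (c (κ n))) (emb A)) atTop (𝓝 0) := by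
  obtain ⟨m, hm⟩ := exists_ball A
  have h0 : Tendsto (fun n => 1 / ((κ n : ℝ) + 1) * ‖A‖) atTop (𝓝 0) := by
    have := (tendsto_one_div_add_atTop_nhds_zero_nat (𝕜 := ℝ)).comp hκ
    simpa using this.mul_const ‖A‖
  refine squeeze_zero_norm' ?_ h0
  filter_upwards [hQ, hκ.eventually_ge_atTop m] with n hn hmn
  have := hn.2.action A (localAlg_mono (ball_mono hmn) hm) 0 (by simp [siteDist_zero_zero])
  rwa [shiftObs_zero, ← hn.1] at this

/-- Block sums of densities with bounded susceptibility and convergent action, along slowly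
increasing indices, form a pseudolocal sequence. -/
theorem isPseudolocalSeq_of_isGoodBlock (hD : 1 ≤ D) (hω : IsClustering ω)
    (hκ : Tendsto κ atTop atTop)
    (hQ : ∀ᶠ n in atTop, Q n = blockSum (c (κ n)) n ∧ IsGoodBlock ω (c (κ n)) (κ n) n)
    (hQ0 : ∀ n, (Q n = blockSum (c (κ n)) n ∧ IsGoodBlock ω (c (κ n)) (κ n) n) ∨ Q n = 0)
    {M : ℝ} (hM : ∀ k, (leftForm ω (emb (c k)) (emb (c k))).re ≤ M)
    (hc : ∀ A : O.obs, ∃ l, Tendsto (fun k => leftForm ω (emb (c k)) (emb A)) atTop (𝓝 l)) :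
    IsPseudolocalSeq ω Q where
  mem_ball n := by
    rcases hQ0 n with h | h
    · rw [h.1]; exact h.2.mem
    · rw [h]; exact zero_mem (localAlg (ball D n))
  volume_growth := by
    have hM0 : 0 ≤ M := (hω.leftForm_self_nonneg hD (c 0)).trans (hM 0)
    refine ⟨(M + 1) * 2 ^ D, by positivity, fun n hn => ?_⟩
    rcases hQ0 n with h | h
    · rw [h.1]
      refine h.2.variance.trans ?_
      rw [mul_assoc]
      have := hM (κ n)
      gcongr
    · have hz : centre ω (emb (Q n)) = 0 := by
        rw [h, emb_zero, centre, hω.isInvariantState.map_zero, map_zero, sub_zero]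
      rw [hz, mul_zero, hω.isInvariantState.map_zero, Complex.zero_re]
      positivity
  limit_action A := by
    obtain ⟨l, hl⟩ := hc A
    refine ⟨l, ?_⟩
    have := (tendsto_action_of_isGoodBlock hκ hQ A).add (hl.comp hκ)
    simpa using this
  homogeneity := by
    have hD0 : (0 : ℝ) < D := by exact_mod_cast hD
    refine ⟨1 / (4 * D), by positivity, ?_, fun A ε hε => ?_⟩
    · rw [div_lt_one (by positivity)]
      have : (1 : ℝ) ≤ D := by exact_mod_cast hD
      linarith
    obtain ⟨m, hm⟩ := exists_ball A
    have h0 : Tendsto (fun n => 2 * (1 / ((κ n : ℝ) + 1) * ‖A‖)) atTop (𝓝 0) := by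
      have := (tendsto_one_div_add_atTop_nhds_zero_nat (𝕜 := ℝ)).comp hκ
      simpa using (this.mul_const ‖A‖).const_mul 2
    filter_upwards [hQ, hκ.eventually_ge_atTop m, h0.eventually (gt_mem_nhds hε)]
      with n hn hmn hεn x y hx hy
    have hle : ∀ z : Site D, (siteDist z 0 : ℝ) ≤ 1 / (4 * D) * n → 4 * D * siteDist z 0 ≤ n := by
      intro z hz
      rw [one_div_mul_eq_div, le_div_iff₀ (by positivity)] at hz
      have : siteDist z 0 * (4 * D) ≤ n := by exact_mod_cast hz
      linarith
    have h1 := hn.2.action A (localAlg_mono (ball_mono hmn) hm) x (hle x hx)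
    have h2 := hn.2.action A (localAlg_mono (ball_mono hmn) hm) y (hle y hy)
    rw [← hn.1] at h1 h2
    rw [← sub_sub_sub_cancel_right _ _ (leftForm ω (emb (c (κ n))) (emb A))]
    refine (norm_sub_le _ _).trans_lt ?_
    linarith

end Slow

/-- Every functional that is bounded in the seminorm of the susceptibility form is a pseudolocal
charge. It is a limit of the actions of local densities, and block sums of these densities along a
slowly increasing sequence are pseudolocal. -/
theorem IsClustering.isPseudolocalCharge (hD : 1 ≤ D) (hω : IsClustering ω) (P : O.obs →ₗ[ℂ] ℂ)
    {K : ℝ} (hP : ∀ A : O.obs, ‖P A‖ ≤ K * √(symForm ω (emb A) (emb A)).re) :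
    IsPseudolocalCharge ω P := by
  classical
  have hinv := hω.isInvariantState
  have hS := hω.isPosForm_symForm hD
  have hL := hω.isPosForm_leftForm hD
  have hP' : ∀ A : O.obs, ‖P A‖ ≤ |K| * √(symForm ω (emb A) (emb A)).re := fun A =>
    (hP A).trans (mul_le_mul_of_nonneg_right (le_abs_self K) (Real.sqrt_nonneg _))
  choose b hb using fun k : ℕ => hS.exists_approx_riesz P hP'
    (by positivity : (0 : ℝ) < 1 / ((k : ℝ) + 1))
  have hε : Tendsto (fun k : ℕ => 1 / ((k : ℝ) + 1)) atTop (𝓝 0) :=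
    tendsto_one_div_add_atTop_nhds_zero_nat
  have hε1 : ∀ k : ℕ, 1 / ((k : ℝ) + 1) ≤ 1 := fun k => by
    rw [div_le_one (by positivity)]; linarith [(Nat.cast_nonneg k : (0 : ℝ) ≤ k)]
  have hε0 : ∀ k : ℕ, (0 : ℝ) < 1 / ((k : ℝ) + 1) := fun k => by positivity
  -- susceptibilities of the densities are bounded
  have hqb : ∀ k, (symForm ω (emb (b k)) (emb (b k))).re ≤ (|K| + 1) ^ 2 := by
    intro k
    have h1 := hS.sqrt_self_le hP' (hb k) (by have := hε0 k; positivity)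
    have h2 : √(symForm ω (emb (b k)) (emb (b k))).re ≤ |K| + 1 :=
      h1.trans (by linarith [hε1 k])
    exact (Real.sqrt_le_left (by positivity)).1 h2
  have hM : ∀ k, (leftForm ω (emb (b k)) (emb (b k))).re ≤ 2 * (|K| + 1) ^ 2 := fun k =>
    (hω.leftForm_self_le hD _).trans (by linarith [hqb k])
  have hM' : ∀ k, (leftForm ω (emb (star (b k))) (emb (star (b k)))).re ≤ 2 * (|K| + 1) ^ 2 :=
    fun k => (hω.leftForm_self_le hD _).trans (by
      rw [emb_star, symForm_star]; linarith [hqb k])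
  -- the one-sided actions converge, since both one-sided forms are dominated by the symmetric one
  have hcauchy : ∀ g : O.obs → O.obs, (∀ u v, g (u - v) = g u - g v) →
      (∀ u, symForm ω (emb (g u)) (emb (g u)) = symForm ω (emb u) (emb u)) → ∀ A : O.obs,
      ∃ l, Tendsto (fun k => leftForm ω (emb (g (b k))) (emb A)) atTop (𝓝 l) := by
    intro g hg1 hg2 A
    refine cauchySeq_tendsto_of_complete (Metric.cauchySeq_iff'.2 fun ε hε' => ?_)
    set a := √(leftForm ω (emb A) (emb A)).re with ha
    have h0 : Tendsto (fun k : ℕ => √2 * (2 * (1 / ((k : ℝ) + 1))) * a) atTop (𝓝 0) := by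
      simpa using ((hε.const_mul 2).const_mul √2).mul_const a
    obtain ⟨N, hN⟩ := eventually_atTop.1 (h0.eventually (gt_mem_nhds hε'))
    refine ⟨N, fun k hk => ?_⟩
    rw [dist_eq_norm, ← hL.sub_left, ← hg1]
    refine (hL.norm_le _ _).trans_lt (lt_of_le_of_lt ?_ (hN N le_rfl))
    refine mul_le_mul_of_nonneg_right ?_ (Real.sqrt_nonneg _)
    have h1 := hS.sqrt_sub_le (hb k) (hb N) (by linarith [hε0 k, hε0 N])
    have h2 : 1 / ((k : ℝ) + 1) ≤ 1 / ((N : ℝ) + 1) := by gcongr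
    calc √(leftForm ω (emb (g (b k - b N))) (emb (g (b k - b N)))).re
        ≤ √(2 * (symForm ω (emb (b k - b N)) (emb (b k - b N))).re) := by
          refine Real.sqrt_le_sqrt ?_
          rw [← hg2]
          exact hω.leftForm_self_le hD _
      _ = √2 * √(symForm ω (emb (b k - b N)) (emb (b k - b N))).re :=
          Real.sqrt_mul (by norm_num) _
      _ ≤ √2 * (2 * (1 / ((N : ℝ) + 1))) := by
          refine mul_le_mul_of_nonneg_left ?_ (Real.sqrt_nonneg _)
          linarith
  have hc := hcauchy id (fun _ _ => rfl) fun _ => rfl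
  have hc' := hcauchy star (fun u v => star_sub u v) fun u => by rw [emb_star, symForm_star]
  -- the density used in the ball of radius `n` changes so slowly with `n` that its block sum is good
  obtain ⟨κ, hκ, hgood⟩ := exists_slow_of_eventually (p := fun k n =>
    IsGoodBlock ω (b k) k n ∧ IsGoodBlock ω (star (b k)) k n) fun k =>
    (hω.eventually_isGoodBlock hD (b k) k).and (hω.eventually_isGoodBlock hD (star (b k)) k)
  set Q : ℕ → O.obs := fun n =>
    if IsGoodBlock ω (b (κ n)) (κ n) n ∧ IsGoodBlock ω (star (b (κ n))) (κ n) n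
    then blockSum (b (κ n)) n else 0 with hQdef
  have hQ : ∀ᶠ n in atTop, Q n = blockSum (b (κ n)) n ∧ IsGoodBlock ω (b (κ n)) (κ n) n := by
    filter_upwards [hgood] with n hn
    exact ⟨if_pos hn, hn.1⟩
  have hQs : ∀ᶠ n in atTop, star (Q n) = blockSum (star (b (κ n))) n
      ∧ IsGoodBlock ω (star (b (κ n))) (κ n) n := by
    filter_upwards [hgood] with n hn
    refine ⟨?_, hn.2⟩
    rw [← star_blockSum, hQdef]
    simp only [if_pos hn]
  refine ⟨Q, isPseudolocalSeq_of_isGoodBlock hD hω hκ hQ (fun n => ?_) hM hc,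
    isPseudolocalSeq_of_isGoodBlock (c := fun k => star (b k)) hD hω hκ hQs (fun n => ?_) hM' hc',
    fun A => ?_⟩
  · by_cases hn : IsGoodBlock ω (b (κ n)) (κ n) n ∧ IsGoodBlock ω (star (b (κ n))) (κ n) n
    · exact Or.inl ⟨if_pos hn, hn.1⟩
    · exact Or.inr (if_neg hn)
  · by_cases hn : IsGoodBlock ω (b (κ n)) (κ n) n ∧ IsGoodBlock ω (star (b (κ n))) (κ n) n
    · refine Or.inl ⟨?_, hn.2⟩
      rw [← star_blockSum, hQdef]
      simp only [if_pos hn]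
    · refine Or.inr ?_
      rw [hQdef]
      simp only [if_neg hn, star_zero]
  -- averaging the actions of `Q` and of `Q*` gives the symmetrised action
  · have h1 := tendsto_action_of_isGoodBlock hκ hQ A
    have h2 := (Complex.continuous_conj.tendsto _).comp
      (tendsto_action_of_isGoodBlock (c := fun k => star (b k)) hκ hQs (star A))
    have h3 : Tendsto (fun k => symForm ω (emb (b k)) (emb A)) atTop (𝓝 (P A)) := by
      rw [tendsto_iff_norm_sub_tendsto_zero]
      refine squeeze_zero (fun _ => norm_nonneg _) (fun k => ?_)
        (by simpa only [zero_mul] using hε.mul_const √(symForm ω (emb A) (emb A)).re)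
      rw [norm_sub_rev]
      exact hb k A
    have h4 := (((h1.add h2).div_const 2).add (h3.comp hκ))
    simp only [map_zero, add_zero, zero_div, zero_add] at h4
    refine h4.congr fun n => ?_
    simp only [Function.comp_apply, map_sub, conj_leftForm hinv]
    rw [map_star_centre_mul hinv.toIsState, map_star_centre_mul hinv.toIsState, symForm, map_sub,
      map_mul, ← hinv.map_star, ← hinv.map_star, ← hinv.map_star, hinv.map_add]
    simp only [emb_star, star_mul, star_star]
    ring

end Charges

end ObsAlgebra

/-! ### Inner dynamics in a C*-algebra -/

section Heis

variable {𝔸 : Type*} [NormedRing 𝔸] [NormedAlgebra ℂ 𝔸]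

/-- The Heisenberg evolution `exp(i t H) a exp(-i t H)` for the Hamiltonian `H`. -/
def heis (H : 𝔸) (t : ℝ) (a : 𝔸) : 𝔸 :=
  NormedSpace.exp ((Complex.I * t) • H) * a * NormedSpace.exp (-((Complex.I * t) • H))

theorem exp_I_smul (H : 𝔸) (t : ℝ) : NormedSpace.exp ((Complex.I * t) • H)
    = NormedSpace.exp (t • (Complex.I • H)) := by
  rw [mul_comm, mul_smul, Complex.coe_smul]

theorem exp_neg_I_smul (H : 𝔸) (t : ℝ) : NormedSpace.exp (-((Complex.I * t) • H))
    = NormedSpace.exp (t • (-(Complex.I • H))) := by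
  rw [mul_comm, mul_smul, Complex.coe_smul, smul_neg]

theorem heis_neg_ham (H : 𝔸) (t : ℝ) (a : 𝔸) : heis (-H) t a = heis H (-t) a := by
  simp [heis]

theorem heis_add_apply (H : 𝔸) (t : ℝ) (a b : 𝔸) : heis H t (a + b) = heis H t a + heis H t b := by
  simp only [heis, mul_add, add_mul]

theorem heis_sub_apply (H : 𝔸) (t : ℝ) (a b : 𝔸) : heis H t (a - b) = heis H t a - heis H t b := by
  simp only [heis, mul_sub, sub_mul]

theorem heis_smul_apply (H : 𝔸) (t : ℝ) (c : ℂ) (a : 𝔸) : heis H t (c • a) = c • heis H t a := by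
  simp only [heis, mul_smul_comm, smul_mul_assoc]

theorem heis_sum_apply (H : 𝔸) (t : ℝ) {ι : Type*} (s : Finset ι) (f : ι → 𝔸) :
    heis H t (∑ i ∈ s, f i) = ∑ i ∈ s, heis H t (f i) := by
  simp only [heis, Finset.mul_sum, Finset.sum_mul]

theorem heis_zero_time (H a : 𝔸) : heis H 0 a = a := by
  simp [heis]

section Star

variable [StarRing 𝔸] [StarModule ℂ 𝔸]

theorem I_smul_mem_skewAdjoint {H : 𝔸} (hH : star H = H) (t : ℝ) :
    (Complex.I * t) • H ∈ skewAdjoint 𝔸 := by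
  rw [skewAdjoint.mem_iff, star_smul, hH, ← neg_smul]
  congr 1
  simp

theorem star_heis [CStarRing 𝔸] {H : 𝔸} (hH : star H = H) (t : ℝ) (a : 𝔸) :
    star (heis H t a) = heis H t (star a) := by
  have h1 := skewAdjoint.mem_iff.1 (I_smul_mem_skewAdjoint hH t)
  rw [heis, star_mul, star_mul, NormedSpace.star_exp, NormedSpace.star_exp, star_neg, h1, neg_neg,
    heis, mul_assoc]

end Star

variable [CompleteSpace 𝔸]

theorem exp_mul_exp_neg (a : 𝔸) : NormedSpace.exp a * NormedSpace.exp (-a) = 1 := by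
  let _ : NormedAlgebra ℚ 𝔸 := NormedAlgebra.restrictScalars ℚ ℂ 𝔸
  rw [← NormedSpace.exp_add_of_commute (Commute.refl a).neg_right, add_neg_cancel,
    NormedSpace.exp_zero]

theorem exp_neg_mul_exp (a : 𝔸) : NormedSpace.exp (-a) * NormedSpace.exp a = 1 := by
  simpa using exp_mul_exp_neg (-a)

theorem heis_mul_apply (H : 𝔸) (t : ℝ) (a b : 𝔸) :
    heis H t (a * b) = heis H t a * heis H t b := by
  simp only [heis]
  calc _ = NormedSpace.exp ((Complex.I * t) • H) * a * 1 * b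
        * NormedSpace.exp (-((Complex.I * t) • H)) := by rw [mul_one, mul_assoc _ a b]
    _ = _ := by rw [← exp_neg_mul_exp ((Complex.I * t) • H)]; simp only [mul_assoc]

theorem heis_heis (H : 𝔸) (s t : ℝ) (a : 𝔸) : heis H s (heis H t a) = heis H (s + t) a := by
  let _ : NormedAlgebra ℚ 𝔸 := NormedAlgebra.restrictScalars ℚ ℂ 𝔸
  have hc : ∀ z w : ℂ, Commute (z • H) (w • H) := fun z w =>
    ((Commute.refl H).smul_left z).smul_right w
  have h1 : NormedSpace.exp ((Complex.I * (s + t : ℝ)) • H)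
      = NormedSpace.exp ((Complex.I * s) • H) * NormedSpace.exp ((Complex.I * t) • H) := by
    rw [← NormedSpace.exp_add_of_commute (hc _ _), ← add_smul, ← mul_add, ← Complex.ofReal_add]
  have h2 : NormedSpace.exp (-((Complex.I * (s + t : ℝ)) • H))
      = NormedSpace.exp (-((Complex.I * t) • H)) * NormedSpace.exp (-((Complex.I * s) • H)) := by
    rw [← NormedSpace.exp_add_of_commute ((hc _ _).neg_left.neg_right), ← neg_add, ← add_smul,
      ← mul_add, ← Complex.ofReal_add, add_comm]
  simp only [heis, h1, h2, mul_assoc]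

theorem heis_neg_heis (H : 𝔸) (t : ℝ) (a : 𝔸) : heis H (-t) (heis H t a) = a := by
  rw [heis_heis, neg_add_cancel, heis_zero_time]

theorem heis_heis_neg (H : 𝔸) (t : ℝ) (a : 𝔸) : heis H t (heis H (-t) a) = a := by
  rw [heis_heis, add_neg_cancel, heis_zero_time]

theorem heis_of_commute {H b : 𝔸} (h : Commute H b) (t : ℝ) : heis H t b = b := by
  let _ : NormedAlgebra ℚ 𝔸 := NormedAlgebra.restrictScalars ℚ ℂ 𝔸
  have : Commute (NormedSpace.exp ((Complex.I * t) • H)) b := (h.smul_left _).exp_left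
  rw [heis, this.eq, mul_assoc, exp_mul_exp_neg, mul_one]

/-- The product rule for the evolution of a moving observable. -/
theorem hasDerivAt_heis (H : 𝔸) {X : ℝ → 𝔸} {X' : 𝔸} {t : ℝ} (hX : HasDerivAt X X' t) :
    HasDerivAt (fun s => heis H s (X s))
      (heis H t (Complex.I • (H * X t - X t * H) + X')) t := by
  simp only [heis, exp_I_smul, exp_neg_I_smul]
  have h1 := hasDerivAt_exp_smul_const (𝕂 := ℝ) (Complex.I • H) t
  have h2 := hasDerivAt_exp_smul_const' (𝕂 := ℝ) (-(Complex.I • H)) t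
  refine ((h1.mul hX).mul h2).congr_deriv ?_
  simp only [Pi.mul_apply]
  simp only [mul_add, add_mul, mul_smul_comm, smul_mul_assoc,
    neg_mul, mul_neg, mul_assoc, sub_eq_add_neg, smul_add, smul_neg]
  abel

variable [StarRing 𝔸] [StarModule ℂ 𝔸] [CStarRing 𝔸]

theorem norm_heis {H : 𝔸} (hH : star H = H) (t : ℝ) (a : 𝔸) : ‖heis H t a‖ = ‖a‖ := by
  let _ : NormedAlgebra ℚ 𝔸 := NormedAlgebra.restrictScalars ℚ ℂ 𝔸
  have h1 := I_smul_mem_skewAdjoint hH t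
  rw [heis, CStarRing.norm_mul_mem_unitary _
      (NormedSpace.exp_mem_unitary_of_mem_skewAdjoint (neg_mem h1)),
    CStarRing.norm_mem_unitary_mul _ (NormedSpace.exp_mem_unitary_of_mem_skewAdjoint h1)]

/-- The commutator is transported by the evolution. -/
theorem norm_commutator_heis {H : 𝔸} (hH : star H = H) (t : ℝ) (a b : 𝔸) :
    ‖a * heis H (-t) b - heis H (-t) b * a‖ = ‖heis H t a * b - b * heis H t a‖ := by
  rw [← norm_heis hH t, heis_sub_apply, heis_mul_apply, heis_mul_apply, heis_heis_neg]

/-- Comparison of two dynamics: `F` backwards after `H` forwards moves `A` at most by the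
accumulated commutators of `A` with the evolved difference `H - F`. -/
theorem norm_heis_heis_sub_le {H F A : 𝔸} (hH : star H = H) (hF : star F = F) {B B' : ℝ → ℝ}
    (hB0 : 0 ≤ B 0) (hB : ∀ s, HasDerivAt B (B' s) s) {t : ℝ} (ht : 0 ≤ t)
    (hbd : ∀ s, 0 ≤ s → ‖heis H s (H - F) * A - A * heis H s (H - F)‖ ≤ B' s) :
    ‖heis F t (heis H (-t) A) - A‖ ≤ B t := by
  have hX : ∀ s, HasDerivAt (fun s => heis H (-s) A)
      (-(Complex.I • (H * heis H (-s) A - heis H (-s) A * H))) s := by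
    intro s
    have h1 := hasDerivAt_heis (-H) (hasDerivAt_const s A)
    simp only [heis_neg_ham, add_zero] at h1
    refine h1.congr_deriv ?_
    rw [heis_smul_apply, heis_sub_apply, heis_mul_apply, heis_mul_apply]
    have h2 : heis H (-s) (-H) = -H := heis_of_commute (Commute.refl H).neg_right _
    rw [h2, ← smul_neg]
    congr 1
    noncomm_ring
  have hf : ∀ s, HasDerivAt (fun s => heis F s (heis H (-s) A) - A)
      (heis F s (-(Complex.I • ((H - F) * heis H (-s) A - heis H (-s) A * (H - F))))) s := by
    intro s
    refine ((hasDerivAt_heis F (hX s)).sub_const A).congr_deriv ?_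
    congr 1
    rw [← sub_eq_add_neg, ← smul_sub, ← smul_neg]
    congr 1
    noncomm_ring
  refine image_norm_le_of_norm_deriv_right_le_deriv_boundary
    (fun s _ => (hf s).continuousAt.continuousWithinAt) (fun s _ => (hf s).hasDerivWithinAt)
    ?_ hB (fun s hs => ?_) ⟨ht, le_rfl⟩
  · simpa [heis_zero_time] using hB0
  · rw [norm_heis hF, norm_neg, norm_smul, Complex.norm_I, one_mul, norm_commutator_heis hH]
    exact hbd s hs.1

/-- One step of the Lieb--Robinson iteration. If `b` commutes with `F`, only the part `H - F` of
the Hamiltonian makes `b` spread, and the commutator of the evolved `b` with `A` is controlled by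
those of the evolved `H - F` with `A`. -/
theorem norm_commutator_heis_le {H F A b : 𝔸} (hH : star H = H) (hF : star F = F)
    (hb : Commute F b) {B B' : ℝ → ℝ}
    (hB0 : 0 ≤ B 0) (hB : ∀ s, HasDerivAt B (B' s) s) {t : ℝ} (ht : 0 ≤ t)
    (hbd : ∀ s, 0 ≤ s → ‖heis H s (H - F) * A - A * heis H s (H - F)‖ ≤ B' s) :
    ‖heis H t b * A - A * heis H t b‖ ≤ ‖b * A - A * b‖ + 2 * ‖b‖ * B t := by
  set Y := heis F t (heis H (-t) A) with hY
  have h1 : ‖heis H t b * A - A * heis H t b‖ = ‖b * Y - Y * b‖ := by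
    rw [← norm_commutator_heis hH, ← norm_heis hF t, heis_sub_apply, heis_mul_apply,
      heis_mul_apply, heis_of_commute hb]
  have h2 : b * Y - Y * b = (b * A - A * b) + (b * (Y - A) - (Y - A) * b) := by noncomm_ring
  have h3 := norm_heis_heis_sub_le hH hF hB0 hB ht hbd
  rw [h1, h2]
  refine (norm_add_le _ _).trans (add_le_add le_rfl ?_)
  refine (norm_sub_le _ _).trans ?_
  have h4 := norm_mul_le b (Y - A)
  have h5 := norm_mul_le (Y - A) b
  have h6 := mul_le_mul_of_nonneg_left h3 (norm_nonneg b)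
  rw [← hY] at h6
  linarith

/-- The Lieb--Robinson bound for a sum of bounded terms `g x`, each commuting with all but at most
`N` others. The function `lev` counts interaction steps: it grows by at most one between terms that
do not commute, and terms at positive level commute with `A`. -/
theorem lieb_robinson {ι : Type*} [DecidableEq ι] {Λ : Finset ι} {g : ι → 𝔸} {A : 𝔸} {J : ℝ}
    {N : ℕ} {nb : ι → Finset ι} {lev : ι → ℕ} (hg : ∀ x, star (g x) = g x) (hJ : ∀ x, ‖g x‖ ≤ J)
    (hcomm : ∀ x y, y ∉ nb x → Commute (g y) (g x)) (hN : ∀ x, (nb x).card ≤ N)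
    (hlev : ∀ x y, y ∈ nb x → lev x ≤ lev y + 1) (hA : ∀ x, 1 ≤ lev x → g x * A - A * g x = 0)
    {x : ι} {t : ℝ} (ht : 0 ≤ t) :
    ‖heis (∑ y ∈ Λ, g y) t (g x) * A - A * heis (∑ y ∈ Λ, g y) t (g x)‖
      ≤ 2 * J * ‖A‖ * ((2 * J * N * t) ^ lev x / (lev x).factorial) := by
  set H := ∑ y ∈ Λ, g y with hH
  have hHs : ∀ s : Finset ι, star (∑ y ∈ s, g y) = ∑ y ∈ s, g y := fun s => by
    rw [star_sum]; exact Finset.sum_congr rfl fun y _ => hg y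
  have hJ0 : 0 ≤ J := (norm_nonneg _).trans (hJ x)
  have key : ∀ k : ℕ, ∀ x, k ≤ lev x → ∀ t : ℝ, 0 ≤ t →
      ‖heis H t (g x) * A - A * heis H t (g x)‖
        ≤ 2 * J * ‖A‖ * ((2 * J * N * t) ^ k / k.factorial) := by
    intro k
    induction k with
    | zero =>
      intro x _ t _
      have h1 := norm_mul_le (heis H t (g x)) A
      have h2 := norm_mul_le A (heis H t (g x))
      rw [norm_heis (hHs Λ)] at h1 h2
      have h3 := mul_le_mul_of_nonneg_right (hJ x) (norm_nonneg A)
      refine (norm_sub_le _ _).trans ?_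
      simp only [pow_zero, Nat.factorial_zero, Nat.cast_one, div_one, mul_one]
      linarith
    | succ k ih =>
      intro x hx t ht
      set B : ℝ → ℝ := fun s => N * (2 * J * ‖A‖) * (2 * J * N) ^ k
        * (s ^ (k + 1) / (k + 1).factorial) with hBdef
      have hB : ∀ s, HasDerivAt B
          (N * (2 * J * ‖A‖ * ((2 * J * N * s) ^ k / k.factorial))) s := by
        intro s
        have h1 := (((hasDerivAt_pow (k + 1) s).div_const
          ((k + 1).factorial : ℝ)).const_mul (N * (2 * J * ‖A‖) * (2 * J * N) ^ k))
        refine h1.congr_deriv ?_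
        have : ((k.factorial : ℕ) : ℝ) ≠ 0 := by exact_mod_cast k.factorial_ne_zero
        rw [Nat.factorial_succ, Nat.add_sub_cancel, mul_pow _ s]
        push_cast
        field_simp
      have hF : Commute (∑ y ∈ Λ \ nb x, g y) (g x) :=
        Commute.sum_left _ _ _ fun y hy => hcomm x y (Finset.mem_sdiff.1 hy).2
      have hHF : H - ∑ y ∈ Λ \ nb x, g y = ∑ y ∈ Λ ∩ nb x, g y := by
        rw [sub_eq_iff_eq_add, hH, Finset.sum_inter_add_sum_sdiff]
      have h1 := norm_commutator_heis_le (A := A) (hHs Λ) (hHs _) hF (B := B)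
        (by simp [hBdef]) hB ht ?_
      · rw [hA x (by omega), norm_zero, zero_add] at h1
        refine h1.trans ?_
        have hB0 : 0 ≤ B t := by simp only [hBdef]; positivity
        calc 2 * ‖g x‖ * B t ≤ 2 * J * B t := by have := hJ x; gcongr
          _ = _ := by simp only [hBdef, mul_pow _ t, pow_succ (2 * J * N)]; ring
      · intro s hs
        rw [hHF, heis_sum_apply, Finset.sum_mul, Finset.mul_sum, ← Finset.sum_sub_distrib]
        refine (norm_sum_le _ _).trans ?_
        have h2 : ∀ y ∈ Λ ∩ nb x, ‖heis H s (g y) * A - A * heis H s (g y)‖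
            ≤ 2 * J * ‖A‖ * ((2 * J * N * s) ^ k / k.factorial) := fun y hy => by
          have := hlev x y (Finset.mem_inter.1 hy).2
          exact ih y (by omega) s hs
        refine (Finset.sum_le_card_nsmul _ _ _ h2).trans ?_
        rw [nsmul_eq_mul]
        have : ((Λ ∩ nb x).card : ℝ) ≤ N := by
          exact_mod_cast (Finset.card_le_card Finset.inter_subset_right).trans (hN x)
        gcongr
  exact key _ x le_rfl t ht

/-- Adding terms to the Hamiltonian changes the evolution of `A` by at most the Lieb--Robinson
bounds of the added terms. -/
theorem norm_heis_sub_heis_le {ι : Type*} [DecidableEq ι] {Λ Λ' : Finset ι} (hΛ : Λ ⊆ Λ')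
    {g : ι → 𝔸} {A : 𝔸} {J : ℝ} {N : ℕ} {nb : ι → Finset ι} {lev : ι → ℕ}
    (hg : ∀ x, star (g x) = g x) (hJ : ∀ x, ‖g x‖ ≤ J)
    (hcomm : ∀ x y, y ∉ nb x → Commute (g y) (g x)) (hN : ∀ x, (nb x).card ≤ N)
    (hlev : ∀ x y, y ∈ nb x → lev x ≤ lev y + 1) (hA : ∀ x, 1 ≤ lev x → g x * A - A * g x = 0)
    {t : ℝ} (ht : 0 ≤ t) :
    ‖heis (∑ y ∈ Λ', g y) t A - heis (∑ y ∈ Λ, g y) t A‖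
      ≤ ∑ x ∈ Λ' \ Λ, t * (2 * J * ‖A‖ * ((2 * J * N * t) ^ lev x / (lev x).factorial)) := by
  have hHs : ∀ s : Finset ι, star (∑ y ∈ s, g y) = ∑ y ∈ s, g y := fun s => by
    rw [star_sum]; exact Finset.sum_congr rfl fun y _ => hg y
  have hHn : ∀ s : Finset ι, star (-∑ y ∈ s, g y) = -∑ y ∈ s, g y := fun s => by
    rw [star_neg, hHs]
  have hneg : ∀ s : Finset ι, -∑ y ∈ s, g y = ∑ y ∈ s, -g y := fun s => by
    rw [Finset.sum_neg_distrib]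
  have hbd : ∀ x, ∀ s, 0 ≤ s → ‖heis (-∑ y ∈ Λ', g y) s (-g x) * A
      - A * heis (-∑ y ∈ Λ', g y) s (-g x)‖
      ≤ 2 * J * ‖A‖ * ((2 * J * N * s) ^ lev x / (lev x).factorial) := by
    intro x s hs
    rw [hneg]
    refine lieb_robinson (g := fun y => -g y) (nb := nb) (fun y => by rw [star_neg, hg])
      (fun y => by rw [norm_neg]; exact hJ y) (fun x y hy => (hcomm x y hy).neg_left.neg_right)
      hN hlev (fun y hy => ?_) hs
    rw [neg_mul, mul_neg, sub_neg_eq_add, neg_add_eq_sub, ← neg_sub, hA y hy, neg_zero]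
  have hdiff : -∑ y ∈ Λ', g y - -∑ y ∈ Λ, g y = ∑ y ∈ Λ' \ Λ, -g y := by
    rw [← Finset.sum_sdiff hΛ, Finset.sum_neg_distrib]; abel
  set B' : ℝ → ℝ := fun s => ∑ x ∈ Λ' \ Λ,
    2 * J * ‖A‖ * ((2 * J * N * s) ^ lev x / (lev x).factorial) with hB'
  -- the bound at the final time serves for all earlier times
  have h1 : ‖heis (-∑ y ∈ Λ, g y) t (heis (-∑ y ∈ Λ', g y) (-t) A) - A‖
      ≤ ∑ x ∈ Λ' \ Λ, t * (2 * J * ‖A‖ * ((2 * J * N * t) ^ lev x / (lev x).factorial)) := by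
    have hB : ∀ s, HasDerivAt (fun s => ∑ x ∈ Λ' \ Λ, 2 * J * ‖A‖ * ((2 * J * N) ^ lev x
        * (s ^ (lev x + 1) / (lev x + 1)) / (lev x).factorial)) (B' s) s := by
      intro s
      refine HasDerivAt.fun_sum fun x _ => ?_
      have h2 := (((((hasDerivAt_pow (lev x + 1) s).div_const ((lev x : ℝ) + 1)).const_mul
        ((2 * J * N) ^ lev x)).div_const ((lev x).factorial : ℝ)).const_mul (2 * J * ‖A‖))
      refine h2.congr_deriv ?_
      have : (lev x : ℝ) + 1 ≠ 0 := by positivity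
      rw [Nat.add_sub_cancel, mul_pow _ s]
      push_cast
      field_simp
    refine (norm_heis_heis_sub_le (hHn Λ') (hHn Λ) ?_ hB ht fun s hs => ?_).trans ?_
    · simp
    · rw [hdiff, heis_sum_apply, Finset.sum_mul, Finset.mul_sum, ← Finset.sum_sub_distrib]
      exact (norm_sum_le _ _).trans (Finset.sum_le_sum fun x _ => hbd x s hs)
    · refine Finset.sum_le_sum fun x _ => ?_
      have hJ0 : 0 ≤ J := (norm_nonneg _).trans (hJ x)
      have h3 : t ^ (lev x + 1) / ((lev x : ℝ) + 1) ≤ t ^ (lev x + 1) :=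
        div_le_self (by positivity) (by linarith [(Nat.cast_nonneg (lev x) : (0 : ℝ) ≤ lev x)])
      calc _ ≤ 2 * J * ‖A‖ * ((2 * J * N) ^ lev x * t ^ (lev x + 1) / (lev x).factorial) := by
            gcongr
        _ = _ := by rw [mul_pow _ t, pow_succ]; ring
  have h2 : ‖heis (∑ y ∈ Λ', g y) t A - heis (∑ y ∈ Λ, g y) t A‖
      = ‖heis (-∑ y ∈ Λ, g y) t (heis (-∑ y ∈ Λ', g y) (-t) A) - A‖ := by
    rw [← norm_heis (hHn Λ) t, heis_sub_apply, heis_neg_ham _ t (heis (∑ y ∈ Λ, g y) t A),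
      heis_neg_heis, heis_neg_ham _ (-t), neg_neg]
  rw [h2]
  exact h1

/-- Second-order Taylor bound for the evolution. -/
theorem norm_heis_sub_taylor_le {H A X : 𝔸} (hH : star H = H)
    (hX : X = Complex.I • (H * A - A * H)) {t : ℝ} (ht : 0 ≤ t) :
    ‖heis H t A - A - (t : ℂ) • X‖ ≤ t ^ 2 * ‖H * X - X * H‖ := by
  have hd : ∀ (Y : 𝔸) (s : ℝ), HasDerivAt (fun s => heis H s Y)
      (heis H s (Complex.I • (H * Y - Y * H))) s := fun Y s => by
    simpa using hasDerivAt_heis H (hasDerivAt_const s Y)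
  have h1 : ∀ s, 0 ≤ s → ‖heis H s X - X‖ ≤ s * ‖H * X - X * H‖ := by
    intro s hs
    refine image_norm_le_of_norm_deriv_right_le_deriv_boundary (a := 0) (b := s)
      (fun u _ => ((hd X u).sub_const X).continuousAt.continuousWithinAt)
      (fun u _ => ((hd X u).sub_const X).hasDerivWithinAt) ?_
      (B := fun u => u * ‖H * X - X * H‖) (B' := fun _ => ‖H * X - X * H‖) (fun u => ?_)
      (fun u _ => ?_) ⟨hs, le_rfl⟩
    · simp [heis_zero_time]
    · simpa using (hasDerivAt_id u).mul_const ‖H * X - X * H‖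
    · rw [norm_heis hH, norm_smul, Complex.norm_I, one_mul]
  have hf : ∀ s : ℝ, HasDerivAt (fun s : ℝ => heis H s A - A - (s : ℂ) • X)
      (heis H s X - X) s := by
    intro s
    have h2 : HasDerivAt (fun s : ℝ => (s : ℂ) • X) X s := by
      simpa using (hasDerivAt_id s).ofReal_comp.smul_const X
    have h3 := ((hd A s).sub_const A).sub h2
    rwa [← hX] at h3
  refine image_norm_le_of_norm_deriv_right_le_deriv_boundary (a := 0) (b := t)
    (fun u _ => (hf u).continuousAt.continuousWithinAt) (fun u _ => (hf u).hasDerivWithinAt) ?_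
    (B := fun u => u ^ 2 * ‖H * X - X * H‖) (B' := fun u => 2 * u * ‖H * X - X * H‖)
    (fun u => ?_) (fun u hu => ?_) ⟨ht, le_rfl⟩
  · simp [heis_zero_time]
  · simpa using (hasDerivAt_pow 2 u).mul_const ‖H * X - X * H‖
  · refine (h1 u hu.1).trans ?_
    have := hu.1
    have := norm_nonneg (H * X - X * H)
    nlinarith [mul_nonneg hu.1 this]

end Heis

/-- The factorial beats the power `(k + 1) ^ q`, with a constant independent of `k`. -/
theorem pow_mul_pow_div_factorial_le {c : ℝ} (hc : 0 ≤ c) (q k : ℕ) :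
    ((k : ℝ) + 1) ^ q * (c ^ k / k.factorial)
      ≤ q.factorial * Real.exp 1 * Real.exp (c * Real.exp 1) := by
  have h1 := Real.pow_div_factorial_le_exp ((k : ℝ) + 1) (by positivity) q
  have h2 := Real.pow_div_factorial_le_exp (c * Real.exp 1) (by positivity) k
  rw [div_le_iff₀ (by positivity)] at h1
  calc ((k : ℝ) + 1) ^ q * (c ^ k / k.factorial)
      ≤ Real.exp ((k : ℝ) + 1) * q.factorial * (c ^ k / k.factorial) := by gcongr
    _ = q.factorial * Real.exp 1 * ((c * Real.exp 1) ^ k / k.factorial) := by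
        rw [Real.exp_add, mul_pow, ← Real.exp_nat_mul, mul_one]; ring
    _ ≤ _ := by gcongr

namespace ObsAlgebra

/-! ### Time evolution on the lattice -/

section Evolution

variable {D d : ℕ} {O : ObsAlgebra D d}

/-- The Hamiltonian `∑ x ∈ Λ, ι_x(h)` of a finite region. -/
def localHam (h : O.obs) (Λ : Finset (Site D)) : O.Alg := ∑ x ∈ Λ, shift x (emb h)

theorem hamiltonian_eq (h : O.obs) (n : ℕ) : hamiltonian h n = localHam h (ball D n) := rfl

theorem evolve_eq (h : O.obs) (t : ℝ) (a : O.Alg) :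
    evolve h t a = limUnder atTop fun n : ℕ => heis (hamiltonian h n) t a := rfl

theorem star_shift_emb {h : O.obs} (hh : star h = h) (x : Site D) :
    star (shift x (emb h)) = shift x (emb h) := by
  rw [← shift_star, ← emb_star, hh]

theorem star_localHam {h : O.obs} (hh : star h = h) (Λ : Finset (Site D)) :
    star (localHam h Λ) = localHam h Λ := by
  rw [localHam, star_sum]
  exact Finset.sum_congr rfl fun x _ => star_shift_emb hh x

theorem star_hamiltonian {h : O.obs} (hh : star h = h) (n : ℕ) :
    star (hamiltonian h n) = hamiltonian h n := star_localHam hh _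

theorem commute_alg_of_disjoint {X Y : Finset (Site D)} (hXY : Disjoint X Y) {a b : O.Alg}
    (ha : (a : Op D d) ∈ localAlg X) (hb : (b : Op D d) ∈ localAlg Y) : Commute a b :=
  Subtype.ext (commute_of_disjoint hXY ha hb).eq

theorem commute_shift_emb {h : O.obs} {r : ℕ} (hr : (h : Op D d) ∈ localAlg (ball D r)) {A : O.obs}
    {m : ℕ} (hA : (A : Op D d) ∈ localAlg (ball D m)) {x : Site D} (hx : r + m < siteDist x 0) :
    Commute (shift x (emb h)) (emb A) := by
  refine commute_alg_of_disjoint ?_ (translate_mem_localAlg x hr) hA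
  refine Finset.disjoint_left.2 fun y hy hy' => ?_
  obtain ⟨z, hz, rfl⟩ := Finset.mem_map.1 hy
  have h1 := mem_ball.1 hz
  have h2 := mem_ball.1 hy'
  have h3 := siteDist_add_zero_le (z + x) (-z)
  rw [add_neg_cancel_comm, siteDist_neg_zero] at h3
  simp only [Equiv.coe_toEmbedding, Equiv.coe_addRight] at h2
  omega

theorem commute_shift_shift {h : O.obs} {r : ℕ} (hr : (h : Op D d) ∈ localAlg (ball D r))
    {x y : Site D} (hxy : 2 * r < siteDist (y - x) 0) :
    Commute (shift y (emb h)) (shift x (emb h)) := by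
  have h1 := commute_shift_emb hr hr (x := y - x) (by omega)
  have h2 := h1.map (shiftHom (O := O) x)
  rwa [shiftHom_apply, shiftHom_apply, shift_shift, add_sub_cancel] at h2

theorem siteWeight_natCast (q : ℕ) (x : Site D) :
    siteWeight q x = ((1 + (siteDist x 0 : ℝ)) ^ q)⁻¹ := by
  rw [siteWeight, Real.rpow_neg (by positivity), Real.rpow_natCast]

/-- Enlarging the region changes the evolution of a local observable by an amount that decays
faster than any power of the distance of the added sites. -/
theorem exists_norm_heis_sub_le {h : O.obs} (hh : star h = h) (A : O.obs) {t : ℝ} (ht : 0 ≤ t)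
    (q : ℕ) : ∃ C : ℝ, 0 ≤ C ∧ ∀ Λ Λ' : Finset (Site D), Λ ⊆ Λ' →
      ‖heis (localHam h Λ') t (emb A) - heis (localHam h Λ) t (emb A)‖
        ≤ ∑ x ∈ Λ' \ Λ, C * siteWeight q x := by
  classical
  -- terms commute unless their centres are within `2 r`, so that one interaction step covers a
  -- distance `2 r + 1`, and a term at distance beyond `r + m` commutes with `A`
  obtain ⟨r, hr⟩ := exists_ball h
  obtain ⟨m, hm⟩ := exists_ball A
  set N := (ball D (2 * r)).card with hN
  set c : ℝ := 2 * ‖h‖ * N * t with hc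
  have hc0 : 0 ≤ c := by positivity
  set K : ℝ := q.factorial * Real.exp 1 * Real.exp (c * Real.exp 1) with hK
  have hK0 : 0 ≤ K := by positivity
  set a : ℕ := (2 * r + 1) + (r + m) + 1 with ha
  refine ⟨t * (2 * ‖h‖ * ‖A‖ * (K * a ^ q)), by positivity, fun Λ Λ' hΛ => ?_⟩
  have h1 := norm_heis_sub_heis_le hΛ (g := fun x => shift x (emb h)) (A := emb A) (J := ‖h‖)
    (N := N) (nb := fun x => (ball D (2 * r)).map (Equiv.addRight x).toEmbedding)
    (lev := fun x => (siteDist x 0 - (r + m)) / (2 * r + 1))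
    (star_shift_emb hh) (fun x => by rw [norm_shift, norm_emb]) (fun x y hy => ?_)
    (fun x => (Finset.card_map _).le) (fun x y hy => ?_) (fun x hx => ?_) ht
  · refine h1.trans (Finset.sum_le_sum fun x _ => ?_)
    set k := (siteDist x 0 - (r + m)) / (2 * r + 1) with hk
    rw [norm_emb, mul_assoc t, mul_assoc (2 * ‖h‖ * ‖A‖)]
    refine mul_le_mul_of_nonneg_left (mul_le_mul_of_nonneg_left ?_ (by positivity)) ht
    rw [siteWeight_natCast, ← div_eq_mul_inv, le_div_iff₀ (by positivity)]
    have h2 : (1 + (siteDist x 0 : ℝ)) ^ q ≤ (a : ℝ) ^ q * ((k : ℝ) + 1) ^ q := by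
      rw [← mul_pow]
      refine pow_le_pow_left₀ (by positivity) ?_ q
      have h3 : siteDist x 0 - (r + m) < (2 * r + 1) * (k + 1) := by
        have := Nat.lt_mul_div_succ (siteDist x 0 - (r + m)) (by omega : 0 < 2 * r + 1)
        exact this
      have h4 : 1 + siteDist x 0 ≤ a * (k + 1) := by
        rw [ha, add_mul, add_mul]
        calc 1 + siteDist x 0 ≤ (siteDist x 0 - (r + m)) + (r + m) + 1 := by omega
          _ ≤ _ := add_le_add (add_le_add h3.le (Nat.le_mul_of_pos_right _ k.succ_pos))
            (Nat.le_mul_of_pos_right _ k.succ_pos)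
      exact_mod_cast h4
    calc c ^ k / k.factorial * (1 + (siteDist x 0 : ℝ)) ^ q
        ≤ c ^ k / k.factorial * ((a : ℝ) ^ q * ((k : ℝ) + 1) ^ q) := by gcongr
      _ = (((k : ℝ) + 1) ^ q * (c ^ k / k.factorial)) * (a : ℝ) ^ q := by ring
      _ ≤ K * (a : ℝ) ^ q := by
        have := pow_mul_pow_div_factorial_le hc0 q k
        gcongr
  · refine commute_shift_shift hr ?_
    by_contra! hle
    exact hy (Finset.mem_map.2 ⟨y - x, mem_ball.2 hle, by simp⟩)
  · obtain ⟨z, hz, rfl⟩ := Finset.mem_map.1 hy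
    have h2 := mem_ball.1 hz
    have h3 := siteDist_add_zero_le (z + x) (-z)
    rw [add_neg_cancel_comm, siteDist_neg_zero] at h3
    simp only [Equiv.coe_toEmbedding, Equiv.coe_addRight]
    rw [← Nat.add_div_right _ (by omega)]
    exact Nat.div_le_div_right (by omega)
  · have h2 : 2 * r + 1 ≤ siteDist x 0 - (r + m) := by
      by_contra! h3
      rw [Nat.div_eq_of_lt h3] at hx
      omega
    rw [(commute_shift_emb hr hm (by omega)).eq, sub_self]

/-- Finite-volume evolutions of a local observable form a Cauchy net over the finite regions. -/
theorem exists_norm_heis_sub_le_tail (hD : 1 ≤ D) {h : O.obs} (hh : star h = h) (A : O.obs) {t : ℝ}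
    (ht : 0 ≤ t) : ∃ u : Finset (Site D) → ℝ, Tendsto u atTop (𝓝 0) ∧
      ∀ Λ Λ' : Finset (Site D), Λ ⊆ Λ' →
        ‖heis (localHam h Λ') t (emb A) - heis (localHam h Λ) t (emb A)‖ ≤ u Λ := by
  classical
  obtain ⟨C, hC, hle⟩ := exists_norm_heis_sub_le hh A ht (D + 1)
  have hs := summable_siteWeight hD (p := ((D + 1 : ℕ) : ℝ)) (by push_cast; linarith)
  have hs' := hs.mul_left C
  refine ⟨fun Λ => ∑' x : Site D, C * siteWeight ((D + 1 : ℕ) : ℝ) x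
    - ∑ x ∈ Λ, C * siteWeight ((D + 1 : ℕ) : ℝ) x, ?_, fun Λ Λ' hΛ => (hle Λ Λ' hΛ).trans ?_⟩
  · simpa using hs'.hasSum.const_sub (∑' x : Site D, C * siteWeight ((D + 1 : ℕ) : ℝ) x)
  · rw [le_sub_iff_add_le, Finset.sum_sdiff hΛ]
    exact hs'.sum_le_tsum _ fun x _ => mul_nonneg hC (siteWeight_pos _ x).le

/-- The infinite-volume evolution exists for all times. -/
theorem tendsto_heis_evolve (hD : 1 ≤ D) {h : O.obs} (hh : star h = h) {t : ℝ} (ht : 0 ≤ t)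
    (a : O.Alg) : Tendsto (fun n => heis (hamiltonian h n) t a) atTop (𝓝 (evolve h t a)) := by
  rw [evolve_eq]
  refine CauchySeq.tendsto_limUnder (Metric.cauchySeq_iff'.2 fun ε hε => ?_)
  obtain ⟨b, ⟨A, rfl⟩, hA⟩ := Metric.mem_closure_iff.1 (denseRange_emb a) (ε / 3) (by positivity)
  obtain ⟨u, hu, hle⟩ := exists_norm_heis_sub_le_tail hD hh A ht
  obtain ⟨N, hN⟩ := eventually_atTop.1
    ((hu.comp tendsto_ball).eventually (gt_mem_nhds (by positivity : 0 < ε / 3)))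
  refine ⟨N, fun n hn => ?_⟩
  have hap : ∀ n, dist (heis (hamiltonian h n) t a) (heis (hamiltonian h n) t (emb A)) < ε / 3 := by
    intro n
    rwa [dist_eq_norm, ← heis_sub_apply, norm_heis (star_hamiltonian hh n), ← dist_eq_norm]
  have h1 := hap n
  have h2 := hap N
  have h3 : dist (heis (hamiltonian h n) t (emb A)) (heis (hamiltonian h N) t (emb A)) < ε / 3 := by
    rw [dist_eq_norm]
    exact (hle _ _ (ball_mono hn)).trans_lt (hN N le_rfl)
  have h4 := dist_triangle4 (heis (hamiltonian h n) t a) (heis (hamiltonian h n) t (emb A))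
    (heis (hamiltonian h N) t (emb A)) (heis (hamiltonian h N) t a)
  rw [dist_comm (heis (hamiltonian h N) t (emb A))] at h4
  linarith

section EvolveProps

variable (hD : 1 ≤ D) {h : O.obs} (hh : star h = h) {t : ℝ} (ht : 0 ≤ t)

include hD hh ht

theorem evolve_mul (a b : O.Alg) : evolve h t (a * b) = evolve h t a * evolve h t b :=
  tendsto_nhds_unique (tendsto_heis_evolve hD hh ht _)
    (((tendsto_heis_evolve hD hh ht a).mul (tendsto_heis_evolve hD hh ht b)).congr fun _ =>
      (heis_mul_apply _ t a b).symm)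

theorem evolve_star (a : O.Alg) : evolve h t (star a) = star (evolve h t a) :=
  tendsto_nhds_unique (tendsto_heis_evolve hD hh ht _)
    ((tendsto_heis_evolve hD hh ht a).star.congr fun n => star_heis (star_hamiltonian hh n) t a)

theorem evolve_evolve {s : ℝ} (hs : 0 ≤ s) (a : O.Alg) :
    evolve h s (evolve h t a) = evolve h (s + t) a := by
  have h1 : Tendsto (fun n => heis (hamiltonian h n) s (heis (hamiltonian h n) t a)
      - heis (hamiltonian h n) s (evolve h t a)) atTop (𝓝 0) := by
    have h2 := tendsto_iff_norm_sub_tendsto_zero.1 (tendsto_heis_evolve hD hh ht a)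
    rw [tendsto_zero_iff_norm_tendsto_zero]
    refine h2.congr fun n => ?_
    rw [← heis_sub_apply, norm_heis (star_hamiltonian hh n)]
  have h3 := h1.add (tendsto_heis_evolve hD hh hs (evolve h t a))
  simp only [sub_add_cancel, zero_add, heis_heis] at h3
  exact tendsto_nhds_unique h3 (tendsto_heis_evolve hD hh (add_nonneg hs ht) a)

/-- The evolution commutes with translations: it does not depend on how the finite regions
exhaust the lattice. -/
theorem shift_evolve (x : Site D) (A : O.obs) :
    shift x (evolve h t (emb A)) = evolve h t (emb (shiftObs x A)) := by
  have h1 : ∀ n, shift x (heis (hamiltonian h n) t (emb A))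
      = heis (localHam h ((ball D n).map (Equiv.addRight x).toEmbedding)) t
        (emb (shiftObs x A)) := by
    intro n
    have h2 : shift x (hamiltonian h n)
        = localHam h ((ball D n).map (Equiv.addRight x).toEmbedding) := by
      rw [hamiltonian_eq, localHam, localHam, Finset.sum_map, ← shiftHom_apply, map_sum]
      refine Finset.sum_congr rfl fun y _ => ?_
      simp only [Equiv.coe_toEmbedding, Equiv.coe_addRight]
      rw [shiftHom_apply, shift_shift, add_comm]
    let _ : NormedAlgebra ℚ O.Alg := NormedAlgebra.restrictScalars ℚ ℂ O.Alg
    have h3 : ∀ z : ℂ, shift x (NormedSpace.exp (z • hamiltonian h n))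
        = NormedSpace.exp (z • shift x (hamiltonian h n)) := fun z => by
      rw [← shift_smul, ← shiftHom_apply,
        NormedSpace.map_exp (shiftHom (O := O) x) (continuous_shift x), shiftHom_apply]
    rw [heis, shift_mul, shift_mul, ← neg_smul, h3, h3, h2, neg_smul, emb_shiftObs]
    rfl
  have h4 : Tendsto (fun n => shift x (heis (hamiltonian h n) t (emb A))) atTop
      (𝓝 (shift x (evolve h t (emb A)))) :=
    ((continuous_shift x).tendsto _).comp (tendsto_heis_evolve hD hh ht _)
  simp_rw [h1] at h4
  refine tendsto_nhds_unique h4 ?_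
  obtain ⟨u, hu, hle⟩ := exists_norm_heis_sub_le_tail hD hh (shiftObs x A) ht
  have h5 : Tendsto (fun n => heis (hamiltonian h (n + siteDist x 0)) t (emb (shiftObs x A)))
      atTop (𝓝 (evolve h t (emb (shiftObs x A)))) :=
    (tendsto_heis_evolve hD hh ht _).comp (tendsto_add_atTop_nat _)
  have h6 : Tendsto (fun n => (ball D n).map (Equiv.addRight x).toEmbedding) atTop atTop := by
    refine tendsto_atTop_finset_of_monotone
      (fun m n hmn => Finset.map_subset_map.2 (ball_mono hmn)) fun y =>
      ⟨siteDist (y - x) 0, Finset.mem_map.2 ⟨y - x, mem_ball.2 le_rfl, by simp⟩⟩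
  have h7 : Tendsto (fun n => heis (hamiltonian h (n + siteDist x 0)) t (emb (shiftObs x A))
      - heis (localHam h ((ball D n).map (Equiv.addRight x).toEmbedding)) t
        (emb (shiftObs x A))) atTop (𝓝 0) := by
    refine squeeze_zero_norm (fun n => hle _ _ fun y hy => ?_) (hu.comp h6)
    obtain ⟨z, hz, rfl⟩ := Finset.mem_map.1 hy
    have h8 := mem_ball.1 hz
    have h9 := siteDist_add_zero_le z x
    rw [mem_ball]
    simp only [Equiv.coe_toEmbedding, Equiv.coe_addRight]
    omega
  simpa using h5.sub h7

/-- The trace is invariant under every finite-volume evolution, hence under the limit. -/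
theorem IsTrace.map_evolve {ω : O.Alg → ℂ} (hω : IsState ω) (htr : IsTrace ω) (a : O.Alg) :
    ω (evolve h t a) = ω a := by
  refine tendsto_nhds_unique
    ((hω.continuous.tendsto _).comp (tendsto_heis_evolve hD hh ht a)) ?_
  refine tendsto_const_nhds.congr fun n => ?_
  rw [Function.comp_apply, heis, htr.map_mul_comm hω, ← mul_assoc, exp_neg_mul_exp, one_mul]

end EvolveProps

/-- Only translates of `h` that meet the support of `A` contribute, so a large ball suffices. -/
theorem lieAction_eq_sum {h : O.obs} {r : ℕ} (hr : (h : Op D d) ∈ localAlg (ball D r)) {A : O.obs}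
    {m : ℕ} (hA : (A : Op D d) ∈ localAlg (ball D m)) {n : ℕ} (hn : r + m ≤ n) :
    lieAction h A = ∑ x ∈ ball D n, (shiftObs x h * A - A * shiftObs x h) := by
  refine finsum_eq_sum_of_support_subset _ fun x hx => ?_
  by_contra hx'
  refine hx ?_
  have h1 : r + m < siteDist x 0 := by
    by_contra! h2
    exact hx' (mem_ball.2 (h2.trans hn))
  have h2 := (commute_shift_emb hr hA h1).eq
  have h3 : shiftObs x h * A = A * shiftObs x h := Subtype.ext (congrArg Subtype.val h2 :)
  exact sub_eq_zero.2 h3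

theorem commutator_hamiltonian (h A : O.obs) : ∀ᶠ n in atTop,
    hamiltonian h n * emb A - emb A * hamiltonian h n = emb (lieAction h A) := by
  obtain ⟨r, hr⟩ := exists_ball h
  obtain ⟨m, hm⟩ := exists_ball A
  filter_upwards [eventually_ge_atTop (r + m)] with n hn
  rw [lieAction_eq_sum hr hm hn, emb_sum, hamiltonian, Finset.sum_mul, Finset.mul_sum,
    ← Finset.sum_sub_distrib]
  rfl

theorem emb_injective : Function.Injective (emb : O.obs → O.Alg) := fun _ _ h =>
  Subtype.ext (congrArg (fun a : O.Alg => (a : Op D d)) h)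

theorem lieAction_add (h A B : O.obs) :
    lieAction h (A + B) = lieAction h A + lieAction h B := by
  obtain ⟨n, h1, h2, h3⟩ := ((commutator_hamiltonian h (A + B)).and
    ((commutator_hamiltonian h A).and (commutator_hamiltonian h B))).exists
  refine emb_injective ?_
  rw [emb_add, ← h1, ← h2, ← h3, emb_add]
  noncomm_ring

theorem lieAction_smul (h : O.obs) (c : ℂ) (A : O.obs) :
    lieAction h (c • A) = c • lieAction h A := by
  obtain ⟨n, h1, h2⟩ := ((commutator_hamiltonian h (c • A)).and
    (commutator_hamiltonian h A)).exists
  refine emb_injective ?_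
  rw [emb_smul, ← h1, ← h2, emb_smul, smul_sub, mul_smul_comm, smul_mul_assoc]

/-- `i 𝔏H` generates the evolution of local observables. -/
theorem exists_evolve_taylor (hD : 1 ≤ D) {h : O.obs} (hh : star h = h) (A : O.obs) :
    ∃ C : ℝ, ∀ t : ℝ, 0 ≤ t →
      ‖evolve h t (emb A) - emb A - (t : ℂ) • (Complex.I • emb (lieAction h A))‖ ≤ t ^ 2 * C := by
  refine ⟨‖emb (lieAction h (Complex.I • lieAction h A))‖, fun t ht => ?_⟩
  refine le_of_tendsto (((tendsto_heis_evolve hD hh ht (emb A)).sub_const (emb A)).sub_const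
    ((t : ℂ) • (Complex.I • emb (lieAction h A)))).norm ?_
  filter_upwards [commutator_hamiltonian h A,
    commutator_hamiltonian h (Complex.I • lieAction h A)] with n h1 h2
  have h3 := norm_heis_sub_taylor_le (star_hamiltonian hh n) (A := emb A)
    (X := Complex.I • emb (lieAction h A)) (by rw [h1]) ht
  rwa [← emb_smul, h2, emb_smul] at h3

/-! ### Local approximations of the evolution -/

theorem heis_mem_localSub {X : Finset (Site D)} {H a : O.Alg} (hH : H ∈ localSub O X)
    (ha : a ∈ localSub O X) (t : ℝ) : heis H t a ∈ localSub O X := by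
  have hexp : ∀ b ∈ localSub O X, NormedSpace.exp b ∈ localSub O X := fun b hb => by
    rw [NormedSpace.exp_eq_tsum ℂ]
    exact tsum_mem (isClosed_localSub X) fun i =>
      (localSub O X).smul_mem (pow_mem hb _) _
  have h1 := (localSub O X).smul_mem hH (Complex.I * t)
  exact mul_mem (mul_mem (hexp _ h1) ha) (hexp _ (neg_mem h1))

theorem heis_hamiltonian_mem {h : O.obs} {r : ℕ} (hr : (h : Op D d) ∈ localAlg (ball D r))
    {A : O.obs} {m : ℕ} (hA : (A : Op D d) ∈ localAlg (ball D m)) (t : ℝ) (n : ℕ) :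
    heis (hamiltonian h n) t (emb A) ∈ localSub O (ball D (n + (r + m))) := by
  refine heis_mem_localSub (sum_mem fun x hx => emb_mem_localSub.2 ?_)
    (emb_mem_localSub.2 (localAlg_mono (ball_mono (by omega)) hA)) t
  exact shiftObs_mem_localAlg hr (by have := mem_ball.1 hx; omega)

/-- The evolution of a local observable by the Hamiltonian of a ball, as a local observable. -/
def evolveObs (h : O.obs) (t : ℝ) (n : ℕ) (A : O.obs) : O.obs :=
  ⟨(heis (hamiltonian h n) t (emb A) : O.Alg), by
    obtain ⟨r, hr⟩ := exists_ball h
    obtain ⟨m, hm⟩ := exists_ball A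
    exact (heis_hamiltonian_mem hr hm t n).1⟩

theorem emb_evolveObs (h : O.obs) (t : ℝ) (n : ℕ) (A : O.obs) :
    emb (evolveObs h t n A) = heis (hamiltonian h n) t (emb A) := rfl

theorem evolveObs_add (h : O.obs) (t : ℝ) (n : ℕ) (A B : O.obs) :
    evolveObs h t n (A + B) = evolveObs h t n A + evolveObs h t n B :=
  Subtype.ext (congrArg Subtype.val (heis_add_apply (hamiltonian h n) t (emb A) (emb B)) :)

theorem evolveObs_smul (h : O.obs) (t : ℝ) (n : ℕ) (c : ℂ) (A : O.obs) :
    evolveObs h t n (c • A) = c • evolveObs h t n A :=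
  Subtype.ext (congrArg Subtype.val (heis_smul_apply (hamiltonian h n) t c (emb A)) :)

/-- The increments of the finite-volume evolutions, starting from the first one. -/
def evolveIncr (h : O.obs) (t : ℝ) (A : O.obs) : ℕ → O.obs
  | 0 => evolveObs h t 0 A
  | n + 1 => evolveObs h t (n + 1) A - evolveObs h t n A

theorem sum_evolveIncr (h : O.obs) (t : ℝ) (A : O.obs) (n : ℕ) :
    ∑ j ∈ Finset.range (n + 1), evolveIncr h t A j = evolveObs h t n A := by
  induction n with
  | zero => simp [evolveIncr]
  | succ n ih => rw [Finset.sum_range_succ, ih, evolveIncr, add_sub_cancel]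

theorem exists_evolveIncr_mem (h : O.obs) (t : ℝ) (A : O.obs) :
    ∃ m, ∀ n, (evolveIncr h t A n : Op D d) ∈ localAlg (ball D (n + m)) := by
  obtain ⟨r, hr⟩ := exists_ball h
  obtain ⟨m, hm⟩ := exists_ball A
  refine ⟨r + m, fun n => ?_⟩
  cases n with
  | zero => exact (heis_hamiltonian_mem hr hm t 0).2
  | succ n =>
    exact sub_mem (heis_hamiltonian_mem hr hm t (n + 1)).2
      (localAlg_mono (ball_mono (by omega)) (heis_hamiltonian_mem hr hm t n).2)

/-- The increments decay faster than any power. -/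
theorem summable_pow_mul_evolveIncr (hD : 1 ≤ D) {h : O.obs} (hh : star h = h) {t : ℝ} (ht : 0 ≤ t)
    (A : O.obs) (q : ℕ) : Summable fun n : ℕ => ((n : ℝ) + 1) ^ q * ‖evolveIncr h t A n‖ := by
  classical
  obtain ⟨C, hC, hle⟩ := exists_norm_heis_sub_le hh A ht (q + (D + 1))
  have hs := summable_siteWeight hD (p := ((D + 1 : ℕ) : ℝ)) (by push_cast; linarith)
  rw [← summable_nat_add_iff 1]
  refine summable_of_sum_range_le (c := C * ∑' x : Site D, siteWeight ((D + 1 : ℕ) : ℝ) x)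
    (fun n => by positivity) fun N => ?_
  have hterm : ∀ n : ℕ, (((n + 1 : ℕ) : ℝ) + 1) ^ q * ‖evolveIncr h t A (n + 1)‖
      ≤ C * (∑ x ∈ ball D (n + 1), siteWeight ((D + 1 : ℕ) : ℝ) x
        - ∑ x ∈ ball D n, siteWeight ((D + 1 : ℕ) : ℝ) x) := by
    intro n
    have h1 : ‖evolveIncr h t A (n + 1)‖ ≤ _ := hle _ _ (ball_mono (Nat.le_succ n))
    rw [← Finset.sum_sdiff (ball_mono (Nat.le_succ n)), add_sub_cancel_right, Finset.mul_sum]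
    refine (mul_le_mul_of_nonneg_left h1 (by positivity)).trans ?_
    rw [Finset.mul_sum]
    refine Finset.sum_le_sum fun x hx => le_of_eq ?_
    have hx1 := Finset.mem_sdiff.1 hx
    rw [mem_ball, mem_ball] at hx1
    have hx2 : siteDist x 0 = n + 1 := by omega
    rw [siteWeight_natCast, siteWeight_natCast, hx2, pow_add _ q, mul_inv, add_comm (1 : ℝ)]
    field_simp
  refine (Finset.sum_le_sum fun n _ => hterm n).trans ?_
  rw [← Finset.mul_sum, Finset.sum_range_sub fun n => ∑ x ∈ ball D n, siteWeight ((D + 1 : ℕ) : ℝ) x]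
  refine mul_le_mul_of_nonneg_left ?_ hC
  refine (sub_le_self _ (Finset.sum_nonneg fun x _ => (siteWeight_pos _ x).le)).trans ?_
  exact hs.sum_le_tsum _ fun x _ => (siteWeight_pos _ x).le

end Evolution

/-! ### Susceptibilities of evolved observables -/

section Extension

variable {D d : ℕ} {O : ObsAlgebra D d} {ω : O.Alg → ℂ}

theorem cov_sum (hω : IsState ω) (s s' : Finset ℕ) (Δ Δ' : ℕ → O.obs) (x : Site D) :
    cov ω (emb (∑ j ∈ s, Δ j)) (emb (∑ k ∈ s', Δ' k)) x
      = ∑ j ∈ s, ∑ k ∈ s', cov ω (emb (Δ j)) (emb (Δ' k)) x := by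
  simp only [cov, emb_sum]
  rw [← shiftHom_apply, map_sum, star_sum, star_sum, Finset.sum_mul_sum, hω.map_sum, hω.map_sum,
    hω.map_sum, Finset.sum_mul_sum, ← Finset.sum_sub_distrib]
  refine Finset.sum_congr rfl fun j _ => ?_
  rw [hω.map_sum, ← Finset.sum_sub_distrib]
  rfl

/-- Sums of observables whose covariances factorise into weights have covariances bounded by the
total weights. -/
theorem norm_cov_sum_le (hω : IsState ω) {s s' : Finset ℕ} {Δ Δ' : ℕ → O.obs} {g g' : ℕ → ℝ}
    {w : ℝ} {x : Site D}
    (h : ∀ j ∈ s, ∀ k ∈ s', ‖cov ω (emb (Δ j)) (emb (Δ' k)) x‖ ≤ g j * g' k * w) :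
    ‖cov ω (emb (∑ j ∈ s, Δ j)) (emb (∑ k ∈ s', Δ' k)) x‖
      ≤ (∑ j ∈ s, g j) * (∑ k ∈ s', g' k) * w := by
  rw [cov_sum hω, Finset.sum_mul_sum, Finset.sum_mul]
  refine (norm_sum_le _ _).trans (Finset.sum_le_sum fun j hj => ?_)
  rw [Finset.sum_mul]
  exact (norm_sum_le _ _).trans (Finset.sum_le_sum fun k hk => h j hj k hk)

theorem tendsto_leftForm {ι : Type*} {l : Filter ι} {φ : ι → O.Alg → ℂ} {a b : ι → O.Alg}
    {a₀ b₀ : O.Alg} {w : Site D → ℝ} (hw : Summable w)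
    (hlim : ∀ x, Tendsto (fun i => cov (φ i) (a i) (b i) x) l (𝓝 (cov ω a₀ b₀ x)))
    (hle : ∀ i x, ‖cov (φ i) (a i) (b i) x‖ ≤ w x) :
    Tendsto (fun i => leftForm (φ i) (a i) (b i)) l (𝓝 (leftForm ω a₀ b₀)) :=
  tendsto_tsum_of_dominated_convergence hw hlim (Eventually.of_forall hle)

theorem tendsto_symForm {ι : Type*} {l : Filter ι} {φ : ι → O.Alg → ℂ} {a b : ι → O.Alg}
    {a₀ b₀ : O.Alg} {w : Site D → ℝ} (hw : Summable w)
    (hlim : ∀ x, Tendsto (fun i => cov (φ i) (a i) (b i) x) l (𝓝 (cov ω a₀ b₀ x)))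
    (hlim' : ∀ x, Tendsto (fun i => cov (φ i) (star (b i)) (star (a i)) x) l
      (𝓝 (cov ω (star b₀) (star a₀) x)))
    (hle : ∀ i x, ‖cov (φ i) (a i) (b i) x‖ ≤ w x)
    (hle' : ∀ i x, ‖cov (φ i) (star (b i)) (star (a i)) x‖ ≤ w x) :
    Tendsto (fun i => symForm (φ i) (a i) (b i)) l (𝓝 (symForm ω a₀ b₀)) :=
  ((tendsto_leftForm hw hlim hle).add (tendsto_leftForm hw hlim' hle')).div_const 2

theorem symForm_self_re_le {a : O.Alg} {w : Site D → ℝ} (hw : Summable w)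
    (hle : ∀ x, ‖cov ω a a x‖ ≤ w x) (hle' : ∀ x, ‖cov ω (star a) (star a) x‖ ≤ w x) :
    (symForm ω a a).re ≤ ∑' x, w x := by
  have h1 : ‖leftForm ω a a‖ ≤ ∑' x, w x := tsum_of_norm_bounded hw.hasSum hle
  have h2 : ‖leftForm ω (star a) (star a)‖ ≤ ∑' x, w x := tsum_of_norm_bounded hw.hasSum hle'
  have h3 := (Complex.re_le_norm _).trans h1
  have h4 := (Complex.re_le_norm _).trans h2
  rw [symForm_self_re]
  linarith

theorem tendsto_cov {ι : Type*} {l : Filter ι} (hω : IsState ω) {a b : ι → O.Alg} {a₀ b₀ : O.Alg}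
    (ha : Tendsto a l (𝓝 a₀)) (hb : Tendsto b l (𝓝 b₀)) (x : Site D) :
    Tendsto (fun i => cov ω (a i) (b i) x) l (𝓝 (cov ω a₀ b₀ x)) := by
  have hc := hω.continuous
  have hs : Tendsto (fun i => star (shift x (a i))) l (𝓝 (star (shift x a₀))) :=
    (((continuous_shift x).tendsto a₀).comp ha).star
  exact ((hc.tendsto _).comp (hs.mul hb)).sub
    (((hc.tendsto _).comp ha.star).mul ((hc.tendsto _).comp hb))

/-- For power size functions the decay constants grow polynomially with the radius. -/
theorem exists_clusterConst_le {p ν a : ℝ} (hν : 0 < ν) (m : ℕ) :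
    ∃ C : ℝ, 1 ≤ C ∧ ∃ q : ℕ, ∀ j : ℕ,
      clusterConst D p (fun ℓ => ν * (ℓ : ℝ) ^ a) (j + m) ≤ C * ((j : ℝ) + 1) ^ q := by
  obtain ⟨q₁, hq₁⟩ := exists_nat_ge p
  obtain ⟨q₂, hq₂⟩ := exists_nat_ge a
  set c₁ : ℝ := 4 * (m : ℝ) + 4 with hc₁
  set c₂ : ℝ := (2 * (m : ℝ) + 2) ^ D + 1 with hc₂
  set C : ℝ := 2 * c₁ ^ q₁ + 4 ^ p * (ν * c₂ ^ q₂) with hC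
  have hc₁1 : 1 ≤ c₁ := by rw [hc₁]; linarith [(Nat.cast_nonneg m : (0 : ℝ) ≤ m)]
  have hc₂1 : 1 ≤ c₂ := by rw [hc₂]; linarith [(by positivity : 0 ≤ (2 * (m : ℝ) + 2) ^ D)]
  refine ⟨C, ?_, max q₁ (D * q₂), fun j => ?_⟩
  · have h1 : 1 ≤ c₁ ^ q₁ := one_le_pow₀ hc₁1
    have h2 : 0 ≤ (4 : ℝ) ^ p * (ν * c₂ ^ q₂) := by positivity
    rw [hC]; linarith
  · have hj : (1 : ℝ) ≤ (j : ℝ) + 1 := by linarith [(Nat.cast_nonneg j : (0 : ℝ) ≤ j)]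
    have hj0 : (0 : ℝ) ≤ j := Nat.cast_nonneg j
    have hm0 : (0 : ℝ) ≤ m := Nat.cast_nonneg m
    have h1 : (1 + 4 * ((j + m : ℕ) : ℝ)) ^ p ≤ c₁ ^ q₁ * ((j : ℝ) + 1) ^ max q₁ (D * q₂) := by
      have hb : 1 + 4 * ((j + m : ℕ) : ℝ) ≤ c₁ * ((j : ℝ) + 1) := by
        push_cast; rw [hc₁]; nlinarith
      have hb1 : 1 ≤ 1 + 4 * ((j + m : ℕ) : ℝ) := by
        linarith [(Nat.cast_nonneg (j + m) : (0 : ℝ) ≤ ((j + m : ℕ) : ℝ))]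
      calc (1 + 4 * ((j + m : ℕ) : ℝ)) ^ p ≤ (1 + 4 * ((j + m : ℕ) : ℝ)) ^ (q₁ : ℝ) :=
            Real.rpow_le_rpow_of_exponent_le hb1 hq₁
        _ = (1 + 4 * ((j + m : ℕ) : ℝ)) ^ q₁ := Real.rpow_natCast _ _
        _ ≤ (c₁ * ((j : ℝ) + 1)) ^ q₁ := by gcongr
        _ = c₁ ^ q₁ * ((j : ℝ) + 1) ^ q₁ := mul_pow _ _ _
        _ ≤ _ := by
          have := pow_le_pow_right₀ hj (le_max_left q₁ (D * q₂))
          gcongr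
    have h2 : (((ball D (j + m)).card + 1 : ℕ) : ℝ) ^ a
        ≤ c₂ ^ q₂ * ((j : ℝ) + 1) ^ max q₁ (D * q₂) := by
      have hb : (((ball D (j + m)).card + 1 : ℕ) : ℝ) ≤ c₂ * ((j : ℝ) + 1) ^ D := by
        have hcard : (((ball D (j + m)).card : ℕ) : ℝ) ≤ (2 * ((j + m : ℕ) : ℝ) + 1) ^ D := by
          exact_mod_cast card_ball_le (D := D) (j + m)
        have hpow : (2 * ((j + m : ℕ) : ℝ) + 1) ^ D
            ≤ (2 * (m : ℝ) + 2) ^ D * ((j : ℝ) + 1) ^ D := by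
          rw [← mul_pow]
          refine pow_le_pow_left₀ (by positivity) ?_ D
          push_cast
          nlinarith
        have h1 : 1 ≤ ((j : ℝ) + 1) ^ D := one_le_pow₀ hj
        push_cast
        rw [hc₂, add_mul, one_mul]
        linarith
      have hb1 : (1 : ℝ) ≤ (((ball D (j + m)).card + 1 : ℕ) : ℝ) := by
        exact_mod_cast Nat.le_add_left 1 _
      calc (((ball D (j + m)).card + 1 : ℕ) : ℝ) ^ a
          ≤ (((ball D (j + m)).card + 1 : ℕ) : ℝ) ^ (q₂ : ℝ) :=
            Real.rpow_le_rpow_of_exponent_le hb1 hq₂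
        _ = (((ball D (j + m)).card + 1 : ℕ) : ℝ) ^ q₂ := Real.rpow_natCast _ _
        _ ≤ (c₂ * ((j : ℝ) + 1) ^ D) ^ q₂ := by gcongr
        _ = c₂ ^ q₂ * ((j : ℝ) + 1) ^ (D * q₂) := by rw [mul_pow, pow_mul]
        _ ≤ _ := by
          have := pow_le_pow_right₀ hj (le_max_right q₁ (D * q₂))
          gcongr
    calc clusterConst D p (fun ℓ => ν * (ℓ : ℝ) ^ a) (j + m)
        ≤ 2 * (c₁ ^ q₁ * ((j : ℝ) + 1) ^ max q₁ (D * q₂))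
          + 4 ^ p * (ν * (c₂ ^ q₂ * ((j : ℝ) + 1) ^ max q₁ (D * q₂))) := by
          unfold clusterConst
          gcongr
          exact mul_le_mul_of_nonneg_left h2 hν.le
      _ = C * ((j : ℝ) + 1) ^ max q₁ (D * q₂) := by rw [hC]; ring

/-- Covariances of observables on balls of different radii are bounded by a
product of polynomial weights, one for each observable. -/
theorem exists_norm_cov_le_mul {p ν a : ℝ} (hp : 0 < p) (hν : 0 < ν) (m : ℕ) :
    ∃ C : ℝ, 1 ≤ C ∧ ∃ q : ℕ, ∀ ω : O.Alg → ℂ, IsPClustering p (fun ℓ => ν * (ℓ : ℝ) ^ a) ω →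
      ∀ (j k : ℕ) (A B : O.obs), (A : Op D d) ∈ localAlg (ball D (j + m)) →
        (B : Op D d) ∈ localAlg (ball D (k + m)) → ∀ x,
        ‖cov ω (emb A) (emb B) x‖ ≤ (C * (((j : ℝ) + 1) ^ q * ‖A‖)) * (C * (((k : ℝ) + 1) ^ q * ‖B‖))
          * siteWeight p x := by
  obtain ⟨C, hC, q, hle⟩ := exists_clusterConst_le (D := D) hν m
  refine ⟨C, hC, q, fun ω hω j k A B hA hB x => ?_⟩
  have hj : (1 : ℝ) ≤ (j : ℝ) + 1 := by linarith [(Nat.cast_nonneg j : (0 : ℝ) ≤ j)]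
  have hk : (1 : ℝ) ≤ (k : ℝ) + 1 := by linarith [(Nat.cast_nonneg k : (0 : ℝ) ≤ k)]
  have h1 := norm_cov_le hp (fun ℓ => by positivity) hω
    (localAlg_mono (ball_mono (by gcongr; exact le_max_left j k)) hA)
    (localAlg_mono (ball_mono (by gcongr; exact le_max_right j k)) hB) x (m := max j k + m)
  have h2 : clusterConst D p (fun ℓ => ν * (ℓ : ℝ) ^ a) (max j k + m)
      ≤ (C * ((j : ℝ) + 1) ^ q) * (C * ((k : ℝ) + 1) ^ q) := by
    refine (hle _).trans ?_
    have hj' : 1 ≤ C * ((j : ℝ) + 1) ^ q := one_le_mul_of_one_le_of_one_le hC (one_le_pow₀ hj)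
    have hk' : 1 ≤ C * ((k : ℝ) + 1) ^ q := one_le_mul_of_one_le_of_one_le hC (one_le_pow₀ hk)
    rcases max_choice j k with h | h <;> rw [h]
    · exact le_mul_of_one_le_right (by linarith) hk'
    · exact le_mul_of_one_le_left (by linarith) hj'
  refine h1.trans ?_
  have h3 := (siteWeight_pos p x).le
  calc _ ≤ ‖A‖ * ‖B‖ * ((C * ((j : ℝ) + 1) ^ q) * (C * ((k : ℝ) + 1) ^ q)) * siteWeight p x := by
        gcongr
    _ = _ := by ring

end Extension

section EvolvedForms

variable {D d : ℕ} {O : ObsAlgebra D d} {ω : O.Alg → ℂ}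

theorem evolveObs_star {h : O.obs} (hh : star h = h) (t : ℝ) (n : ℕ) (A : O.obs) :
    evolveObs h t n (star A) = star (evolveObs h t n A) :=
  emb_injective (star_heis (star_hamiltonian hh n) t (emb A)).symm

theorem evolveObs_zero (h : O.obs) (n : ℕ) (A : O.obs) : evolveObs h 0 n A = A := by
  refine emb_injective ?_
  rw [emb_evolveObs, heis]
  simp

theorem evolve_zero (h : O.obs) (A : O.obs) : evolve h 0 (emb A) = emb A :=
  Tendsto.limUnder_eq (tendsto_const_nhds.congr fun n => by
    rw [← heis, ← emb_evolveObs, evolveObs_zero])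

/-- Evolutions of local observables in finite volumes have covariances with a common summable
bound, uniformly in the volumes and in the state: the growth of the clustering constants with the
radius is polynomial, while the increments of the evolutions decay faster than any power. -/
theorem exists_norm_cov_evolveObs_le (hD : 1 ≤ D) {h : O.obs} (hh : star h = h) {t t' : ℝ}
    (ht : 0 ≤ t) (ht' : 0 ≤ t') {p ν a : ℝ} (hp : 0 < p) (hν : 0 < ν) (A B : O.obs) :
    ∃ M : ℝ, 0 ≤ M ∧ ∀ ω : O.Alg → ℂ, IsPClustering p (fun ℓ => ν * (ℓ : ℝ) ^ a) ω →
      ∀ (n n' : ℕ) (x : Site D),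
        ‖cov ω (emb (evolveObs h t n A)) (emb (evolveObs h t' n' B)) x‖ ≤ M * siteWeight p x := by
  obtain ⟨m, hm⟩ := exists_evolveIncr_mem h t A
  obtain ⟨m', hm'⟩ := exists_evolveIncr_mem h t' B
  obtain ⟨C, hC, q, hle⟩ := exists_norm_cov_le_mul (O := O) (a := a) hp hν (max m m')
  set g : ℕ → ℝ := fun j => C * (((j : ℝ) + 1) ^ q * ‖evolveIncr h t A j‖) with hg
  set g' : ℕ → ℝ := fun j => C * (((j : ℝ) + 1) ^ q * ‖evolveIncr h t' B j‖) with hg'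
  have hgs : Summable g := (summable_pow_mul_evolveIncr hD hh ht A q).mul_left C
  have hgs' : Summable g' := (summable_pow_mul_evolveIncr hD hh ht' B q).mul_left C
  have hg0 : ∀ j, 0 ≤ g j := fun j => by rw [hg]; positivity
  have hg0' : ∀ j, 0 ≤ g' j := fun j => by rw [hg']; positivity
  refine ⟨(∑' j, g j) * ∑' k, g' k, mul_nonneg (tsum_nonneg hg0) (tsum_nonneg hg0'),
    fun ω hω n n' x => ?_⟩
  rw [← sum_evolveIncr, ← sum_evolveIncr]
  refine (norm_cov_sum_le hω.1.toIsState (g := g) (g' := g') (w := siteWeight p x)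
    fun j _ k _ => hle ω hω j k _ _ (localAlg_mono (ball_mono (by gcongr; exact le_max_left m m')) (hm j))
      (localAlg_mono (ball_mono (by gcongr; exact le_max_right m m')) (hm' k)) x).trans ?_
  have h1 := hgs.sum_le_tsum (Finset.range (n + 1)) fun j _ => hg0 j
  have h2 := hgs'.sum_le_tsum (Finset.range (n' + 1)) fun j _ => hg0' j
  have h3 := Finset.sum_nonneg fun j (_ : j ∈ Finset.range (n' + 1)) => hg0' j
  have h4 := (siteWeight_pos p x).le
  have h5 : 0 ≤ ∑' j, g j := tsum_nonneg hg0
  gcongr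

theorem exists_symForm_evolveObs_le (hD : 1 ≤ D) {h : O.obs} (hh : star h = h) {t : ℝ}
    (ht : 0 ≤ t) {p ν a : ℝ} (hp : (D : ℝ) < p) (hν : 0 < ν) (A : O.obs) :
    ∃ M : ℝ, ∀ ω : O.Alg → ℂ, IsPClustering p (fun ℓ => ν * (ℓ : ℝ) ^ a) ω → ∀ n : ℕ,
      (symForm ω (emb (evolveObs h t n A)) (emb (evolveObs h t n A))).re ≤ M := by
  have hp0 : 0 < p := lt_of_le_of_lt (Nat.cast_nonneg D) hp
  obtain ⟨M, hM, hle⟩ := exists_norm_cov_evolveObs_le (a := a) hD hh ht ht hp0 hν A A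
  obtain ⟨M', hM', hle'⟩ := exists_norm_cov_evolveObs_le (a := a) hD hh ht ht hp0 hν (star A) (star A)
  refine ⟨∑' x : Site D, (M + M') * siteWeight p x, fun ω hω n => ?_⟩
  have h1 : ∀ x : Site D, M * siteWeight p x ≤ (M + M') * siteWeight p x := fun x => by
    have := (siteWeight_pos p x).le
    gcongr; linarith
  have h2 : ∀ x : Site D, M' * siteWeight p x ≤ (M + M') * siteWeight p x := fun x => by
    have := (siteWeight_pos p x).le
    gcongr; linarith
  refine symForm_self_re_le ((summable_siteWeight hD hp).mul_left _)
    (fun x => (hle ω hω n n x).trans (h1 x)) fun x => ?_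
  rw [← emb_star, ← evolveObs_star hh]
  exact (hle' ω hω n n x).trans (h2 x)

/-- Susceptibilities of finite-volume evolutions converge to those of the infinite-volume evolution, in
both volumes jointly, by dominated convergence. -/
theorem tendsto_symForm_evolveObs (hD : 1 ≤ D) {h : O.obs} (hh : star h = h) {t t' : ℝ}
    (ht : 0 ≤ t) (ht' : 0 ≤ t') {p ν a : ℝ} (hp : (D : ℝ) < p) (hν : 0 < ν)
    (hω : IsPClustering p (fun ℓ => ν * (ℓ : ℝ) ^ a) ω) (A B : O.obs) :
    Tendsto (fun q : ℕ × ℕ => symForm ω (emb (evolveObs h t q.1 A)) (emb (evolveObs h t' q.2 B)))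
      (atTop ×ˢ atTop) (𝓝 (symForm ω (evolve h t (emb A)) (evolve h t' (emb B)))) := by
  have hp0 : 0 < p := lt_of_le_of_lt (Nat.cast_nonneg D) hp
  obtain ⟨M, hM, hle⟩ := exists_norm_cov_evolveObs_le (a := a) hD hh ht ht' hp0 hν A B
  obtain ⟨M', hM', hle'⟩ := exists_norm_cov_evolveObs_le (a := a) hD hh ht' ht hp0 hν (star B) (star A)
  have h1 : ∀ x : Site D, M * siteWeight p x ≤ (M + M') * siteWeight p x := fun x => by
    have := (siteWeight_pos p x).le
    gcongr; linarith
  have h2 : ∀ x : Site D, M' * siteWeight p x ≤ (M + M') * siteWeight p x := fun x => by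
    have := (siteWeight_pos p x).le
    gcongr; linarith
  have hA : Tendsto (fun q : ℕ × ℕ => emb (evolveObs h t q.1 A)) (atTop ×ˢ atTop)
      (𝓝 (evolve h t (emb A))) := (tendsto_heis_evolve hD hh ht _).comp tendsto_fst
  have hB : Tendsto (fun q : ℕ × ℕ => emb (evolveObs h t' q.2 B)) (atTop ×ˢ atTop)
      (𝓝 (evolve h t' (emb B))) := (tendsto_heis_evolve hD hh ht' _).comp tendsto_snd
  refine tendsto_symForm ((summable_siteWeight hD hp).mul_left (M + M'))
    (fun x => tendsto_cov hω.1.toIsState hA hB x)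
    (fun x => tendsto_cov hω.1.toIsState hB.star hA.star x)
    (fun q x => (hle ω hω _ _ x).trans (h1 x)) fun q x => ?_
  rw [← emb_star, ← evolveObs_star hh, ← emb_star, ← evolveObs_star hh]
  exact (hle' ω hω _ _ x).trans (h2 x)

theorem tendsto_symForm_evolveObs_left (hD : 1 ≤ D) {h : O.obs} (hh : star h = h) {t : ℝ}
    (ht : 0 ≤ t) {p ν a : ℝ} (hp : (D : ℝ) < p) (hν : 0 < ν)
    (hω : IsPClustering p (fun ℓ => ν * (ℓ : ℝ) ^ a) ω) (A B : O.obs) :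
    Tendsto (fun n => symForm ω (emb (evolveObs h t n A)) (emb B)) atTop
      (𝓝 (symForm ω (evolve h t (emb A)) (emb B))) := by
  have h1 := (tendsto_symForm_evolveObs hD hh ht le_rfl hp hν hω A B).comp
    (tendsto_id.prodMk tendsto_id)
  rw [evolve_zero] at h1
  refine h1.congr fun n => ?_
  simp only [Function.comp_apply, id, evolveObs_zero]

/-- The susceptibilities of evolved observables are those of the evolved state. -/
theorem symForm_evolve (hD : 1 ≤ D) {h : O.obs} (hh : star h = h) {t : ℝ} (ht : 0 ≤ t)
    (A B : O.obs) : symForm ω (evolve h t (emb A)) (evolve h t (emb B))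
      = symForm (fun a => ω (evolve h t a)) (emb A) (emb B) := by
  have h1 : ∀ A B : O.obs, leftForm ω (evolve h t (emb A)) (evolve h t (emb B))
      = leftForm (fun a => ω (evolve h t a)) (emb A) (emb B) := fun A B => by
    refine tsum_congr fun x => ?_
    dsimp only
    rw [evolve_mul hD hh ht, evolve_star hD hh ht, evolve_star hD hh ht, ← emb_shiftObs,
      shift_evolve hD hh ht]
  rw [symForm, symForm, h1, ← evolve_star hD hh ht, ← evolve_star hD hh ht, ← emb_star,
    ← emb_star, h1]

/-- Additivity with one evolved argument follows from that on local observables by approximation. -/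
theorem symForm_evolve_add_right (hD : 1 ≤ D) {h : O.obs} (hh : star h = h) {t : ℝ}
    (ht : 0 ≤ t) {p ν a : ℝ} (hp : (D : ℝ) < p) (hν : 0 < ν) (hcl : IsClustering ω)
    (hω : IsPClustering p (fun ℓ => ν * (ℓ : ℝ) ^ a) ω) (A B C : O.obs) :
    symForm ω (evolve h t (emb A)) (emb (B + C))
      = symForm ω (evolve h t (emb A)) (emb B) + symForm ω (evolve h t (emb A)) (emb C) :=
  tendsto_nhds_unique (tendsto_symForm_evolveObs_left hD hh ht hp hν hω A (B + C))
    (((tendsto_symForm_evolveObs_left hD hh ht hp hν hω A B).add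
      (tendsto_symForm_evolveObs_left hD hh ht hp hν hω A C)).congr fun _ =>
        (hcl.symForm_add_right hD _ _ _).symm)

end EvolvedForms

/-! ### Evolved charges -/

section EvolvedCharges

variable {D d : ℕ} {O : ObsAlgebra D d} {ω : O.Alg → ℂ}

/-- The evolved charge `A ↦ P (τ_t A)`, where the quasi-local observable `τ_t A` is approximated by
the evolutions in balls. -/
def evolveCharge (P : O.obs → ℂ) (h : O.obs) (t : ℝ) (A : O.obs) : ℂ :=
  limUnder atTop fun n => P (evolveObs h t n A)

variable (hD : 1 ≤ D) {h : O.obs} (hh : star h = h) {t : ℝ} (ht : 0 ≤ t) {p ν a K : ℝ}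
  (hp : (D : ℝ) < p) (hν : 0 < ν) (hcl : IsClustering ω)
  (hω : IsPClustering p (fun ℓ => ν * (ℓ : ℝ) ^ a) ω) (P : O.obs →ₗ[ℂ] ℂ)
  (hP : ∀ A, ‖P A‖ ≤ K * √(symForm ω (emb A) (emb A)).re)

include hD hh ht hp hν hcl hω hP

/-- The finite-volume evolutions are Cauchy in the seminorm of the susceptibility form, so the values
of a bounded charge on them converge. -/
theorem tendsto_evolveCharge (A : O.obs) :
    Tendsto (fun n => P (evolveObs h t n A)) atTop (𝓝 (evolveCharge P h t A)) := by
  have hB := hcl.isPosForm_symForm hD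
  have h0 := tendsto_symForm_evolveObs hD hh ht ht hp hν hω A A
  have h1 : Tendsto (fun q : ℕ × ℕ => symForm ω (emb (evolveObs h t q.1 A - evolveObs h t q.2 A))
      (emb (evolveObs h t q.1 A - evolveObs h t q.2 A))) (atTop ×ˢ atTop) (𝓝 0) := by
    have h11 := h0.comp (tendsto_fst.prodMk tendsto_fst :
      Tendsto (fun q : ℕ × ℕ => (q.1, q.1)) (atTop ×ˢ atTop) (atTop ×ˢ atTop))
    have h21 := h0.comp (tendsto_snd.prodMk tendsto_fst :
      Tendsto (fun q : ℕ × ℕ => (q.2, q.1)) (atTop ×ˢ atTop) (atTop ×ˢ atTop))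
    have h22 := h0.comp (tendsto_snd.prodMk tendsto_snd :
      Tendsto (fun q : ℕ × ℕ => (q.2, q.2)) (atTop ×ˢ atTop) (atTop ×ˢ atTop))
    have h3 := (h11.sub h21).sub (h0.sub h22)
    simp only [sub_self] at h3
    refine h3.congr fun q => ?_
    have e : ∀ X Y Z : O.obs, symForm ω (emb (X - Y)) (emb Z)
        = symForm ω (emb X) (emb Z) - symForm ω (emb Y) (emb Z) := hB.sub_left
    have e' : ∀ X Y Z : O.obs, symForm ω (emb X) (emb (Y - Z))
        = symForm ω (emb X) (emb Y) - symForm ω (emb X) (emb Z) := fun X Y Z => by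
      rw [← conj_symForm hω.1, e, map_sub, conj_symForm hω.1, conj_symForm hω.1]
    rw [e', e, e]
    rfl
  have h2 : CauchySeq fun n => P (evolveObs h t n A) := by
    rw [cauchySeq_iff_tendsto_dist_atTop_0, ← prod_atTop_atTop_eq]
    have h3 := ((Real.continuous_sqrt.comp Complex.continuous_re).tendsto _).comp h1
    have h4 := h3.const_mul K
    simp only [Function.comp_apply, Complex.zero_re, Real.sqrt_zero, mul_zero] at h4
    refine squeeze_zero (fun _ => dist_nonneg) (fun q => ?_) h4
    rw [dist_eq_norm, ← map_sub]
    exact hP _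
  exact tendsto_nhds_limUnder (cauchySeq_tendsto_of_complete h2)

theorem evolveCharge_add (A B : O.obs) :
    evolveCharge P h t (A + B) = evolveCharge P h t A + evolveCharge P h t B :=
  tendsto_nhds_unique (tendsto_evolveCharge hD hh ht hp hν hcl hω P hP _)
    (((tendsto_evolveCharge hD hh ht hp hν hcl hω P hP A).add
      (tendsto_evolveCharge hD hh ht hp hν hcl hω P hP B)).congr fun n => by
        rw [evolveObs_add, map_add])

theorem evolveCharge_smul (c : ℂ) (A : O.obs) :
    evolveCharge P h t (c • A) = c * evolveCharge P h t A :=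
  tendsto_nhds_unique (tendsto_evolveCharge hD hh ht hp hν hcl hω P hP _)
    (((tendsto_evolveCharge hD hh ht hp hν hcl hω P hP A).const_mul c).congr fun n => by
        rw [evolveObs_smul, map_smul, smul_eq_mul])

/-- If the functional `⟨⟨b, ·⟩⟩` approximates `P` in the dual seminorm, it approximates the evolved
charge equally well, in the seminorm of the evolved state. -/
theorem norm_evolveCharge_sub_le {b : O.obs} {ε : ℝ}
    (hb : ∀ C, ‖P C - symForm ω (emb b) (emb C)‖ ≤ ε * √(symForm ω (emb C) (emb C)).re)
    (A : O.obs) :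
    ‖evolveCharge P h t A - (starRingEnd ℂ) (symForm ω (evolve h t (emb A)) (emb b))‖
      ≤ ε * √(symForm (fun a => ω (evolve h t a)) (emb A) (emb A)).re := by
  rw [← symForm_evolve hD hh ht]
  have h1 := (tendsto_symForm_evolveObs hD hh ht ht hp hν hω A A).comp
    (tendsto_id.prodMk tendsto_id)
  have h2 := (((Real.continuous_sqrt.comp Complex.continuous_re).tendsto _).comp h1).const_mul ε
  have h3 := (Complex.continuous_conj.tendsto _).comp
    (tendsto_symForm_evolveObs_left hD hh ht hp hν hω A b)
  refine le_of_tendsto_of_tendsto'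
    ((tendsto_evolveCharge hD hh ht hp hν hcl hω P hP A).sub h3).norm h2 fun n => ?_
  have h4 := hb (evolveObs h t n A)
  rw [← conj_symForm hω.1] at h4
  exact h4

theorem norm_evolveCharge_le (A : O.obs) :
    ‖evolveCharge P h t A‖ ≤ K * √(symForm (fun a => ω (evolve h t a)) (emb A) (emb A)).re := by
  have h0 : ∀ C : O.obs, symForm ω (emb C) (emb (0 : O.obs)) = 0 := fun C => by
    have := symForm_smul_right hω.1 (emb C) (emb (0 : O.obs)) 0
    simpa [emb_zero] using this
  have h1 := norm_evolveCharge_sub_le hD hh ht hp hν hcl hω P hP (b := 0) (ε := K) (fun C => by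
    rw [← conj_symForm hω.1, h0, map_zero, sub_zero]; exact hP C) A
  have h2 : symForm ω (evolve h t (emb A)) (emb (0 : O.obs)) = 0 :=
    tendsto_nhds_unique (tendsto_symForm_evolveObs_left hD hh ht hp hν hω A 0)
      (tendsto_const_nhds.congr fun n => (h0 _).symm)
  rwa [h2, map_zero, sub_zero] at h1

omit ht

/-- Weak convergence: if the susceptibilities of the evolved observable converge and its seminorm
stays bounded, the values of every bounded charge converge, since a bounded charge is a uniform
limit of susceptibilities. -/
theorem exists_tendsto_evolveCharge {A : O.obs} {M : ℝ}
    (hM : ∀ t : ℝ, 0 ≤ t → (symForm (fun a => ω (evolve h t a)) (emb A) (emb A)).re ≤ M)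
    (hlim : ∀ B : O.obs, ∃ c, Tendsto (fun t : ℝ => symForm ω (evolve h t (emb A)) (emb B)) atTop
      (𝓝 c)) :
    ∃ c, Tendsto (fun t : ℝ => evolveCharge P h t A) atTop (𝓝 c) := by
  refine cauchySeq_tendsto_of_complete (Metric.cauchySeq_iff.2 fun ε hε => ?_)
  have hδ : 0 < ε / (3 * (√M + 1)) := by positivity
  obtain ⟨b, hb⟩ := (hcl.isPosForm_symForm hD).exists_approx_riesz P hP hδ
  obtain ⟨c, hc⟩ := hlim b
  have hc' := (Complex.continuous_conj.tendsto _).comp hc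
  obtain ⟨N, hN⟩ := Metric.cauchySeq_iff.1 hc'.cauchySeq (ε / 3) (by positivity)
  have hap : ∀ t, 0 ≤ t → dist (evolveCharge P h t A)
      ((starRingEnd ℂ) (symForm ω (evolve h t (emb A)) (emb b))) < ε / 3 := fun t ht => by
    rw [dist_eq_norm]
    refine (norm_evolveCharge_sub_le hD hh ht hp hν hcl hω P hP hb A).trans_lt ?_
    have h1 := Real.sqrt_le_sqrt (hM t ht)
    calc _ ≤ ε / (3 * (√M + 1)) * √M := by gcongr
      _ < ε / (3 * (√M + 1)) * (√M + 1) := by gcongr; linarith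
      _ = ε / 3 := by field_simp
  refine ⟨max N 0, fun s hs t ht => ?_⟩
  have h1 := hap s ((le_max_right _ _).trans hs)
  have h2 := hap t ((le_max_right _ _).trans ht)
  have h3 := hN s ((le_max_left _ _).trans hs) t ((le_max_left _ _).trans ht)
  have h4 := dist_triangle4 (evolveCharge P h s A)
    ((starRingEnd ℂ) (symForm ω (evolve h s (emb A)) (emb b)))
    ((starRingEnd ℂ) (symForm ω (evolve h t (emb A)) (emb b))) (evolveCharge P h t A)
  rw [dist_comm ((starRingEnd ℂ) (symForm ω (evolve h t (emb A)) (emb b)))] at h4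
  simp only [Function.comp_apply] at h3
  linarith

/-- It is enough to have the convergence of susceptibilities on a spanning sequence. -/
theorem exists_tendsto_evolveCharge_of_span {e : ℕ → O.obs}
    (he : Submodule.span ℂ (Set.range e) = ⊤)
    (hM : ∀ A : O.obs, ∃ M : ℝ, ∀ t : ℝ, 0 ≤ t →
      (symForm (fun a => ω (evolve h t a)) (emb A) (emb A)).re ≤ M)
    (hlim : ∀ i j, ∃ c, Tendsto (fun t : ℝ => symForm ω (evolve h t (emb (e i))) (emb (e j))) atTop
      (𝓝 c)) (A : O.obs) :
    ∃ c, Tendsto (fun t : ℝ => evolveCharge P h t A) atTop (𝓝 c) := by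
  have hA : A ∈ Submodule.span ℂ (Set.range e) := he ▸ Submodule.mem_top
  induction hA using Submodule.span_induction with
  | mem x hx =>
    obtain ⟨i, rfl⟩ := hx
    obtain ⟨M, hM'⟩ := hM (e i)
    refine exists_tendsto_evolveCharge hD hh hp hν hcl hω P hP hM' fun B => ?_
    have hB : B ∈ Submodule.span ℂ (Set.range e) := he ▸ Submodule.mem_top
    induction hB using Submodule.span_induction with
    | mem x hx =>
      obtain ⟨j, rfl⟩ := hx
      exact hlim i j
    | zero =>
      refine ⟨0, tendsto_const_nhds.congr fun t => ?_⟩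
      have := symForm_smul_right hω.1 (evolve h t (emb (e i))) (emb (0 : O.obs)) 0
      rw [← emb_smul, zero_smul, zero_mul] at this
      exact this.symm
    | add x y _ _ hx hy =>
      obtain ⟨c, hc⟩ := hx
      obtain ⟨c', hc'⟩ := hy
      refine ⟨c + c', (hc.add hc').congr' ?_⟩
      filter_upwards [eventually_ge_atTop 0] with t ht
      exact (symForm_evolve_add_right hD hh ht hp hν hcl hω _ _ _).symm
    | smul z x _ hx =>
      obtain ⟨c, hc⟩ := hx
      exact ⟨z * c, (hc.const_mul z).congr fun t => by rw [emb_smul, symForm_smul_right hω.1]⟩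
  | zero =>
    refine ⟨0, tendsto_const_nhds.congr' ?_⟩
    filter_upwards [eventually_ge_atTop 0] with t ht
    have := evolveCharge_smul hD hh ht hp hν hcl hω P hP 0 0
    rw [zero_smul, zero_mul] at this
    exact this.symm
  | add x y _ _ hx hy =>
    obtain ⟨c, hc⟩ := hx
    obtain ⟨c', hc'⟩ := hy
    refine ⟨c + c', (hc.add hc').congr' ?_⟩
    filter_upwards [eventually_ge_atTop 0] with t ht
    exact (evolveCharge_add hD hh ht hp hν hcl hω P hP _ _).symm
  | smul z x _ hx =>
    obtain ⟨c, hc⟩ := hx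
    refine ⟨z * c, (hc.const_mul z).congr' ?_⟩
    filter_upwards [eventually_ge_atTop 0] with t ht
    exact (evolveCharge_smul hD hh ht hp hν hcl hω P hP _ _).symm

end EvolvedCharges

end ObsAlgebra

/-! ### Integrals of bounded families -/

/-- Bounded convergence on `[0, 1]` and all its subintervals. -/
theorem tendsto_integral_of_bounded {ι : Type*} {l : Filter ι} [l.NeBot] [l.IsCountablyGenerated]
    {F : ι → ℝ → ℂ} {f : ℝ → ℂ} {M : ℝ} (hF : ∀ i, IntervalIntegrable (F i) volume 0 1)
    (hM : ∀ i, ∀ s ∈ Set.Icc (0 : ℝ) 1, ‖F i s‖ ≤ M)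
    (hlim : ∀ᵐ s ∂(volume.restrict (Set.Icc (0 : ℝ) 1)), Tendsto (fun i => F i s) l (𝓝 (f s))) :
    IntervalIntegrable f volume 0 1 ∧ ∀ s₁ s₂ : ℝ, 0 ≤ s₁ → s₁ ≤ s₂ → s₂ ≤ 1 →
      Tendsto (fun i => ∫ s in s₁..s₂, F i s) l (𝓝 (∫ s in s₁..s₂, f s)) := by
  have hF' : ∀ i, IntegrableOn (F i) (Set.Icc 0 1) volume := fun i =>
    (intervalIntegrable_iff_integrableOn_Icc_of_le zero_le_one).1 (hF i)
  have hM' : ∀ i, ∀ᵐ s ∂(volume.restrict (Set.Icc (0 : ℝ) 1)), ‖F i s‖ ≤ M := fun i =>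
    (ae_restrict_iff' measurableSet_Icc).2 (Eventually.of_forall (hM i))
  refine ⟨(intervalIntegrable_iff_integrableOn_Icc_of_le zero_le_one).2 ?_, fun s₁ s₂ h1 h2 h3 => ?_⟩
  · have hm : AEStronglyMeasurable f (volume.restrict (Set.Icc (0 : ℝ) 1)) :=
      aestronglyMeasurable_of_tendsto_ae l (fun i => (hF' i).aestronglyMeasurable) hlim
    obtain ⟨u, hu⟩ := l.exists_seq_tendsto
    refine Integrable.of_bound hm M ?_
    filter_upwards [hlim, ae_all_iff.2 fun n => hM' (u n)] with s hs hb
    exact le_of_tendsto (hs.comp hu).norm (Eventually.of_forall hb)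
  · simp_rw [intervalIntegral.integral_of_le h2]
    have hsub : Set.Ioc s₁ s₂ ⊆ Set.Icc 0 1 := fun s hs => ⟨h1.trans hs.1.le, hs.2.trans h3⟩
    have hle : volume.restrict (Set.Ioc s₁ s₂) ≤ volume.restrict (Set.Icc (0 : ℝ) 1) :=
      Measure.restrict_mono hsub le_rfl
    exact MeasureTheory.tendsto_integral_filter_of_dominated_convergence (fun _ => M)
      (Eventually.of_forall fun i => ((hF' i).aestronglyMeasurable.mono_measure hle))
      (Eventually.of_forall fun i => ae_mono hle (hM' i)) (integrable_const M) (ae_mono hle hlim)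

/-- An integrable function all of whose integrals over subintervals vanish is zero. -/
theorem ae_eq_zero_of_integral_eq_zero {f : ℝ → ℂ} (hf : IntervalIntegrable f volume 0 1)
    (h : ∀ s₁ s₂ : ℝ, 0 ≤ s₁ → s₁ < s₂ → s₂ ≤ 1 → ∫ s in s₁..s₂, f s = 0) :
    ∀ᵐ s ∂(volume.restrict (Set.Icc (0 : ℝ) 1)), f s = 0 := by
  have h1 := hf.ae_hasDerivAt_integral
  have h0 : ∀ᵐ s : ℝ, s ≠ 0 := by simp [ae_iff, measure_singleton]
  have h2 : ∀ᵐ s : ℝ, s ≠ 1 := by simp [ae_iff, measure_singleton]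
  rw [ae_restrict_iff' measurableSet_Icc]
  filter_upwards [h1, h0, h2] with s hs hs0 hs1 hmem
  rw [Set.uIcc_of_le zero_le_one] at hs
  have hd := hs hmem 0 ⟨le_rfl, zero_le_one⟩
  have hs' : s ∈ Set.Ioo (0 : ℝ) 1 :=
    ⟨lt_of_le_of_ne hmem.1 (Ne.symm hs0), lt_of_le_of_ne hmem.2 hs1⟩
  refine hd.unique ((hasDerivAt_const s (0 : ℂ)).congr_of_eventuallyEq ?_)
  filter_upwards [Ioo_mem_nhds hs'.1 hs'.2] with u hu
  exact h 0 u le_rfl hu.1 hu.2.le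

namespace ObsAlgebra

variable {D d : ℕ} {O : ObsAlgebra D d}

theorem IsPseudolocalCharge.exists_linearMap {ω : O.Alg → ℂ} {P : O.obs → ℂ} (hω : IsState ω)
    (hP : IsPseudolocalCharge ω P) : ∃ L : O.obs →ₗ[ℂ] ℂ, ⇑L = P := by
  obtain ⟨Q, -, -, hQ⟩ := hP
  refine ⟨{ toFun := P, map_add' := fun A B => ?_, map_smul' := fun c A => ?_ }, rfl⟩
  · refine tendsto_nhds_unique (hQ _) (((hQ A).add (hQ B)).congr fun n => ?_)
    rw [emb_add, mul_add, add_mul, hω.map_add, hω.map_add, hω.map_add, hω.map_add, hω.map_add,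
      hω.map_add]
    ring
  · refine tendsto_nhds_unique (hQ _) (((hQ A).const_mul c).congr fun n => ?_)
    rw [emb_smul, mul_smul_comm, smul_mul_assoc, ← smul_add, hω.map_smul, hω.map_smul]
    ring

/-- Uniform clustering bounds the covariances of an observable by a summable function common to all
states. -/
theorem exists_norm_cov_le {p : ℝ} {ν : ℕ → ℝ} (hp : 0 < p) (hν : ∀ ℓ, 0 ≤ ν ℓ) (A : O.obs) :
    ∃ M : ℝ, ∀ ω : O.Alg → ℂ, IsPClustering p ν ω → ∀ x,
      ‖cov ω (emb A) (emb A) x‖ ≤ M * siteWeight p x ∧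
      ‖cov ω (star (emb A)) (star (emb A)) x‖ ≤ M * siteWeight p x := by
  obtain ⟨m, hm⟩ := exists_ball A
  have hm' : ((star A : O.obs) : Op D d) ∈ localAlg (ball D m) := star_mem hm
  refine ⟨‖A‖ * ‖A‖ * clusterConst D p ν m, fun ω hω x => ⟨norm_cov_le hp hν hω hm hm x, ?_⟩⟩
  have h := norm_cov_le hp hν hω hm' hm' x
  rwa [← norm_emb (star A), emb_star, norm_star_alg, norm_emb] at h

theorem exists_symForm_self_le {p : ℝ} {ν : ℕ → ℝ} (hp : (D : ℝ) < p) (hD : 1 ≤ D)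
    (hν : ∀ ℓ, 0 ≤ ν ℓ) (A : O.obs) :
    ∃ M : ℝ, ∀ ω : O.Alg → ℂ, IsPClustering p ν ω → (symForm ω (emb A) (emb A)).re ≤ M := by
  obtain ⟨M, hM⟩ := exists_norm_cov_le (lt_of_le_of_lt (Nat.cast_nonneg D) hp) hν A
  exact ⟨∑' x : Site D, M * siteWeight p x, fun ω hω =>
    symForm_self_re_le ((summable_siteWeight hD hp).mul_left M) (fun x => (hM ω hω x).1)
      fun x => (hM ω hω x).2⟩

/-- Susceptibilities are continuous under pointwise convergence of uniformly clustering states. -/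
theorem tendsto_symForm_self {p : ℝ} {ν : ℕ → ℝ} (hp : (D : ℝ) < p) (hD : 1 ≤ D)
    (hν : ∀ ℓ, 0 ≤ ν ℓ) (A : O.obs) {ι : Type*} {l : Filter ι} {φ : ι → O.Alg → ℂ} {ω : O.Alg → ℂ}
    (hφ : ∀ i, IsPClustering p ν (φ i)) (h : ∀ a, Tendsto (fun i => φ i a) l (𝓝 (ω a))) :
    Tendsto (fun i => symForm (φ i) (emb A) (emb A)) l (𝓝 (symForm ω (emb A) (emb A))) := by
  obtain ⟨M, hM⟩ := exists_norm_cov_le (lt_of_le_of_lt (Nat.cast_nonneg D) hp) hν A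
  exact tendsto_symForm ((summable_siteWeight hD hp).mul_left M)
    (fun x => (h _).sub ((h _).mul (h _))) (fun x => (h _).sub ((h _).mul (h _)))
    (fun i x => (hM _ (hφ i) x).1) fun i x => (hM _ (hφ i) x).2

/-! ### The stationary flow -/

/-- The long-time limit of a state. -/
def stationaryState (h : O.obs) (ω : O.Alg → ℂ) (a : O.Alg) : ℂ :=
  limUnder atTop fun t : ℝ => ω (evolve h t a)

open Classical in
/-- The long-time limit of a charge; it is set to zero when the limit fails to exist for some
observable, which happens along a flow for a null set of parameters only. -/
def stationaryCharge (h : O.obs) (P : O.obs → ℂ) (A : O.obs) : ℂ :=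
  if ∀ B, ∃ c, Tendsto (fun t : ℝ => evolveCharge P h t B) atTop (𝓝 c) then
    limUnder atTop fun t : ℝ => evolveCharge P h t A else 0

theorem tendsto_stationaryCharge {h : O.obs} {P : O.obs → ℂ}
    (hP : ∀ B, ∃ c, Tendsto (fun t : ℝ => evolveCharge P h t B) atTop (𝓝 c)) (A : O.obs) :
    Tendsto (fun t : ℝ => evolveCharge P h t A) atTop (𝓝 (stationaryCharge h P A)) := by
  rw [stationaryCharge, if_pos hP]
  exact tendsto_nhds_limUnder (hP A)

/-- A flow from the trace with the properties that make it thermalize: the clustering of the flow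
itself has a size function that is a power, the evolved states cluster uniformly with an arbitrary
size function, and susceptibilities of evolved observables converge almost everywhere. -/
structure IsThermalizing (h : O.obs) (ωs : ℝ → O.Alg → ℂ) (P : ℝ → O.obs → ℂ) (p ν a p' : ℝ)
    (ν' : ℕ → ℝ) (K : ℝ) : Prop where
  dim : 1 ≤ D
  star_eq : star h = h
  flow : IsPseudolocalFlow ωs P
  trace : IsTrace (ωs 0)
  lt : (D : ℝ) < p
  pos : 0 < ν
  clustering : ∀ s ∈ Set.Icc (0 : ℝ) 1, IsPClustering p (fun ℓ => ν * (ℓ : ℝ) ^ a) (ωs s)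
  lt' : (D : ℝ) < p'
  nonneg' : ∀ ℓ, 0 ≤ ν' ℓ
  clustering' : ∀ s ∈ Set.Icc (0 : ℝ) 1, ∀ t : ℝ, 0 ≤ t →
    IsPClustering p' ν' fun a => ωs s (evolve h t a)
  bound_nonneg : 0 ≤ K
  bound : ∀ s ∈ Set.Icc (0 : ℝ) 1, ∀ A, ‖P s A‖ ≤ K * √(symForm (ωs s) (emb A) (emb A)).re
  limit : ∀ A B : O.obs, ∀ᵐ s ∂(volume.restrict (Set.Icc (0 : ℝ) 1)), ∃ c : ℂ,
    Tendsto (fun t : ℝ => symForm (ωs s) (evolve h t (emb A)) (emb B)) atTop (𝓝 c)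

namespace IsThermalizing

variable {h : O.obs} {ωs : ℝ → O.Alg → ℂ} {P : ℝ → O.obs → ℂ} {p ν a p' : ℝ} {ν' : ℕ → ℝ} {K : ℝ}
  (T : IsThermalizing h ωs P p ν a p' ν' K)

include T

/-- The charge as a linear functional; linearity holds because it is a limit of linear functionals. -/
theorem exists_charge {s : ℝ} (hs : s ∈ Set.Icc (0 : ℝ) 1) :
    ∃ L : O.obs →ₗ[ℂ] ℂ, ⇑L = P s ∧ ∀ A, ‖L A‖ ≤ K * √(symForm (ωs s) (emb A) (emb A)).re := by
  obtain ⟨L, hL⟩ := (T.flow.charge s hs).exists_linearMap (T.clustering s hs).1.toIsState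
  exact ⟨L, hL, fun A => hL ▸ T.bound s hs A⟩

/-- The flow equation extends to evolved observables. -/
theorem flow_evolve {t : ℝ} (ht : 0 ≤ t) (A : O.obs) :
    IntervalIntegrable (fun s => evolveCharge (P s) h t A) volume 0 1 ∧
      ∀ s₁ s₂ : ℝ, 0 ≤ s₁ → s₁ < s₂ → s₂ ≤ 1 → ωs s₂ (evolve h t (emb A))
        - ωs s₁ (evolve h t (emb A)) = ∫ s in s₁..s₂, evolveCharge (P s) h t A := by
  obtain ⟨M, hM⟩ := exists_symForm_evolveObs_le (a := a) T.dim T.star_eq ht T.lt T.pos A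
  have h1 := tendsto_integral_of_bounded (l := atTop) (F := fun n s => P s (evolveObs h t n A))
    (f := fun s => evolveCharge (P s) h t A) (M := K * √M)
    (fun n => T.flow.integrable _) (fun n s hs => ?_) ?_
  · refine ⟨h1.1, fun s₁ s₂ h2 h3 h4 => ?_⟩
    refine tendsto_nhds_unique ?_ (h1.2 s₁ s₂ h2 h3.le h4)
    have h5 : ∀ s ∈ Set.Icc (0 : ℝ) 1, Tendsto (fun n => ωs s (emb (evolveObs h t n A))) atTop
        (𝓝 (ωs s (evolve h t (emb A)))) := fun s hs =>
      ((T.clustering s hs).1.toIsState.continuous.tendsto _).comp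
        (tendsto_heis_evolve T.dim T.star_eq ht _)
    exact ((h5 s₂ ⟨h2.trans h3.le, h4⟩).sub (h5 s₁ ⟨h2, h3.le.trans h4⟩)).congr fun n =>
      T.flow.flow _ s₁ s₂ h2 h3 h4
  · refine (T.bound s hs _).trans ?_
    have := Real.sqrt_le_sqrt (hM _ (T.clustering s hs) n)
    have := T.bound_nonneg
    gcongr
  · refine (ae_restrict_iff' measurableSet_Icc).2 (Eventually.of_forall fun s hs => ?_)
    obtain ⟨L, hL, hLb⟩ := T.exists_charge hs
    have := tendsto_evolveCharge T.dim T.star_eq ht T.lt T.pos (T.flow.clustering s hs)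
      (T.clustering s hs) L hLb A
    rwa [hL] at this

theorem norm_evolveCharge_le {s : ℝ} (hs : s ∈ Set.Icc (0 : ℝ) 1) {t : ℝ} (ht : 0 ≤ t)
    (A : O.obs) : ‖evolveCharge (P s) h t A‖
      ≤ K * √(symForm (fun a => ωs s (evolve h t a)) (emb A) (emb A)).re := by
  obtain ⟨L, hL, hLb⟩ := T.exists_charge hs
  have := ObsAlgebra.norm_evolveCharge_le T.dim T.star_eq ht T.lt T.pos (T.flow.clustering s hs)
    (T.clustering s hs) L hLb A
  rwa [hL] at this

/-- The null set of the convergence hypothesis depends on the observables; a spanning sequence reduces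
it to a countable union. -/
theorem ae_exists_tendsto_evolveCharge : ∀ᵐ s ∂(volume.restrict (Set.Icc (0 : ℝ) 1)),
    ∀ B, ∃ c, Tendsto (fun t : ℝ => evolveCharge (P s) h t B) atTop (𝓝 c) := by
  obtain ⟨e, he⟩ := exists_spanning_sequence O
  filter_upwards [ae_all_iff.2 fun i => ae_all_iff.2 fun j => T.limit (e i) (e j),
    ae_restrict_mem measurableSet_Icc] with s hlim hs
  obtain ⟨L, hL, hLb⟩ := T.exists_charge hs
  have := exists_tendsto_evolveCharge_of_span T.dim T.star_eq T.lt T.pos (T.flow.clustering s hs)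
    (T.clustering s hs) L hLb he (fun A => ?_) hlim
  · rwa [hL] at this
  · obtain ⟨M, hM⟩ := exists_symForm_self_le T.lt' T.dim T.nonneg' A
    exact ⟨M, fun t ht => hM _ (T.clustering' s hs t ht)⟩

/-- The flow equation for evolved observables survives the limit of long times. -/
theorem tendsto_integral_evolveCharge (A : O.obs) :
    IntervalIntegrable (fun s => stationaryCharge h (P s) A) volume 0 1 ∧
      ∀ s₁ s₂ : ℝ, 0 ≤ s₁ → s₁ < s₂ → s₂ ≤ 1 → Tendsto (fun t : ℝ => ωs s₂ (evolve h t (emb A))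
        - ωs s₁ (evolve h t (emb A))) atTop (𝓝 (∫ s in s₁..s₂, stationaryCharge h (P s) A)) := by
  obtain ⟨M, hM⟩ := exists_symForm_self_le T.lt' T.dim T.nonneg' A
  -- evolutions are controlled for nonnegative times only
  have hmax : Tendsto (fun t : ℝ => max t 0) atTop atTop :=
    tendsto_atTop_mono (fun t => le_max_left t 0) tendsto_id
  have h1 := tendsto_integral_of_bounded (l := (atTop : Filter ℝ))
    (F := fun t s => evolveCharge (P s) h (max t 0) A)
    (f := fun s => stationaryCharge h (P s) A) (M := K * √M)
    (fun t => (T.flow_evolve (le_max_right t 0) A).1) (fun t s hs => ?_) ?_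
  · refine ⟨h1.1, fun s₁ s₂ h2 h3 h4 => (h1.2 s₁ s₂ h2 h3.le h4).congr' ?_⟩
    filter_upwards [eventually_ge_atTop 0] with t ht
    rw [(T.flow_evolve ht A).2 s₁ s₂ h2 h3 h4, max_eq_left ht]
  · refine (T.norm_evolveCharge_le hs (le_max_right t 0) A).trans ?_
    have := Real.sqrt_le_sqrt (hM _ (T.clustering' s hs _ (le_max_right t 0)))
    have := T.bound_nonneg
    gcongr
  · filter_upwards [T.ae_exists_tendsto_evolveCharge] with s hs
    exact (tendsto_stationaryCharge hs A).comp hmax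

/-- The trace is invariant under the evolution, so the flow from the trace shows that all evolved
states converge. -/
theorem tendsto_stationaryState {s : ℝ} (hs : s ∈ Set.Icc (0 : ℝ) 1) (b : O.Alg) :
    Tendsto (fun t : ℝ => ωs s (evolve h t b)) atTop (𝓝 (stationaryState h (ωs s) b)) := by
  have h0 : (0 : ℝ) ∈ Set.Icc (0 : ℝ) 1 := ⟨le_rfl, zero_le_one⟩
  refine tendsto_nhds_limUnder (exists_tendsto_of_local (fun t ht =>
    (T.clustering' s hs t ht).1.toIsState) (fun A => ?_) b)
  have h1 : Tendsto (fun t : ℝ => ωs 0 (evolve h t (emb A))) atTop (𝓝 (ωs 0 (emb A))) := by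
    refine tendsto_const_nhds.congr' ?_
    filter_upwards [eventually_ge_atTop 0] with t ht
    exact (T.trace.map_evolve T.dim T.star_eq ht (T.clustering 0 h0).1.toIsState _).symm
  rcases hs.1.eq_or_lt with h2 | h2
  · exact ⟨_, h2 ▸ h1⟩
  · have h3 := ((T.tendsto_integral_evolveCharge A).2 0 s le_rfl h2 hs.2).add h1
    simp only [sub_add_cancel] at h3
    exact ⟨_, h3⟩

theorem isTrace_stationaryState : IsTrace (stationaryState h (ωs 0)) := by
  have h0 : (0 : ℝ) ∈ Set.Icc (0 : ℝ) 1 := ⟨le_rfl, zero_le_one⟩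
  have h1 : stationaryState h (ωs 0) = ωs 0 := by
    funext b
    refine tendsto_nhds_unique (T.tendsto_stationaryState h0 b) (tendsto_const_nhds.congr' ?_)
    filter_upwards [eventually_ge_atTop 0] with t ht
    exact (T.trace.map_evolve T.dim T.star_eq ht (T.clustering 0 h0).1.toIsState _).symm
  rw [h1]
  exact T.trace

/-- Clustering bounds common to all evolved states pass to the limit; `c` keeps the size function away
from zero. -/
theorem isPClustering_stationaryState {q c : ℝ} {μ : ℕ → ℝ} (hc : 0 < c)
    (hμ : ∀ ℓ, 1 ≤ ℓ → c ≤ μ ℓ) {s : ℝ} (hs : s ∈ Set.Icc (0 : ℝ) 1)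
    (hcl : ∀ t : ℝ, 0 ≤ t → IsPClustering q μ fun a => ωs s (evolve h t a)) :
    IsPClustering q μ (stationaryState h (ωs s)) :=
  IsPClustering.of_tendsto (l := (atTop : Filter ℕ)) hc hμ
    (fun n : ℕ => hcl (n : ℝ) (Nat.cast_nonneg n))
    fun b => (T.tendsto_stationaryState hs b).comp tendsto_natCast_atTop_atTop

theorem uniformlyClustering_stationaryState :
    UniformlyClustering ((fun s => stationaryState h (ωs s)) '' Set.Icc (0 : ℝ) 1) := by
  refine ⟨p', T.lt', fun ℓ => max (ν' ℓ) 1, fun ℓ => lt_max_of_lt_right one_pos, ?_⟩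
  rintro _ ⟨s, hs, rfl⟩
  exact T.isPClustering_stationaryState one_pos (fun ℓ _ => le_max_right _ _) hs fun t ht =>
    (T.clustering' s hs t ht).mono fun ℓ => le_max_left _ _

theorem isClustering_stationaryState {s : ℝ} (hs : s ∈ Set.Icc (0 : ℝ) 1) :
    IsClustering (stationaryState h (ωs s)) := by
  obtain ⟨q, hq, μ, hμ, hcl⟩ := T.uniformlyClustering_stationaryState
  refine ⟨q, hq, μ, hμ, ?_⟩
  rintro _ rfl
  exact hcl _ ⟨s, hs, rfl⟩

theorem norm_stationaryCharge_le {s : ℝ} (hs : s ∈ Set.Icc (0 : ℝ) 1) (A : O.obs) :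
    ‖stationaryCharge h (P s) A‖
      ≤ K * √(symForm (stationaryState h (ωs s)) (emb A) (emb A)).re := by
  by_cases hP : ∀ B, ∃ c, Tendsto (fun t : ℝ => evolveCharge (P s) h t B) atTop (𝓝 c)
  · have h1 := (tendsto_stationaryCharge hP A).comp (tendsto_natCast_atTop_atTop (R := ℝ))
    have h2 := tendsto_symForm_self T.lt' T.dim T.nonneg' A (l := (atTop : Filter ℕ))
      (φ := fun n a => ωs s (evolve h (n : ℝ) a)) (ω := stationaryState h (ωs s))
      (fun n => T.clustering' s hs n (Nat.cast_nonneg n))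
      fun b => (T.tendsto_stationaryState hs b).comp tendsto_natCast_atTop_atTop
    have h3 := (((Real.continuous_sqrt.comp Complex.continuous_re).tendsto _).comp h2).const_mul K
    exact le_of_tendsto_of_tendsto' h1.norm h3 fun n =>
      T.norm_evolveCharge_le hs (Nat.cast_nonneg n) A
  · rw [stationaryCharge, if_neg hP, norm_zero]
    have := T.bound_nonneg
    positivity

theorem exists_stationaryCharge {s : ℝ} (hs : s ∈ Set.Icc (0 : ℝ) 1) :
    ∃ L : O.obs →ₗ[ℂ] ℂ, ⇑L = stationaryCharge h (P s) := by
  obtain ⟨L, hL, hLb⟩ := T.exists_charge hs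
  by_cases hP : ∀ B, ∃ c, Tendsto (fun t : ℝ => evolveCharge (P s) h t B) atTop (𝓝 c)
  · refine ⟨{ toFun := stationaryCharge h (P s), map_add' := fun A B => ?_,
              map_smul' := fun c A => ?_ }, rfl⟩
    · refine tendsto_nhds_unique (tendsto_stationaryCharge hP _)
        (((tendsto_stationaryCharge hP A).add (tendsto_stationaryCharge hP B)).congr' ?_)
      filter_upwards [eventually_ge_atTop 0] with t ht
      rw [← hL]
      exact (evolveCharge_add T.dim T.star_eq ht T.lt T.pos (T.flow.clustering s hs)
        (T.clustering s hs) L hLb A B).symm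
    · refine tendsto_nhds_unique (tendsto_stationaryCharge hP _)
        (((tendsto_stationaryCharge hP A).const_mul c).congr' ?_)
      filter_upwards [eventually_ge_atTop 0] with t ht
      rw [← hL]
      exact (evolveCharge_smul T.dim T.star_eq ht T.lt T.pos (T.flow.clustering s hs)
        (T.clustering s hs) L hLb c A).symm
  · refine ⟨0, ?_⟩
    funext A
    rw [stationaryCharge, if_neg hP]
    rfl

theorem stationary_flow (A : O.obs) (s₁ s₂ : ℝ) (h1 : 0 ≤ s₁) (h2 : s₁ < s₂) (h3 : s₂ ≤ 1) :
    stationaryState h (ωs s₂) (emb A) - stationaryState h (ωs s₁) (emb A)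
      = ∫ s in s₁..s₂, stationaryCharge h (P s) A :=
  tendsto_nhds_unique ((T.tendsto_stationaryState ⟨h1.trans h2.le, h3⟩ _).sub
    (T.tendsto_stationaryState ⟨h1, h2.le.trans h3⟩ _))
    ((T.tendsto_integral_evolveCharge A).2 s₁ s₂ h1 h2 h3)

theorem isPseudolocalFlow_stationaryState :
    IsPseudolocalFlow (fun s => stationaryState h (ωs s)) (fun s => stationaryCharge h (P s)) where
  clustering s hs := T.isClustering_stationaryState hs
  charge s hs := by
    obtain ⟨L, hL⟩ := T.exists_stationaryCharge hs
    have := (T.isClustering_stationaryState hs).isPseudolocalCharge T.dim L (K := K) fun A => by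
      rw [hL]
      exact T.norm_stationaryCharge_le hs A
    rwa [hL] at this
  bounded := ⟨K, fun s hs A => T.norm_stationaryCharge_le hs A⟩
  integrable A := (T.tendsto_integral_evolveCharge A).1
  flow := T.stationary_flow

/-- Limits of `ω ∘ τ_t` for long times are invariant under the evolution. -/
theorem stationaryState_evolve {s : ℝ} (hs : s ∈ Set.Icc (0 : ℝ) 1) {u : ℝ} (hu : 0 ≤ u)
    (b : O.Alg) : stationaryState h (ωs s) (evolve h u b) = stationaryState h (ωs s) b := by
  refine tendsto_nhds_unique (T.tendsto_stationaryState hs (evolve h u b)) ?_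
  refine ((T.tendsto_stationaryState hs b).comp (tendsto_atTop_add_const_right _ u tendsto_id)).congr' ?_
  filter_upwards [eventually_ge_atTop 0] with t ht
  simp only [Function.comp_apply, id]
  rw [evolve_evolve T.dim T.star_eq hu ht]

/-- An invariant state vanishes on the generator of the evolution. -/
theorem stationaryState_lieAction {s : ℝ} (hs : s ∈ Set.Icc (0 : ℝ) 1) (A : O.obs) :
    stationaryState h (ωs s) (emb (lieAction h A)) = 0 := by
  obtain ⟨C, hC⟩ := exists_evolve_taylor T.dim T.star_eq A
  have hst := (T.isClustering_stationaryState hs).isInvariantState.toIsState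
  set z := stationaryState h (ωs s) (emb (lieAction h A)) with hz
  have h1 : ∀ t : ℝ, 0 < t → ‖z‖ ≤ t * C := fun t ht => by
    have h2 := (hst.norm_le _).trans (hC t ht.le)
    rw [hst.map_sub, hst.map_sub, T.stationaryState_evolve hs ht.le, sub_self, zero_sub, norm_neg,
      hst.map_smul, hst.map_smul, norm_mul, norm_mul, Complex.norm_I, one_mul, Complex.norm_real,
      Real.norm_of_nonneg ht.le, sq, mul_assoc] at h2
    exact le_of_mul_le_mul_left h2 ht
  have h2 : Tendsto (fun t : ℝ => t * C) (𝓝[>] 0) (𝓝 (0 * C)) :=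
    (tendsto_id.mono_left nhdsWithin_le_nhds).mul_const C
  rw [zero_mul] at h2
  have h3 : ‖z‖ ≤ 0 := ge_of_tendsto h2 (eventually_mem_nhdsWithin.mono h1)
  exact norm_le_zero_iff.1 h3

/-- The stationary states vanish on the generator for all `s`, and differentiating the flow in `s`
transfers this to almost all charges. -/
theorem conservedAlong_stationaryState :
    ConservedAlong h (fun s => stationaryState h (ωs s)) (fun s => stationaryCharge h (P s)) := by
  obtain ⟨e, he⟩ := exists_spanning_sequence O
  have h1 : ∀ i, ∀ᵐ s ∂(volume.restrict (Set.Icc (0 : ℝ) 1)),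
      stationaryCharge h (P s) (lieAction h (e i)) = 0 := fun i =>
    ae_eq_zero_of_integral_eq_zero (T.tendsto_integral_evolveCharge _).1 fun s₁ s₂ h1 h2 h3 => by
      rw [← T.stationary_flow _ s₁ s₂ h1 h2 h3, T.stationaryState_lieAction ⟨h1.trans h2.le, h3⟩,
        T.stationaryState_lieAction ⟨h1, h2.le.trans h3⟩, sub_zero]
  filter_upwards [ae_all_iff.2 h1, ae_restrict_mem measurableSet_Icc] with s hs hmem
  refine ⟨T.stationaryState_lieAction hmem, fun A => ?_⟩
  obtain ⟨L, hL⟩ := T.exists_stationaryCharge hmem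
  rw [← hL] at hs ⊢
  have hA : A ∈ Submodule.span ℂ (Set.range e) := he ▸ Submodule.mem_top
  induction hA using Submodule.span_induction with
  | mem x hx =>
    obtain ⟨i, rfl⟩ := hx
    exact hs i
  | zero =>
    have := lieAction_smul h 0 0
    rw [zero_smul, zero_smul] at this
    rw [this, map_zero]
  | add x y _ _ hx hy => rw [lieAction_add, map_add, hx, hy, add_zero]
  | smul c x _ hx => rw [lieAction_smul, map_smul, hx, smul_zero]

end IsThermalizing

end ObsAlgebra
end SpinLattice

end

/-- Generalized thermalization. -/
theorem mainTheorem1 {D d : ℕ} (hD : 1 ≤ D) (hd : 1 ≤ d) (O : ObsAlgebra D d)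
    (h : O.obs) (hh : star h = h)
    (ω : O.Alg → ℂ) (ωs : ℝ → O.Alg → ℂ) (P : ℝ → O.obs → ℂ)
    (hω : IsPseudolocalState ω ωs P)
    (ha : UniformlyClustering
      {φ : O.Alg → ℂ | ∃ s ∈ Set.Icc (0 : ℝ) 1, ∃ t : ℝ, 0 ≤ t ∧
        φ = fun a => ωs s (evolve h t a)})
    (hb : ∀ A B : O.obs, ∀ᵐ s ∂(volume.restrict (Set.Icc (0 : ℝ) 1)), ∃ c : ℂ,
      Tendsto (fun t : ℝ => symForm (ωs s)
        (evolve h t (emb A))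
        (emb B)) atTop (𝓝 c)) :
    ∃ ωsta : O.Alg → ℂ,
      (∀ a : O.Alg, Tendsto (fun t : ℝ => ω (evolve h t a)) atTop
        (𝓝 (ωsta a))) ∧
      IsWeakGGE h ωsta ∧
      ((∃ p : ℝ, (D : ℝ) < p ∧ UniformlySizablyClustering p
          {φ : O.Alg → ℂ | ∃ s ∈ Set.Icc (0 : ℝ) 1, ∃ t : ℝ, 0 ≤ t ∧
            φ = fun a => ωs s (evolve h t a)}) →
        IsGGE h ωsta) := by
  obtain ⟨p, hp, ν, a, hν, -, hcl⟩ := hω.uniform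
  obtain ⟨p', hp', ν', hν', hcl'⟩ := ha
  obtain ⟨K, hK⟩ := hω.flow.bounded
  have T : IsThermalizing h ωs P p ν a p' ν' |K| :=
    { dim := hD
      star_eq := hh
      flow := hω.flow
      trace := hω.trace
      lt := hp
      pos := hν
      clustering := fun s hs => hcl _ ⟨s, hs, rfl⟩
      lt' := hp'
      nonneg' := fun ℓ => (hν' ℓ).le
      clustering' := fun s hs t ht => hcl' _ ⟨s, hs, t, ht, rfl⟩
      bound_nonneg := abs_nonneg K
      bound := fun s hs A => (hK s hs A).trans (by gcongr; exact le_abs_self K)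
      limit := hb }
  have h1 : (1 : ℝ) ∈ Set.Icc (0 : ℝ) 1 := ⟨zero_le_one, le_rfl⟩
  refine ⟨stationaryState h (ωs 1), fun b => ?_, ?_, ?_⟩
  · rw [← hω.endpoint]
    exact T.tendsto_stationaryState h1 b
  · exact ⟨_, _, ⟨T.isPseudolocalFlow_stationaryState, T.uniformlyClustering_stationaryState,
      T.isTrace_stationaryState, rfl⟩, T.conservedAlong_stationaryState⟩
  · rintro ⟨q, hq, μ, b, hμ, hb', hcl''⟩
    refine ⟨_, _, ⟨T.isPseudolocalFlow_stationaryState, ⟨q, hq, μ, b, hμ, hb', ?_⟩,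
      T.isTrace_stationaryState, rfl⟩, T.conservedAlong_stationaryState⟩
    rintro _ ⟨s, hs, rfl⟩
    refine T.isPClustering_stationaryState hμ (fun ℓ hℓ => ?_) hs fun t ht =>
      hcl'' _ ⟨s, hs, t, ht, rfl⟩
    exact le_mul_of_one_le_right hμ.le (Real.one_le_rpow (by exact_mod_cast hℓ) hb'.le)
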